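/- Let $d_A,d_B,d_C\ge 1$ be integers with $d_A\ge d_C$, let $\mathcal A,\mathcal B,\mathcal C$ be alphabets of these sizes, and let $\varepsilon>0$. For a distribution $P=P_{ABC}$ on $\mathcal A\times\mathcal B\times\mathcal C$ let $P_{AB}P_{C|B}$ be the distribution $(a,b,c)\mapsto P_{AB}(a,b)\,P_{BC}(b,c)/P_B(b)$ (read as $0$ where $P_B(b)=0$). For a distance measure $\Delta$, let $\mathrm{SC}_{\Delta}(\varepsilon,d_A,d_B,d_C)$ be the least $N$ for which there is a (possibly randomized) tester that, given $N$ i.i.d. samples from an unknown $P$, answers "Yes" with probability at least $2/3$ whenever $\Delta(P\|P_{AB}P_{C|B})=0$ and "No" with probability at least $2/3$ whenever $\Delta(P\|P_{AB}P_{C|B})\ge\varepsilon$. Write $\mathrm{SC}_{\mathrm{CI},H}$ for $\Delta=D_H^2$, $D_H^2(P,Q)=\frac12\sum_x(\sqrt{P(x)}-\sqrt{Q(x)})^2$ (conditional independence testing in squared Hellinger distance), and $\mathrm{SC}_{\mathrm{CMI}}$ for $\Delta=D$, $D(P\|Q)=\sum_x P(x)\log\frac{P(x)}{Q(x)}$ (CMI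 testing, as $D(P\|P_{AB}P_{C|B})=I(A:C|B)_P$). Put $$f_{\mathrm{sym}}=\max\left\{\frac{d_A^{1/2}d_B^{3/4}d_C^{1/2}}{\varepsilon},\ \min\left\{\frac{d_A^{1/4}d_B^{7/8}d_C^{1/4}}{\varepsilon},\frac{d_A^{2/7}d_B^{6/7}d_C^{2/7}}{\varepsilon^{8/7}}\right\}\right\},\qquad f_{\mathrm{asym}}=\min\left\{\frac{d_A^{3/4}d_B^{3/4}d_C^{1/4}}{\varepsilon},\frac{d_A^{2/3}d_B^{2/3}d_C^{1/3}}{\varepsilon^{4/3}}\right\}.$$ There are absolute constants $K>0$ and $k\in\mathbb N$ such that, for all such $d_A,d_B,d_C,\varepsilon$, 1. $\mathrm{SC}_{\mathrm{CI},H}(\varepsilon,d_A,d_B,d_C)\le K\log^k\!\left(2+\frac{d_Ad_Bd_C}{\varepsilon}\right)\max\{f_{\mathrm{sym}},f_{\mathrm{asym}}\}$; 2. $\mathrm{SC}_{\mathrm{CMI}}(\varepsilon,d_A,d_B,d_C)\le K\log^k\!\left(2+\frac{d_Ad_Bd_C}{\varepsilon}\right)\max\{f_{\mathrm{sym}},f_{\mathrm{asym}}\}$;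 3. $\mathrm{SC}_{\mathrm{CMI}}(\varepsilon,d_A,d_B,d_C)\le \mathrm{SC}_{\mathrm{CI},H}(\nu,d_A,d_B,d_C)$ with $\nu=\varepsilon\big/\left(K\log\left(2+\frac{d_Ad_C}{\varepsilon}\right)\right)$. -/

import Mathlib

open scoped ENNReal

noncomputable section

namespace CMITest

/-- Kullback-Leibler divergence `∑ P log (P / Q)` (natural logarithm, `0 log 0 = 0`) of two
distributions on a finite set. It is only used where the support of `Q` contains that of `P`. -/
def klDivergence {X : Type} [Fintype X] (P Q : X → ℝ) : ℝ :=
  ∑ x, P x * Real.log (P x / Q x)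

/-- Squared Hellinger distance, with the normalization `1 / 2`. -/
def hellingerSq {X : Type} [Fintype X] (P Q : X → ℝ) : ℝ :=
  (1 / 2) * ∑ x, (Real.sqrt (P x) - Real.sqrt (Q x)) ^ 2

section Marginals

variable {A B C : Type} [Fintype A] [Fintype B] [Fintype C]

/-- The marginal `P_{AB}`. -/
def margAB (P : A × B × C → ℝ) (a : A) (b : B) : ℝ := ∑ c, P (a, b, c)

/-- The marginal `P_{BC}`. -/
def margBC (P : A × B × C → ℝ) (b : B) (c : C) : ℝ := ∑ a, P (a, b, c)

/-- The marginal `P_B`. -/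
def margB (P : A × B × C → ℝ) (b : B) : ℝ := ∑ a, ∑ c, P (a, b, c)

/-- The conditional distribution `P_{C|B}(c|b)`; its value where `P_B(b) = 0` is immaterial. -/
def condCB (P : A × B × C → ℝ) (c : C) (b : B) : ℝ := margBC P b c / margB P b

/-- The Markov reference distribution `P_{AB} P_{C|B}` built from `P_{ABC}`. -/
def markovRef (P : A × B × C → ℝ) : A × B × C → ℝ :=
  fun x => margAB P x.1 x.2.1 * condCB P x.2.2 x.2.1

end Marginals

/-- A randomized tester using `N` samples from `X`: to every list of samples it assigns the
probability (over its internal randomness) with which it answers `Yes`. -/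
abbrev Tester (N : ℕ) (X : Type) : Type := (Fin N → X) → unitInterval

/-- Probability that the tester answers `Yes` on `N` i.i.d. samples from `P`. -/
def yesProb {N : ℕ} {X : Type} [Fintype X] (P : X → ℝ) (T : Tester N X) : ℝ :=
  ∑ s : Fin N → X, (∏ i, P (s i)) * (T s : ℝ)

/-- The tester solves conditional independence testing with respect to `Δ` and threshold `ε`: for
every distribution `P` on `A × B × C`, it answers `Yes` with probability at least `2/3` if
`Δ(P_{ABC} ‖ P_{AB} P_{C|B}) = 0`, and `No` with probability at least `2/3` if
`Δ(P_{ABC} ‖ P_{AB} P_{C|B}) ≥ ε`. -/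
def SolvesCIndep {A B C : Type} [Fintype A] [Fintype B] [Fintype C]
    (Δ : (A × B × C → ℝ) → (A × B × C → ℝ) → ℝ) (ε : ℝ) {N : ℕ}
    (T : Tester N (A × B × C)) : Prop :=
  ∀ P ∈ stdSimplex ℝ (A × B × C),
    (Δ P (markovRef P) = 0 → 2 / 3 ≤ yesProb P T) ∧
    (ε ≤ Δ P (markovRef P) → 2 / 3 ≤ 1 - yesProb P T)

/-- Sample complexity of conditional independence testing: the least number `N` of samples for
which some tester solves the problem (`⊤` if there is none). -/
def scCIndep {A B C : Type} [Fintype A] [Fintype B] [Fintype C]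
    (Δ : (A × B × C → ℝ) → (A × B × C → ℝ) → ℝ) (ε : ℝ) : ℕ∞ :=
  sInf {n : ℕ∞ | ∃ N : ℕ, n = N ∧ ∃ T : Tester N (A × B × C), SolvesCIndep Δ ε T}

/-- Sample complexity of conditional independence testing in squared Hellinger distance. -/
def scHellinger (ε : ℝ) (dA dB dC : ℕ) : ℕ∞ :=
  scCIndep (A := Fin dA) (B := Fin dB) (C := Fin dC) hellingerSq ε

/-- Sample complexity of CMI testing; here `I(A:C|B) = D(P_{ABC} ‖ P_{AB} P_{C|B})`. -/
def scCMI (ε : ℝ) (dA dB dC : ℕ) : ℕ∞ :=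
  scCIndep (A := Fin dA) (B := Fin dB) (C := Fin dC) klDivergence ε

/-- The term that is symmetric in `A` and `C`. -/
def fSym (ε a b c : ℝ) : ℝ :=
  max (a ^ (1 / 2 : ℝ) * b ^ (3 / 4 : ℝ) * c ^ (1 / 2 : ℝ) / ε)
    (min (a ^ (1 / 4 : ℝ) * b ^ (7 / 8 : ℝ) * c ^ (1 / 4 : ℝ) / ε)
      (a ^ (2 / 7 : ℝ) * b ^ (6 / 7 : ℝ) * c ^ (2 / 7 : ℝ) / ε ^ (8 / 7 : ℝ)))

/-- The term that is not symmetric in `A` and `C`. -/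
def fAsym (ε a b c : ℝ) : ℝ :=
  min (a ^ (3 / 4 : ℝ) * b ^ (3 / 4 : ℝ) * c ^ (1 / 4 : ℝ) / ε)
    (a ^ (2 / 3 : ℝ) * b ^ (2 / 3 : ℝ) * c ^ (1 / 3 : ℝ) / ε ^ (4 / 3 : ℝ))

/-- `max {f_sym, f_asym}` times `K` and the polylogarithmic factor
`log (2 + d_A d_B d_C / ε) ^ k`. -/
def rate (K : ℝ) (k : ℕ) (ε a b c : ℝ) : ℝ :=
  K * Real.log (2 + a * b * c / ε) ^ k * max (fSym ε a b c) (fAsym ε a b c)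

end CMITest

end

/-!
At each of polylogarithmically many scales the samples are split into blocks, and the bins `b` that
occur in every block are kept. Given the bins, the samples of one kept bin, one from each block, are
independent draws from `P_{AC|B=b}`. Some of them single out rows and columns to be deleted, so that
the surviving cells have small marginals; the others form pairs. Exchanging the `C`-coordinates of a
pair gives an unbiased estimator of `2 (P_{AC|B=b} - P_{A|B=b} P_{C|B=b})`; two independent groups
of pairs give one of the squared norm of this difference on the surviving cells. Chebyshev's
inequality bounds both errors of the test at one scale. If `P` is far from conditionally
independent then, by the pigeonhole principle, some scale carries a share of the Hellinger distance
that is large enough to be detected; hence the tester that rejects when one of the scales does.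

For conditional mutual information, a summand `p log (p / q)` exceeds its Hellinger counterpart by
more than a factor `O(log M)` only if `p > M² q`, and then it is at most `2 / M`, as `q` is a
product of two marginals that dominate `p`. So `2 D_H² ≤ D ≤ O(log M) D_H² + 2 d_A d_C / M`, and
testing at threshold `ε` reduces to Hellinger testing at threshold `ε / O(log (2 + d_A d_C / ε))`.
-/

noncomputable section

open Finset

namespace CMITest

/-! ### Finitely supported probability -/

section Expectation

variable {Ω Ω' : Type*} [Fintype Ω] [Fintype Ω'] {w : Ω → ℝ} {w' : Ω' → ℝ}

/-- The expectation of `f` under the weights `w` on a finite set. -/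
def expect (w f : Ω → ℝ) : ℝ := ∑ ω, w ω * f ω

open Classical in
/-- The probability of the event `S` under the weights `w`. -/
def prob (w : Ω → ℝ) (S : Ω → Prop) : ℝ := expect w fun ω => if S ω then 1 else 0

/-- The weights of a pair of independent variables. -/
def prodWeight {Ω Ω' : Type*} (w : Ω → ℝ) (w' : Ω' → ℝ) (x : Ω × Ω') : ℝ := w x.1 * w' x.2

lemma expect_add (w f g : Ω → ℝ) :
    expect w (fun ω => f ω + g ω) = expect w f + expect w g :=
  dotProduct_add w f g

lemma expect_sub (w f g : Ω → ℝ) :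
    expect w (fun ω => f ω - g ω) = expect w f - expect w g :=
  dotProduct_sub w f g

lemma expect_const_mul (w f : Ω → ℝ) (c : ℝ) :
    expect w (fun ω => c * f ω) = c * expect w f :=
  dotProduct_smul c w f

lemma expect_mul_const (w f : Ω → ℝ) (c : ℝ) :
    expect w (fun ω => f ω * c) = expect w f * c := by
  simp only [mul_comm _ c, expect_const_mul]

lemma expect_sum {κ : Type*} (w : Ω → ℝ) (s : Finset κ) (f : κ → Ω → ℝ) :
    expect w (fun ω => ∑ i ∈ s, f i ω) = ∑ i ∈ s, expect w (f i) := by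
  simp only [expect, mul_sum]
  exact sum_comm

lemma expect_const (hw : w ∈ stdSimplex ℝ Ω) (c : ℝ) : expect w (fun _ => c) = c := by
  simp [expect, ← sum_mul, hw.2]

lemma expect_mono (hw : w ∈ stdSimplex ℝ Ω) {f g : Ω → ℝ} (h : ∀ ω, f ω ≤ g ω) :
    expect w f ≤ expect w g :=
  dotProduct_le_dotProduct_of_nonneg_left h hw.1

lemma expect_nonneg (hw : w ∈ stdSimplex ℝ Ω) {f : Ω → ℝ} (h : ∀ ω, 0 ≤ f ω) :
    0 ≤ expect w f :=
  dotProduct_nonneg_of_nonneg hw.1 h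

lemma expect_comm (w : Ω → ℝ) (w' : Ω' → ℝ) (f : Ω → Ω' → ℝ) :
    expect w (fun ω => expect w' (f ω)) = expect w' fun ω' => expect w fun ω => f ω ω' := by
  simp only [expect, mul_sum, mul_left_comm (w _)]
  exact sum_comm

lemma prodWeight_mem_stdSimplex (hw : w ∈ stdSimplex ℝ Ω) (hw' : w' ∈ stdSimplex ℝ Ω') :
    prodWeight w w' ∈ stdSimplex ℝ (Ω × Ω') := by
  refine ⟨fun x => mul_nonneg (hw.1 _) (hw'.1 _), ?_⟩
  simp [prodWeight, Fintype.sum_prod_type, ← mul_sum, hw.2, hw'.2]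

lemma expect_prodWeight (w : Ω → ℝ) (w' : Ω' → ℝ) (f : Ω × Ω' → ℝ) :
    expect (prodWeight w w') f = expect w fun ω => expect w' fun ω' => f (ω, ω') := by
  simp only [expect, prodWeight, mul_sum, Fintype.sum_prod_type, mul_assoc]

lemma prob_nonneg (hw : w ∈ stdSimplex ℝ Ω) (S : Ω → Prop) : 0 ≤ prob w S :=
  expect_nonneg hw fun ω => by split_ifs <;> norm_num

lemma prob_mono (hw : w ∈ stdSimplex ℝ Ω) {S S' : Ω → Prop} (h : ∀ ω, S ω → S' ω) :
    prob w S ≤ prob w S' :=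
  expect_mono hw fun ω => by
    by_cases hS : S ω
    · simp [hS, h ω hS]
    · rw [if_neg hS]
      split_ifs <;> norm_num

lemma prob_not (hw : w ∈ stdSimplex ℝ Ω) (S : Ω → Prop) :
    prob w (fun ω => ¬ S ω) = 1 - prob w S := by
  rw [← expect_const hw 1, prob, prob, ← expect_sub]
  congr 1
  ext ω
  by_cases h : S ω <;> simp [h]

lemma prob_exists_le {κ : Type*} (hw : w ∈ stdSimplex ℝ Ω) (s : Finset κ) (S : κ → Ω → Prop) :
    prob w (fun ω => ∃ i ∈ s, S i ω) ≤ ∑ i ∈ s, prob w (S i) := by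
  classical
  have hite : ∀ i ω, (0 : ℝ) ≤ if S i ω then 1 else 0 := fun i ω => by split_ifs <;> norm_num
  simp only [prob]
  rw [← expect_sum]
  refine expect_mono hw fun ω => ?_
  split_ifs with h
  · obtain ⟨i, hi, hS⟩ := h
    simpa [hS] using single_le_sum (fun j _ => hite j ω) hi
  · exact sum_nonneg fun j _ => hite j ω

lemma prob_or_le (hw : w ∈ stdSimplex ℝ Ω) (S S' : Ω → Prop) :
    prob w (fun ω => S ω ∨ S' ω) ≤ prob w S + prob w S' := by
  rw [prob, prob, prob, ← expect_add]
  refine expect_mono hw fun ω => ?_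
  by_cases h : S ω <;> by_cases h' : S' ω <;> simp [h, h']

lemma prob_le_expect_div (hw : w ∈ stdSimplex ℝ Ω) {f : Ω → ℝ} (hf : ∀ ω, 0 ≤ f ω) {t : ℝ}
    (ht : 0 < t) : prob w (fun ω => t ≤ f ω) ≤ expect w f / t := by
  rw [div_eq_mul_inv, ← expect_mul_const]
  refine expect_mono hw fun ω => ?_
  split_ifs with h
  · rwa [← div_eq_mul_inv, one_le_div ht]
  · exact mul_nonneg (hf ω) (by positivity)

lemma expect_le_prob_add (hw : w ∈ stdSimplex ℝ Ω) {f : Ω → ℝ} (S : Ω → Prop) {c : ℝ}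
    (hc : 0 ≤ c) (h1 : ∀ ω, f ω ≤ 1) (h : ∀ ω, ¬ S ω → f ω ≤ c) :
    expect w f ≤ prob w S + c := by
  rw [prob, ← expect_const hw c, ← expect_add]
  refine expect_mono hw fun ω => ?_
  by_cases hS : S ω
  · simpa [hS, add_comm] using (h1 ω).trans (le_add_of_nonneg_left hc)
  · simpa [hS] using h ω hS

lemma sub_prob_le_expect (hw : w ∈ stdSimplex ℝ Ω) {f : Ω → ℝ} (S : Ω → Prop) {c : ℝ}
    (hc : c ≤ 1) (h0 : ∀ ω, 0 ≤ f ω) (h : ∀ ω, ¬ S ω → c ≤ f ω) :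
    c - prob w S ≤ expect w f := by
  have hcompl := expect_le_prob_add hw (f := fun ω => 1 - f ω) S (sub_nonneg.2 hc)
    (fun ω => by linarith [h0 ω]) (fun ω hω => by linarith [h ω hω])
  rw [expect_sub, expect_const hw] at hcompl
  linarith

end Expectation

section PiWeight

variable {ι κ κ' X Y : Type*} [Fintype ι] [Fintype κ] [Fintype κ'] [Fintype X] [Fintype Y]
  [DecidableEq ι] [DecidableEq κ] [DecidableEq κ']

/-- The weights of a family of independent variables `x i`, with weights `p i`. -/
def piWeight {ι X : Type*} [Fintype ι] (p : ι → X → ℝ) (x : ι → X) : ℝ := ∏ i, p i (x i)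

lemma expect_piWeight_prod (p : ι → X → ℝ) (g : ι → X → ℝ) :
    expect (piWeight p) (fun x => ∏ i, g i (x i)) = ∏ i, expect (p i) (g i) := by
  simp [expect, piWeight, ← prod_mul_distrib, prod_univ_sum]

lemma piWeight_mem_stdSimplex {p : ι → X → ℝ} (hp : ∀ i, p i ∈ stdSimplex ℝ X) :
    piWeight p ∈ stdSimplex ℝ (ι → X) := by
  refine ⟨fun x => prod_nonneg fun i _ => (hp i).1 _, ?_⟩
  have h := expect_piWeight_prod p fun _ _ => 1
  simpa [expect, (hp _).2] using h

lemma expect_piWeight_equiv (e : κ ≃ ι) (p : ι → X → ℝ) (G : (κ → X) → ℝ) :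
    expect (piWeight p) (fun x => G (x ∘ e)) = expect (piWeight fun j => p (e j)) G := by
  refine Fintype.sum_equiv (e.arrowCongr (Equiv.refl X)).symm _ _ fun x => ?_
  have hx : (e.arrowCongr (Equiv.refl X)).symm x = x ∘ e := by
    ext j
    simp
  rw [hx, piWeight, piWeight]
  congr 1
  exact (Fintype.prod_equiv e _ _ fun j => rfl).symm

lemma expect_piWeight_sum (p : ι ⊕ κ → X → ℝ) (G : (ι → X) → (κ → X) → ℝ) :
    expect (piWeight p) (fun x => G (x ∘ Sum.inl) (x ∘ Sum.inr)) =
      expect (piWeight fun i => p (Sum.inl i)) fun y =>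
        expect (piWeight fun j => p (Sum.inr j)) fun z => G y z := by
  rw [← expect_prodWeight _ _ fun yz => G yz.1 yz.2]
  refine Fintype.sum_equiv (Equiv.sumArrowEquivProdArrow ι κ X) _ _ fun x => ?_
  simp only [piWeight, prodWeight, Fintype.prod_sum_type]
  rfl

lemma expect_piWeight_comp {e : κ → ι} (he : Function.Injective e) {p : ι → X → ℝ}
    (hp : ∀ i, p i ∈ stdSimplex ℝ X) (G : (κ → X) → ℝ) :
    expect (piWeight p) (fun x => G (x ∘ e)) = expect (piWeight fun j => p (e j)) G := by
  classical
  let rangeAndRest : κ ⊕ {i // i ∉ Set.range e} ≃ ι :=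
    (Equiv.sumCongr (Equiv.ofInjective e he) (Equiv.refl _)).trans
      (Equiv.sumCompl fun i => i ∈ Set.range e)
  have hcomp : ∀ x : ι → X, (x ∘ rangeAndRest) ∘ Sum.inl = x ∘ e := fun x => by
    ext j
    simp [rangeAndRest]
  have hequiv := expect_piWeight_equiv rangeAndRest p fun x => G (x ∘ Sum.inl)
  simp only [hcomp] at hequiv
  rw [hequiv, expect_piWeight_sum (fun j => p (rangeAndRest j)) fun y _ => G y]
  simp only [expect_const (piWeight_mem_stdSimplex fun _ => hp _)]
  rfl

lemma expect_piWeight_comp₂ {e : κ → ι} {e' : κ' → ι} (he : Function.Injective (Sum.elim e e'))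
    {p : ι → X → ℝ} (hp : ∀ i, p i ∈ stdSimplex ℝ X) (G : (κ → X) → (κ' → X) → ℝ) :
    expect (piWeight p) (fun x => G (x ∘ e) (x ∘ e')) =
      expect (piWeight fun j => p (e j)) fun y =>
        expect (piWeight fun j => p (e' j)) fun z => G y z := by
  have h := expect_piWeight_comp he hp fun x => G (x ∘ Sum.inl) (x ∘ Sum.inr)
  rwa [expect_piWeight_sum] at h

lemma expect_piWeight_unit (p : Unit → X → ℝ) (G : X → ℝ) :
    expect (piWeight p) (fun x => G (x ())) = expect (p ()) G :=
  Fintype.sum_equiv (Equiv.funUnique Unit X) _ _ fun x => by simp [piWeight]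

lemma expect_piWeight_apply {p : ι → X → ℝ} (hp : ∀ i, p i ∈ stdSimplex ℝ X) (i : ι)
    (f : X → ℝ) : expect (piWeight p) (fun x => f (x i)) = expect (p i) f := by
  rw [← expect_piWeight_unit fun _ => p i,
    ← expect_piWeight_comp (e := fun _ : Unit => i) (fun _ _ _ => rfl) hp fun y => f (y ())]
  rfl

lemma expect_piWeight_apply_mul {p : ι → X → ℝ} (hp : ∀ i, p i ∈ stdSimplex ℝ X) {i j : ι}
    (hij : i ≠ j) (f g : X → ℝ) :
    expect (piWeight p) (fun x => f (x i) * g (x j)) = expect (p i) f * expect (p j) g := by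
  have he : Function.Injective (Sum.elim (fun _ : Unit => i) fun _ : Unit => j) := by
    rintro (⟨⟩ | ⟨⟩) (⟨⟩ | ⟨⟩) h <;> simp_all
  have h := expect_piWeight_comp₂ he hp fun y z => f (y ()) * g (z ())
  simp only [Function.comp_apply, expect_const_mul, expect_mul_const, expect_piWeight_unit] at h
  exact h

lemma expect_piWeight_curry (p : ι × κ → X → ℝ) (G : (ι → κ → X) → ℝ) :
    expect (piWeight p) (fun x => G fun i j => x (i, j)) =
      expect (piWeight fun i => piWeight fun j => p (i, j)) G := by
  refine Fintype.sum_equiv (Equiv.curry ι κ X) _ _ fun x => ?_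
  simp only [piWeight, Fintype.prod_prod_type]
  rfl

lemma expect_piWeight_pair (p : ι → X → ℝ) (p' : ι → X → Y → ℝ) (G : (ι → X) → (ι → Y) → ℝ) :
    expect (piWeight fun i => fun xy : X × Y => p i xy.1 * p' i xy.1 xy.2)
        (fun z => G (fun i => (z i).1) fun i => (z i).2) =
      expect (piWeight p) fun y => expect (piWeight fun i => p' i (y i)) fun z => G y z := by
  simp only [expect, mul_sum, ← mul_assoc, piWeight, ← prod_mul_distrib]
  rw [← Fintype.sum_prod_type' (f := fun (y : ι → X) (z : ι → Y) =>
    (∏ i, p i (y i) * p' i (y i) (z i)) * G y z)]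
  exact Fintype.sum_equiv (Equiv.arrowProdEquivProdArrow ι (fun _ => X) fun _ => Y) _ _
    fun _ => rfl

lemma expect_piWeight_map (e : Y ≃ X) (p : ι → X → ℝ) (G : (ι → X) → ℝ) :
    expect (piWeight fun i y => p i (e y)) (fun s => G fun i => e (s i)) =
      expect (piWeight p) G :=
  Fintype.sum_equiv (Equiv.piCongrRight fun _ => e) _ _ fun _ => rfl

lemma expect_sq_sum_sub_le {p : ι → X → ℝ} (hp : ∀ i, p i ∈ stdSimplex ℝ X) (f : ι → X → ℝ)
    (c : ℝ) :
    expect (piWeight p) (fun x => (∑ i, f i (x i) - c) ^ 2) ≤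
      ∑ i, expect (p i) (fun x => f i x ^ 2) + (∑ i, expect (p i) (f i) - c) ^ 2 := by
  have hpair : ∀ i j, expect (piWeight p) (fun x => f i (x i) * f j (x j)) ≤
      expect (p i) (f i) * expect (p j) (f j) +
        if i = j then expect (p i) (fun x => f i x ^ 2) else 0 := fun i j => by
    obtain rfl | hij := eq_or_ne i j
    · simp only [← pow_two, if_true, expect_piWeight_apply hp i fun x => f i x ^ 2]
      exact le_add_of_nonneg_left (sq_nonneg _)
    · rw [expect_piWeight_apply_mul hp hij, if_neg hij, add_zero]
  have hsum := sum_le_sum fun i (_ : i ∈ univ) => sum_le_sum fun j (_ : j ∈ univ) => hpair i j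
  simp only [sum_add_distrib, sum_ite_eq, mem_univ, if_true, ← sum_mul_sum] at hsum
  have hexpand : ∀ x : ι → X, (∑ i, f i (x i) - c) ^ 2 =
      ∑ i, ∑ j, f i (x i) * f j (x j) - 2 * c * ∑ i, f i (x i) + c ^ 2 := fun x => by
    rw [← sum_mul_sum]
    ring
  simp only [hexpand, expect_add, expect_sub, expect_const_mul,
    expect_const (piWeight_mem_stdSimplex hp), expect_sum, expect_piWeight_apply hp]
  linarith

end PiWeight

/-! ### Bilinear statistics of two independent groups of samples -/

section Kernel

variable {I R Θ Z : Type*} [Fintype I] [Fintype R] [Fintype Θ] [Fintype Z] [DecidableEq I]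
  [DecidableEq R]

/-- The weights of a family of independent samples, one for each bin `b : I` and each `r : R`; the
samples in bin `b` have the weights `p b`. -/
def binWeight {I X : Type*} [Fintype I] (R : Type*) [Fintype R] (p : I → X → ℝ) :
    (I × R → X) → ℝ :=
  piWeight fun br : I × R => p br.1

lemma binWeight_mem_stdSimplex {p : I → Θ → ℝ} (hp : ∀ b, p b ∈ stdSimplex ℝ Θ) :
    binWeight R p ∈ stdSimplex ℝ (I × R → Θ) :=
  piWeight_mem_stdSimplex fun _ => hp _

lemma expect_binWeight_sq_sum_sub_le {p : I → Θ → ℝ} (hp : ∀ b, p b ∈ stdSimplex ℝ Θ) (k : ℕ)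
    (f : I → Θ → ℝ) (c : ℝ) :
    expect (binWeight (Fin k) p) (fun ξ => (∑ b, ∑ i, f b (ξ (b, i)) - c) ^ 2) ≤
      k * ∑ b, expect (p b) (fun θ => f b θ ^ 2) + (k * ∑ b, expect (p b) (f b) - c) ^ 2 := by
  have h := expect_sq_sum_sub_le (fun bi : I × Fin k => hp bi.1) (fun bi => f bi.1) c
  simpa only [Fintype.sum_prod_type, sum_const, card_univ, Fintype.card_fin, nsmul_eq_mul,
    ← mul_sum, binWeight] using h

lemma expect_binWeight_sq_sum_le {p : I → Θ → ℝ} (hp : ∀ b, p b ∈ stdSimplex ℝ Θ) (k : ℕ)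
    (b : I) (f : Θ → ℝ) :
    expect (binWeight (Fin k) p) (fun ξ => (∑ i, f (ξ (b, i))) ^ 2) ≤
      k * expect (p b) (fun θ => f θ ^ 2) + (k * expect (p b) f) ^ 2 := by
  have hcomp := expect_piWeight_comp (Prod.mk_right_injective b)
    (fun bi : I × Fin k => hp bi.1) fun y => (∑ i, f (y i)) ^ 2
  have h := expect_sq_sum_sub_le (fun _ : Fin k => hp b) (fun _ => f) 0
  simp only [sub_zero, sum_const, card_univ, Fintype.card_fin, nsmul_eq_mul] at h
  exact hcomp.trans_le h

/-- The sum of a kernel `g b` over all pairs of a sample of the first group and a sample of the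
second group in the same bin `b`. -/
def kernelStat {I Θ : Type*} [Fintype I] {k : ℕ} (g : I → Θ → Θ → ℝ) (ξ η : I × Fin k → Θ) : ℝ :=
  ∑ b, ∑ j, ∑ i, g b (ξ (b, i)) (η (b, j))

lemma expect_right_kernelStat_sub_sq_le {p : I → Θ → ℝ} (hp : ∀ b, p b ∈ stdSimplex ℝ Θ) {k : ℕ}
    (g : I → Θ → Θ → ℝ) (ξ : I × Fin k → Θ) (c : ℝ) :
    expect (binWeight (Fin k) p) (fun η => (kernelStat g ξ η - k * c) ^ 2) ≤
      k * ∑ b, expect (p b) (fun θ => (∑ i, g b (ξ (b, i)) θ) ^ 2) +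
        k ^ 2 * (∑ b, ∑ i, expect (p b) (g b (ξ (b, i))) - c) ^ 2 := by
  refine (expect_binWeight_sq_sum_sub_le hp k (fun b θ => ∑ i, g b (ξ (b, i)) θ) _).trans_eq ?_
  simp only [expect_sum, ← mul_sub, mul_pow]

lemma expect_kernelStat_sub_sq_le {p : I → Θ → ℝ} (hp : ∀ b, p b ∈ stdSimplex ℝ Θ) (k : ℕ)
    (g : I → Θ → Θ → ℝ) (hg : ∀ b θ θ', g b θ θ' = g b θ' θ) :
    expect (binWeight (Fin k) p) (fun ξ => expect (binWeight (Fin k) p) fun η =>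
        (kernelStat g ξ η - (k : ℝ) ^ 2 * ∑ b, expect (p b) fun θ => expect (p b) (g b θ)) ^ 2) ≤
      (k : ℝ) ^ 2 * (∑ b, expect (p b) fun θ => expect (p b) fun θ' => g b θ θ' ^ 2) +
        2 * (k : ℝ) ^ 3 * ∑ b, expect (p b) fun θ => expect (p b) (g b θ) ^ 2 := by
  have hdiag : expect (binWeight (Fin k) p)
      (fun ξ => ∑ b, expect (p b) fun θ => (∑ i, g b (ξ (b, i)) θ) ^ 2) ≤
      ∑ b, (k * expect (p b) (fun θ => expect (p b) fun θ' => g b θ θ' ^ 2) +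
        (k : ℝ) ^ 2 * expect (p b) fun θ => expect (p b) (g b θ) ^ 2) := by
    rw [expect_sum]
    refine sum_le_sum fun b _ => ?_
    rw [expect_comm, ← expect_const_mul, ← expect_const_mul, ← expect_add]
    refine expect_mono (hp b) fun θ => ?_
    have hbin := expect_binWeight_sq_sum_le hp k b fun θ' => g b θ' θ
    simp only [mul_pow, hg b _ θ] at hbin
    simpa only [hg b _ θ] using hbin
  have hmean := expect_binWeight_sq_sum_sub_le hp k (fun b θ => expect (p b) (g b θ))
    (k * ∑ b, expect (p b) fun θ => expect (p b) (g b θ))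
  rw [sub_self, zero_pow two_ne_zero, add_zero] at hmean
  have hright := expect_mono (binWeight_mem_stdSimplex hp) fun ξ : I × Fin k → Θ =>
    expect_right_kernelStat_sub_sq_le hp g ξ
      (k * ∑ b, expect (p b) fun θ => expect (p b) (g b θ))
  rw [expect_add, expect_const_mul, expect_const_mul] at hright
  rw [sum_add_distrib, ← mul_sum, ← mul_sum] at hdiag
  simp only [← mul_assoc, ← pow_two] at hright
  linarith [mul_le_mul_of_nonneg_left hdiag (Nat.cast_nonneg k),
    mul_le_mul_of_nonneg_left hmean (sq_nonneg (k : ℝ))]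

lemma sq_sum_mul_mul (c u v : Z → ℝ) :
    (∑ z, c z * u z * v z) ^ 2 =
      ∑ y : Z × Z, c y.1 * c y.2 * (u y.1 * u y.2) * (v y.1 * v y.2) := by
  rw [pow_two, sum_mul_sum, Fintype.sum_prod_type]
  exact sum_congr rfl fun _ _ => sum_congr rfl fun _ _ => by ring

/-- Both factors on the right are Cauchy-Schwarz factors over pairs of features, with the weights
`c y.1 * c y.2` and the second moments of `φ · y.1 * φ · y.2`. -/
lemma sq_expect_sq_le (p : Θ → ℝ) {c : Z → ℝ} (hc : ∀ z, 0 ≤ c z) (φ : Θ → Z → ℝ) :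
    (expect p fun θ => (∑ z, c z * φ θ z * expect p fun θ' => φ θ' z) ^ 2) ^ 2 ≤
      (∑ z, c z * (expect p fun θ' => φ θ' z) ^ 2) ^ 2 *
        expect p (fun θ => expect p fun θ' => (∑ z, c z * φ θ z * φ θ' z) ^ 2) := by
  set μ : Z → ℝ := fun z => expect p fun θ' => φ θ' z
  set M : Z × Z → ℝ := fun y => expect p fun θ => φ θ y.1 * φ θ y.2
  have hcc : ∀ y : Z × Z, √(c y.1 * c y.2) ^ 2 = c y.1 * c y.2 := fun y =>
    Real.sq_sqrt (mul_nonneg (hc _) (hc _))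
  have hcross : (expect p fun θ => (∑ z, c z * φ θ z * μ z) ^ 2) =
      ∑ y : Z × Z, √(c y.1 * c y.2) * (μ y.1 * μ y.2) * (√(c y.1 * c y.2) * M y) := by
    simp only [sq_sum_mul_mul, expect_sum, expect_const_mul, expect_mul_const]
    exact sum_congr rfl fun y _ => by linear_combination (-(μ y.1 * μ y.2 * M y)) * hcc y
  have hmean : (∑ z, c z * μ z ^ 2) ^ 2 =
      ∑ y : Z × Z, (√(c y.1 * c y.2) * (μ y.1 * μ y.2)) ^ 2 := by
    simp only [mul_pow _ (_ * _), hcc, pow_two (μ _), ← mul_assoc (c _), sq_sum_mul_mul]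
    exact sum_congr rfl fun y _ => by ring
  have hmoment : expect p (fun θ => expect p fun θ' => (∑ z, c z * φ θ z * φ θ' z) ^ 2) =
      ∑ y : Z × Z, (√(c y.1 * c y.2) * M y) ^ 2 := by
    simp only [sq_sum_mul_mul, expect_sum, expect_const_mul, expect_mul_const, mul_pow, hcc]
    exact sum_congr rfl fun y _ => by
      change c y.1 * c y.2 * M y * M y = _
      ring
  rw [hcross, hmean, hmoment]
  exact sum_mul_sq_le_sq_mul_sq _ _ _

end Kernel

/-! ### Interactions of pairs of samples -/

section Interaction

variable {A C : Type*} [Fintype A] [Fintype C]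

/-- The first marginal of a distribution on pairs. -/
def margFst (p : A × C → ℝ) (a : A) : ℝ := ∑ c, p (a, c)

/-- The second marginal of a distribution on pairs. -/
def margSnd (p : A × C → ℝ) (c : C) : ℝ := ∑ a, p (a, c)

/-- The deviation of a distribution on pairs from the product of its marginals. -/
def depend (p : A × C → ℝ) (z : A × C) : ℝ := p z - prodWeight (margFst p) (margSnd p) z

/-- The mixed second difference of the indicator of the cell `z` over the rows and columns of two
samples; its mean is `2 * depend p z`. -/
def interaction {A C : Type*} [DecidableEq A] [DecidableEq C] (x : (A × C) × (A × C))
    (z : A × C) : ℝ :=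
  ((Pi.single z.1 1 : A → ℝ) x.1.1 - (Pi.single z.1 1 : A → ℝ) x.2.1) *
    ((Pi.single z.2 1 : C → ℝ) x.1.2 - (Pi.single z.2 1 : C → ℝ) x.2.2)

lemma margFst_mem_stdSimplex {p : A × C → ℝ} (hp : p ∈ stdSimplex ℝ (A × C)) :
    margFst p ∈ stdSimplex ℝ A :=
  ⟨fun _ => sum_nonneg fun _ _ => hp.1 _, (Fintype.sum_prod_type p).symm.trans hp.2⟩

lemma margSnd_mem_stdSimplex {p : A × C → ℝ} (hp : p ∈ stdSimplex ℝ (A × C)) :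
    margSnd p ∈ stdSimplex ℝ C :=
  ⟨fun _ => sum_nonneg fun _ _ => hp.1 _, (Fintype.sum_prod_type_right p).symm.trans hp.2⟩

lemma prodWeight_marg_mem_stdSimplex {p : A × C → ℝ} (hp : p ∈ stdSimplex ℝ (A × C)) :
    prodWeight (margFst p) (margSnd p) ∈ stdSimplex ℝ (A × C) :=
  prodWeight_mem_stdSimplex (margFst_mem_stdSimplex hp) (margSnd_mem_stdSimplex hp)

lemma expect_fst (p : A × C → ℝ) (f : A → ℝ) :
    expect p (fun z => f z.1) = expect (margFst p) f := by
  simp [expect, margFst, Fintype.sum_prod_type, sum_mul]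

lemma expect_snd (p : A × C → ℝ) (f : C → ℝ) :
    expect p (fun z => f z.2) = expect (margSnd p) f := by
  simp [expect, margSnd, Fintype.sum_prod_type_right, sum_mul]

lemma expect_prodWeight_cells {p : A × C → ℝ} (hp : p ∈ stdSimplex ℝ (A × C)) (f : A × C → ℝ)
    (s t : ℝ) :
    expect (prodWeight p p) (fun x => s * f (x.1.1, x.1.2) + t * f (x.1.1, x.2.2) +
      t * f (x.2.1, x.1.2) + s * f (x.2.1, x.2.2)) =
      2 * (s * expect p f + t * expect (prodWeight (margFst p) (margSnd p)) f) := by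
  have hcross : expect p (fun x => expect p fun y => f (x.1, y.2)) =
      expect (prodWeight (margFst p) (margSnd p)) f := by
    simp only [fun a => expect_snd p fun c => f (a, c),
      expect_fst p fun a => expect (margSnd p) fun c => f (a, c), expect_prodWeight]
  simp only [expect_add, expect_const_mul, expect_prodWeight, Prod.mk.eta, expect_const hp,
    expect_comm p p fun x y => f (y.1, x.2), hcross]
  ring

variable [DecidableEq A] [DecidableEq C]

lemma interaction_eq {A C : Type*} [DecidableEq A] [DecidableEq C] (x : (A × C) × (A × C))
    (z : A × C) :
    interaction x z = (Pi.single z 1 : A × C → ℝ) (x.1.1, x.1.2) -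
      (Pi.single z 1 : A × C → ℝ) (x.1.1, x.2.2) - (Pi.single z 1 : A × C → ℝ) (x.2.1, x.1.2) +
      (Pi.single z 1 : A × C → ℝ) (x.2.1, x.2.2) := by
  simp only [interaction, Pi.single_apply, Prod.ext_iff, ite_and]
  split_ifs <;> ring

lemma sum_interaction_mul (x : (A × C) × (A × C)) (f : A × C → ℝ) :
    ∑ z, interaction x z * f z =
      f (x.1.1, x.1.2) - f (x.1.1, x.2.2) - f (x.2.1, x.1.2) + f (x.2.1, x.2.2) := by
  simp [interaction_eq, add_mul, sub_mul, sum_add_distrib, Pi.single_apply]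

lemma expect_single (p : A → ℝ) (a : A) : expect p (Pi.single a 1) = p a := by
  simp [expect, Pi.single_apply]

lemma expect_interaction {p : A × C → ℝ} (hp : p ∈ stdSimplex ℝ (A × C)) (z : A × C) :
    expect (prodWeight p p) (fun x => interaction x z) = 2 * depend p z := by
  have h := expect_prodWeight_cells hp (Pi.single z 1) 1 (-1)
  simp only [expect_single] at h
  simp only [interaction_eq, depend, sub_eq_add_neg]
  simpa only [one_mul, neg_one_mul] using h

lemma expect_interaction_sq_le {p : A × C → ℝ} (hp : p ∈ stdSimplex ℝ (A × C)) (z : A × C) :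
    expect (prodWeight p p) (fun x => interaction x z ^ 2) ≤
      2 * (p z + prodWeight (margFst p) (margSnd p) z) := by
  have h := expect_prodWeight_cells hp (Pi.single z 1) 1 1
  simp only [expect_single, one_mul] at h
  refine (expect_mono (prodWeight_mem_stdSimplex hp hp) fun x => ?_).trans_eq h
  simp only [interaction, Pi.single_apply, Prod.ext_iff, ite_and]
  split_ifs <;> norm_num

lemma expect_sq_sum_interaction_mul_le {p : A × C → ℝ} (hp : p ∈ stdSimplex ℝ (A × C))
    (f : A × C → ℝ) :
    expect (prodWeight p p) (fun x => (∑ z, interaction x z * f z) ^ 2) ≤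
      8 * ∑ z, (p z + prodWeight (margFst p) (margSnd p) z) * f z ^ 2 := by
  have hsq : ∀ s t u v : ℝ, (s - t - u + v) ^ 2 ≤
      4 * s ^ 2 + 4 * t ^ 2 + 4 * u ^ 2 + 4 * v ^ 2 := fun s t u v => by
    nlinarith [sq_nonneg (s + t), sq_nonneg (s + u), sq_nonneg (s - v), sq_nonneg (t - u),
      sq_nonneg (t + v), sq_nonneg (u + v)]
  simp only [sum_interaction_mul]
  refine (expect_mono (prodWeight_mem_stdSimplex hp hp) fun x => hsq _ _ _ _).trans_eq ?_
  rw [expect_prodWeight_cells hp (fun z => f z ^ 2) 4 4]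
  simp only [expect, add_mul, sum_add_distrib]
  ring

lemma expect_kernel_sq_le {p : A × C → ℝ} (hp : p ∈ stdSimplex ℝ (A × C)) {c : A × C → ℝ}
    (hc : ∀ z, c z = 0 ∨ c z = 1) :
    expect (prodWeight p p) (fun x => expect (prodWeight p p) fun y =>
        (∑ z, c z * interaction x z * interaction y z) ^ 2) ≤
      8 * (∑ z, c z * (expect (prodWeight p p) fun x => interaction x z) ^ 2) +
        128 * ∑ z, c z * prodWeight (margFst p) (margSnd p) z ^ 2 := by
  have hpp := prodWeight_mem_stdSimplex hp hp
  have hcsq : ∀ z, c z ^ 2 = c z := fun z => by rcases hc z with h | h <;> simp [h]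
  have hc0 : ∀ z, 0 ≤ c z := fun z => (sq_nonneg _).trans_eq (hcsq z)
  have hinner : ∀ x : (A × C) × (A × C), expect (prodWeight p p)
      (fun y => (∑ z, c z * interaction x z * interaction y z) ^ 2) ≤
      8 * ∑ z, (p z + prodWeight (margFst p) (margSnd p) z) * (c z * interaction x z ^ 2) :=
    fun x => by
      simpa only [mul_comm (_ * interaction x _), mul_pow, hcsq] using
        expect_sq_sum_interaction_mul_le hp fun z => c z * interaction x z
  refine (expect_mono hpp hinner).trans ?_
  simp only [expect_const_mul, expect_sum, expect_interaction hp]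
  rw [mul_sum, mul_sum, mul_sum, ← sum_add_distrib]
  refine sum_le_sum fun z _ => ?_
  have hmoment := expect_interaction_sq_le hp z
  have hq := (prodWeight_marg_mem_stdSimplex hp).1 z
  have hdepend : p z = depend p z + prodWeight (margFst p) (margSnd p) z :=
    (sub_add_cancel _ _).symm
  generalize prodWeight (margFst p) (margSnd p) z = q at *
  have hpq : 0 ≤ p z + q := add_nonneg (hp.1 z) hq
  have hquad : (p z + q) * (2 * (p z + q)) ≤ 4 * depend p z ^ 2 + 16 * q ^ 2 := by
    rw [hdepend]
    nlinarith [sq_nonneg (depend p z - 2 * q)]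
  have hmul := mul_le_mul_of_nonneg_left
    ((mul_le_mul_of_nonneg_left hmoment hpq).trans hquad) (hc0 z)
  linarith

end Interaction

/-! ### Flattening -/

lemma mul_one_sub_pow_le {x : ℝ} (h0 : 0 ≤ x) (h1 : x ≤ 1) (n : ℕ) :
    x * (1 - x) ^ n ≤ 1 / (n + 1) := by
  have hx : 0 ≤ 1 - x := sub_nonneg.2 h1
  rw [le_div_iff₀ (by positivity)]
  calc x * (1 - x) ^ n * (n + 1) = x * ∑ _i ∈ range (n + 1), (1 - x) ^ n := by
        simp only [sum_const, card_range, nsmul_eq_mul]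
        push_cast
        ring
    _ ≤ x * ∑ i ∈ range (n + 1), (1 - x) ^ i := by
        refine mul_le_mul_of_nonneg_left (sum_le_sum fun i hi => ?_) h0
        exact pow_le_pow_of_le_one hx (by linarith) (mem_range_succ_iff.1 hi)
    _ = 1 - (1 - x) ^ (n + 1) := by rw [← mul_neg_geom_sum, sub_sub_cancel]
    _ ≤ 1 := sub_le_self _ (pow_nonneg hx _)

/-- An upper bound for the squared `ℓ²` norm of a distribution on `d` points after deleting all
points that occur among `2 (K - 1)` samples. -/
def flatNorm (d K : ℕ) : ℝ := min (1 / (K : ℝ)) (d / (K : ℝ) ^ 2)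

lemma flatNorm_nonneg (d K : ℕ) : 0 ≤ flatNorm d K := le_min (by positivity) (by positivity)

lemma le_one_of_mem_stdSimplex {X : Type*} [Fintype X] {p : X → ℝ} (hp : p ∈ stdSimplex ℝ X)
    (x : X) : p x ≤ 1 :=
  (single_le_sum (fun y _ => hp.1 y) (mem_univ x)).trans_eq hp.2

lemma sum_sq_mul_pow_le {X : Type*} [Fintype X] {p : X → ℝ} (hp : p ∈ stdSimplex ℝ X) {K : ℕ}
    (hK : 1 ≤ K) :
    ∑ x, p x ^ 2 * (1 - p x) ^ (2 * (K - 1)) ≤ flatNorm (Fintype.card X) K := by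
  have h0 : ∀ x, 0 ≤ p x * (1 - p x) ^ (K - 1) := fun x =>
    mul_nonneg (hp.1 x) (pow_nonneg (sub_nonneg.2 (le_one_of_mem_stdSimplex hp x)) _)
  have hK' : ∀ x, p x * (1 - p x) ^ (K - 1) ≤ 1 / K := fun x => by
    simpa [Nat.cast_sub hK] using
      mul_one_sub_pow_le (hp.1 x) (le_one_of_mem_stdSimplex hp x) (K - 1)
  have hp' : ∀ x, p x * (1 - p x) ^ (K - 1) ≤ p x := fun x =>
    mul_le_of_le_one_right (hp.1 x) (pow_le_one₀
      (sub_nonneg.2 (le_one_of_mem_stdSimplex hp x)) (sub_le_self _ (hp.1 x)))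
  simp only [mul_comm 2, pow_mul, ← mul_pow]
  refine le_min ?_ ?_
  · calc ∑ x, (p x * (1 - p x) ^ (K - 1)) ^ 2 ≤ ∑ x, p x * (1 / (K : ℝ)) :=
          sum_le_sum fun x _ =>
            (pow_two _).trans_le (mul_le_mul (hp' x) (hK' x) (h0 x) (hp.1 x))
      _ = 1 / K := by rw [← sum_mul, hp.2, one_mul]
  · calc ∑ x, (p x * (1 - p x) ^ (K - 1)) ^ 2 ≤ ∑ _x : X, (1 / (K : ℝ)) ^ 2 :=
          sum_le_sum fun x _ => pow_le_pow_left₀ (h0 x) (hK' x) 2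
      _ = Fintype.card X / (K : ℝ) ^ 2 := by simp [div_eq_mul_inv]

/-! ### The statistic of the remaining cells -/

section CellStat

variable {I A C : Type*} [Fintype I] [Fintype A] [Fintype C] [DecidableEq A] [DecidableEq C]

/-- The kernel that correlates the interactions of two pairs of samples on the cells with weights
`c`. -/
def cellKernel (c : A × C → ℝ) (x y : (A × C) × (A × C)) : ℝ :=
  ∑ z, c z * interaction x z * interaction y z

/-- The mean of `cellKernel c` for independent pairs of samples from `p`. -/
def cellSignal {A C : Type*} [Fintype A] [Fintype C] (c p : A × C → ℝ) : ℝ :=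
  ∑ z, c z * (2 * depend p z) ^ 2

/-- The squared `ℓ²` norm of the product of the marginals of `p` on the cells with weights `c`. It
governs the variance of `cellKernel c`. -/
def cellNoise {A C : Type*} [Fintype A] [Fintype C] (c p : A × C → ℝ) : ℝ :=
  ∑ z, c z * prodWeight (margFst p) (margSnd p) z ^ 2

lemma nonneg_of_eq_zero_or_one {X : Type*} {c : X → ℝ} (hc : ∀ x, c x = 0 ∨ c x = 1) (x : X) :
    0 ≤ c x := by
  rcases hc x with h | h <;> simp [h]

lemma cellSignal_nonneg {A C : Type*} [Fintype A] [Fintype C] {c : A × C → ℝ}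
    (hc : ∀ z, 0 ≤ c z) (p : A × C → ℝ) : 0 ≤ cellSignal c p :=
  sum_nonneg fun z _ => mul_nonneg (hc z) (sq_nonneg _)

lemma cellNoise_nonneg {A C : Type*} [Fintype A] [Fintype C] {c : A × C → ℝ}
    (hc : ∀ z, 0 ≤ c z) (p : A × C → ℝ) : 0 ≤ cellNoise c p :=
  sum_nonneg fun z _ => mul_nonneg (hc z) (sq_nonneg _)

lemma expect_cellKernel (c p : A × C → ℝ) (x : (A × C) × (A × C)) :
    expect (prodWeight p p) (cellKernel c x) =
      ∑ z, c z * interaction x z * expect (prodWeight p p) fun y => interaction y z := by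
  simp only [← expect_const_mul]
  exact expect_sum _ _ _

lemma expect_expect_cellKernel {p : A × C → ℝ} (hp : p ∈ stdSimplex ℝ (A × C))
    (c : A × C → ℝ) :
    expect (prodWeight p p) (fun x => expect (prodWeight p p) (cellKernel c x)) =
      cellSignal c p := by
  simp only [expect_cellKernel, expect_sum, expect_mul_const, expect_const_mul,
    expect_interaction hp, cellSignal]
  exact sum_congr rfl fun z _ => by ring

lemma expect_cellKernel_sq_le {p : A × C → ℝ} (hp : p ∈ stdSimplex ℝ (A × C)) {c : A × C → ℝ}
    (hc : ∀ z, c z = 0 ∨ c z = 1) :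
    expect (prodWeight p p) (fun x => expect (prodWeight p p) fun y => cellKernel c x y ^ 2) ≤
      8 * cellSignal c p + 128 * cellNoise c p := by
  simpa only [expect_interaction hp, cellKernel, cellSignal, cellNoise] using
    expect_kernel_sq_le hp hc

lemma expect_sq_expect_cellKernel_le {p : A × C → ℝ} (hp : p ∈ stdSimplex ℝ (A × C))
    {c : A × C → ℝ} (hc : ∀ z, c z = 0 ∨ c z = 1) :
    expect (prodWeight p p) (fun x => expect (prodWeight p p) (cellKernel c x) ^ 2) ≤
      cellSignal c p * (3 * √(cellSignal c p) + 12 * √(cellNoise c p)) := by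
  have hS := cellSignal_nonneg (nonneg_of_eq_zero_or_one hc) p
  have hN := cellNoise_nonneg (nonneg_of_eq_zero_or_one hc) p
  have hcs := sq_expect_sq_le (prodWeight p p) (nonneg_of_eq_zero_or_one hc)
    (interaction (A := A) (C := C))
  simp only [expect_interaction hp] at hcs
  simp only [expect_cellKernel, expect_interaction hp]
  refine le_of_sq_le_sq (hcs.trans ?_) (mul_nonneg hS (by positivity))
  rw [mul_pow]
  refine mul_le_mul_of_nonneg_left ((expect_cellKernel_sq_le hp hc).trans ?_) (sq_nonneg _)
  nlinarith [Real.sq_sqrt hS, Real.sq_sqrt hN,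
    mul_nonneg (Real.sqrt_nonneg (cellSignal c p)) (Real.sqrt_nonneg (cellNoise c p))]

/-- The statistic of two groups of `k` pairs of samples in each bin: the sum of the kernels with
cell weights `c b` over all pairs of pairs from different groups. -/
def cellStat {k : ℕ} (c : I → A × C → ℝ)
    (ξη : (I × Fin k → (A × C) × (A × C)) × (I × Fin k → (A × C) × (A × C))) : ℝ :=
  kernelStat (fun b => cellKernel (c b)) ξη.1 ξη.2

/-- The weights of two independent groups of `k` pairs of samples in each bin. -/
def groupsWeight {I A C : Type*} [Fintype I] (k : ℕ) (p : I → A × C → ℝ) :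
    (I × Fin k → (A × C) × (A × C)) × (I × Fin k → (A × C) × (A × C)) → ℝ :=
  prodWeight (binWeight (Fin k) fun b => prodWeight (p b) (p b))
    (binWeight (Fin k) fun b => prodWeight (p b) (p b))

/-- The mean of `cellStat c` for `k` pairs in each group. -/
def statSignal {I A C : Type*} [Fintype I] [Fintype A] [Fintype C] (k : ℕ)
    (c p : I → A × C → ℝ) : ℝ :=
  (k : ℝ) ^ 2 * ∑ b, cellSignal (c b) (p b)

/-- The part of the variance of `cellStat c` that is present even under independence, up to a
constant. -/
def statNoise {I A C : Type*} [Fintype I] [Fintype A] [Fintype C] (k : ℕ)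
    (c p : I → A × C → ℝ) : ℝ :=
  (k : ℝ) ^ 2 * ∑ b, cellNoise (c b) (p b)

lemma mul_sqrt_le_sqrt_sq_mul_sum {m : I → ℝ} (hm : ∀ b, 0 ≤ m b) (k : ℕ) (b : I) :
    (k : ℝ) * √(m b) ≤ √((k : ℝ) ^ 2 * ∑ b, m b) := by
  rw [Real.sqrt_mul (sq_nonneg _), Real.sqrt_sq (Nat.cast_nonneg k)]
  exact mul_le_mul_of_nonneg_left
    (Real.sqrt_le_sqrt (single_le_sum (fun b _ => hm b) (mem_univ b))) (Nat.cast_nonneg k)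

variable [DecidableEq I]

lemma groupsWeight_mem_stdSimplex {I A C : Type*} [Fintype I] [Fintype A] [Fintype C]
    [DecidableEq I] (k : ℕ) {p : I → A × C → ℝ}
    (hp : ∀ b, p b ∈ stdSimplex ℝ (A × C)) : groupsWeight k p ∈ stdSimplex ℝ _ :=
  have h := binWeight_mem_stdSimplex fun b => prodWeight_mem_stdSimplex (hp b) (hp b)
  prodWeight_mem_stdSimplex h h

lemma expect_cellStat_sub_sq_le (k : ℕ) {p : I → A × C → ℝ}
    (hp : ∀ b, p b ∈ stdSimplex ℝ (A × C)) {c : I → A × C → ℝ}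
    (hc : ∀ b z, c b z = 0 ∨ c b z = 1) :
    expect (groupsWeight k p) (fun ξη => (cellStat c ξη - statSignal k c p) ^ 2) ≤
      8 * statSignal k c p + 128 * statNoise k c p +
        2 * statSignal k c p * (3 * √(statSignal k c p) + 12 * √(statNoise k c p)) := by
  have hS : ∀ b, 0 ≤ cellSignal (c b) (p b) := fun b =>
    cellSignal_nonneg (nonneg_of_eq_zero_or_one (hc b)) _
  have hN : ∀ b, 0 ≤ cellNoise (c b) (p b) := fun b =>
    cellNoise_nonneg (nonneg_of_eq_zero_or_one (hc b)) _
  have hvar := expect_kernelStat_sub_sq_le (fun b => prodWeight_mem_stdSimplex (hp b) (hp b)) k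
    (fun b => cellKernel (c b)) fun b x y => sum_congr rfl fun z _ => by ring
  simp only [expect_expect_cellKernel (hp _)] at hvar
  have hdiag := mul_le_mul_of_nonneg_left
    (sum_le_sum fun b (_ : b ∈ univ) => expect_cellKernel_sq_le (hp b) (hc b))
    (sq_nonneg (k : ℝ))
  rw [sum_add_distrib, ← mul_sum, ← mul_sum] at hdiag
  have hoff : (k : ℝ) ^ 3 * ∑ b, expect (prodWeight (p b) (p b))
      (fun x => expect (prodWeight (p b) (p b)) (cellKernel (c b) x) ^ 2) ≤
      statSignal k c p * (3 * √(statSignal k c p) + 12 * √(statNoise k c p)) := by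
    rw [mul_sum, statSignal, mul_assoc, sum_mul, mul_sum]
    refine sum_le_sum fun b _ => ?_
    calc _ ≤ (k : ℝ) ^ 3 * (cellSignal (c b) (p b) *
            (3 * √(cellSignal (c b) (p b)) + 12 * √(cellNoise (c b) (p b)))) :=
          mul_le_mul_of_nonneg_left (expect_sq_expect_cellKernel_le (hp b) (hc b)) (by positivity)
      _ = (k : ℝ) ^ 2 * (cellSignal (c b) (p b) *
            (3 * (k * √(cellSignal (c b) (p b))) + 12 * (k * √(cellNoise (c b) (p b))))) := by
          ring
      _ ≤ _ := by
          refine mul_le_mul_of_nonneg_left (mul_le_mul_of_nonneg_left ?_ (hS b)) (sq_nonneg _)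
          exact add_le_add
            (mul_le_mul_of_nonneg_left (mul_sqrt_le_sqrt_sq_mul_sum hS k b) (by norm_num))
            (mul_le_mul_of_nonneg_left (mul_sqrt_le_sqrt_sq_mul_sum hN k b) (by norm_num))
  rw [groupsWeight, expect_prodWeight]
  refine hvar.trans ?_
  rw [statSignal, statNoise] at *
  linarith

lemma prob_cellStat_lt_le {k : ℕ} {p : I → A × C → ℝ} (hp : ∀ b, p b ∈ stdSimplex ℝ (A × C))
    {c : I → A × C → ℝ} (hc : ∀ b z, c b z = 0 ∨ c b z = 1) {ρ T : ℝ} (hρ : 1 ≤ ρ)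
    (hnoise : statNoise k c p ≤ 20 * ρ ^ 2) (hsignal : 10 ^ 6 * ρ ≤ statSignal k c p)
    (hT : T ≤ statSignal k c p / 2) :
    prob (groupsWeight k p) (fun ξη => ¬ T ≤ cellStat c ξη) ≤ 1 / 20 := by
  have hvar := expect_cellStat_sub_sq_le k hp hc
  have hg := groupsWeight_mem_stdSimplex k hp
  set S := statSignal k c p
  have hS : 0 < S := by linarith
  calc _ ≤ prob (groupsWeight k p) (fun ξη => (S / 2) ^ 2 ≤ (cellStat c ξη - S) ^ 2) :=
        prob_mono hg fun ξη h => by nlinarith [not_le.1 h]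
    _ ≤ _ := prob_le_expect_div hg (fun _ => sq_nonneg _) (by positivity)
    _ ≤ 1 / 20 := by
      rw [div_le_iff₀ (by positivity)]
      refine hvar.trans ?_
      have hsqrtN : √(statNoise k c p) ≤ 5 * ρ :=
        (Real.sqrt_le_left (by linarith)).2 (by nlinarith)
      have hsqrtS : √S ≤ S / 1000 := (Real.sqrt_le_left (by linarith)).2 (by nlinarith)
      have hρS : ρ ≤ S / 10 ^ 6 := by
        rw [le_div_iff₀ (by norm_num)]
        linarith
      have hSS := mul_le_mul_of_nonneg_left hsqrtS hS.le
      have hSN : S * √(statNoise k c p) ≤ S * (5 * (S / 10 ^ 6)) :=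
        mul_le_mul_of_nonneg_left (by linarith) hS.le
      have hρ2 : ρ ^ 2 ≤ (S / 10 ^ 6) ^ 2 := pow_le_pow_left₀ (by linarith) hρS 2
      nlinarith

end CellStat

section Selection

variable {I A C X Y : Type*} [Fintype I] [Fintype A] [Fintype C] [Fintype Y] [DecidableEq I]
  [DecidableEq A] [DecidableEq C] [DecidableEq X]

/-- The indicator that `x` is not among the values `h (y (b, i))` of the samples in bin `b`. -/
def unseen {I X Y : Type*} [DecidableEq X] {n : ℕ} (h : Y → X) (y : I × Fin n → Y) (b : I)
    (x : X) : ℝ :=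
  ∏ i, if h (y (b, i)) = x then 0 else 1

/-- The weights of the two groups of samples, of `s` and `t` samples in each bin, whose rows and
columns are deleted. -/
def selectWeight {I A C : Type*} [Fintype I] (s t : ℕ) (p : I → A × C → ℝ) :
    (I × Fin s → A × C) × (I × Fin t → A × C) → ℝ :=
  prodWeight (binWeight (Fin s) p) (binWeight (Fin t) p)

/-- The indicator of the cells that remain in bin `b` after deleting the rows seen in the first
group and the columns seen in the second group. -/
def selectCells {I A C : Type*} [DecidableEq A] [DecidableEq C] {s t : ℕ}
    (yz : (I × Fin s → A × C) × (I × Fin t → A × C)) (b : I) (z : A × C) : ℝ :=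
  unseen Prod.fst yz.1 b z.1 * unseen Prod.snd yz.2 b z.2

lemma unseen_eq_zero_or_one {I X Y : Type*} [DecidableEq X] {n : ℕ} (h : Y → X)
    (y : I × Fin n → Y) (b : I) (x : X) : unseen h y b x = 0 ∨ unseen h y b x = 1 := by
  by_cases hx : ∃ i, h (y (b, i)) = x
  · obtain ⟨i, hi⟩ := hx
    exact Or.inl (prod_eq_zero (mem_univ i) (if_pos hi))
  · exact Or.inr (prod_eq_one fun i _ => if_neg fun hi => hx ⟨i, hi⟩)

lemma expect_unseen (n : ℕ) {p : I → Y → ℝ} (hp : ∀ b, p b ∈ stdSimplex ℝ Y) (h : Y → X) (b : I)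
    (x : X) :
    expect (binWeight (Fin n) p) (fun y => unseen h y b x) =
      (1 - expect (p b) fun y => (Pi.single x 1 : X → ℝ) (h y)) ^ n := by
  have hcomp := expect_piWeight_comp (Prod.mk_right_injective b)
    (fun bi : I × Fin n => hp bi.1) fun y => ∏ i, if h (y i) = x then (0 : ℝ) else 1
  have hite : ∀ y, (if h y = x then (0 : ℝ) else 1) = 1 - (Pi.single x 1 : X → ℝ) (h y) :=
    fun y => by
      rw [Pi.single_apply]
      split_ifs <;> simp
  rw [expect_piWeight_prod (fun _ : Fin n => p b) fun _ y => if h y = x then (0 : ℝ) else 1,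
    prod_const, card_univ, Fintype.card_fin] at hcomp
  simp only [hite, expect_sub, expect_const (hp b)] at hcomp
  simp only [unseen, hite, binWeight]
  exact hcomp

lemma selectWeight_mem_stdSimplex {I A C : Type*} [Fintype I] [Fintype A] [Fintype C]
    [DecidableEq I] (s t : ℕ) {p : I → A × C → ℝ}
    (hp : ∀ b, p b ∈ stdSimplex ℝ (A × C)) : selectWeight s t p ∈ stdSimplex ℝ _ :=
  prodWeight_mem_stdSimplex (binWeight_mem_stdSimplex hp) (binWeight_mem_stdSimplex hp)

lemma selectCells_eq_zero_or_one {I A C : Type*} [DecidableEq A] [DecidableEq C] {s t : ℕ}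
    (yz : (I × Fin s → A × C) × (I × Fin t → A × C)) (b : I) (z : A × C) :
    selectCells yz b z = 0 ∨ selectCells yz b z = 1 := by
  unfold selectCells
  rcases unseen_eq_zero_or_one Prod.fst yz.1 b z.1 with h | h <;>
    rcases unseen_eq_zero_or_one Prod.snd yz.2 b z.2 with h' | h' <;> simp [h, h']

lemma expect_selectCells {s t : ℕ} {p : I → A × C → ℝ} (hp : ∀ b, p b ∈ stdSimplex ℝ (A × C))
    (b : I) (z : A × C) :
    expect (selectWeight s t p) (fun yz => selectCells yz b z) =
      (1 - margFst (p b) z.1) ^ s * (1 - margSnd (p b) z.2) ^ t := by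
  simp only [selectWeight, expect_prodWeight, selectCells, expect_const_mul, expect_mul_const,
    expect_unseen _ hp, expect_fst _ (Pi.single z.1 1), expect_snd _ (Pi.single z.2 1),
    expect_single]

lemma expect_selectCells_cellNoise_le {KA KC : ℕ} (hKA : 1 ≤ KA) (hKC : 1 ≤ KC)
    {p : I → A × C → ℝ} (hp : ∀ b, p b ∈ stdSimplex ℝ (A × C)) (b : I) :
    expect (selectWeight (2 * (KA - 1)) (2 * (KC - 1)) p)
        (fun yz => cellNoise (selectCells yz b) (p b)) ≤
      flatNorm (Fintype.card A) KA * flatNorm (Fintype.card C) KC := by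
  simp only [cellNoise, expect_sum, expect_mul_const, expect_selectCells hp]
  calc ∑ z, (1 - margFst (p b) z.1) ^ (2 * (KA - 1)) * (1 - margSnd (p b) z.2) ^ (2 * (KC - 1)) *
        prodWeight (margFst (p b)) (margSnd (p b)) z ^ 2
      = (∑ a, margFst (p b) a ^ 2 * (1 - margFst (p b) a) ^ (2 * (KA - 1))) *
        ∑ c, margSnd (p b) c ^ 2 * (1 - margSnd (p b) c) ^ (2 * (KC - 1)) := by
        rw [sum_mul_sum, Fintype.sum_prod_type]
        exact sum_congr rfl fun _ _ => sum_congr rfl fun _ _ => by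
          rw [prodWeight]
          ring
    _ ≤ _ := by
        refine mul_le_mul (sum_sq_mul_pow_le (margFst_mem_stdSimplex (hp b)) hKA)
          (sum_sq_mul_pow_le (margSnd_mem_stdSimplex (hp b)) hKC) ?_ (flatNorm_nonneg _ _)
        refine sum_nonneg fun c _ => mul_nonneg (sq_nonneg _) ?_
        rw [pow_mul]
        exact pow_nonneg (sq_nonneg _) _

/-- The bound for the mean of `statNoise k` after deleting the rows seen among `2 * (KA - 1)`
samples and the columns seen among `2 * (KC - 1)` samples in each of `n` bins. -/
def flatNoise (n dA dC k KA KC : ℕ) : ℝ :=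
  (k : ℝ) ^ 2 * (n * (flatNorm dA KA * flatNorm dC KC))

lemma expect_statNoise_selectCells_le {KA KC : ℕ} (hKA : 1 ≤ KA) (hKC : 1 ≤ KC)
    {p : I → A × C → ℝ} (hp : ∀ b, p b ∈ stdSimplex ℝ (A × C)) (k : ℕ) :
    expect (selectWeight (2 * (KA - 1)) (2 * (KC - 1)) p)
        (fun yz => statNoise k (selectCells yz) p) ≤
      flatNoise (Fintype.card I) (Fintype.card A) (Fintype.card C) k KA KC := by
  simp only [statNoise, expect_const_mul, expect_sum, flatNoise]
  refine mul_le_mul_of_nonneg_left ?_ (sq_nonneg _)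
  simpa using sum_le_sum fun b (_ : b ∈ univ) => expect_selectCells_cellNoise_le hKA hKC hp b

lemma one_sub_pow_le {x : ℝ} (hx : x ≤ 1) (n : ℕ) : 1 - (1 - x) ^ n ≤ n * x := by
  linarith [one_add_mul_sub_le_pow (by linarith : -1 ≤ 1 - x) n]

/-- The probability that the statistic reaches the threshold `T`, on the cells that remain after
deleting the rows seen among `2 * (KA - 1)` samples and the columns seen among `2 * (KC - 1)`
samples. -/
def exceedProb (k KA KC : ℕ) (p : I → A × C → ℝ) (T : ℝ) : ℝ :=
  expect (selectWeight (2 * (KA - 1)) (2 * (KC - 1)) p) fun yz =>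
    prob (groupsWeight k p) fun ξη => T ≤ cellStat (selectCells yz) ξη

lemma exceedProb_le_of_depend_eq_zero {k KA KC : ℕ} (hKA : 1 ≤ KA) (hKC : 1 ≤ KC)
    {p : I → A × C → ℝ} (hp : ∀ b, p b ∈ stdSimplex ℝ (A × C))
    (hind : ∀ b z, depend (p b) z = 0) {T : ℝ} (hT : 0 < T) :
    exceedProb k KA KC p T ≤
      128 * flatNoise (Fintype.card I) (Fintype.card A) (Fintype.card C) k KA KC / T ^ 2 := by
  have hg := groupsWeight_mem_stdSimplex k hp
  have hcheb : ∀ yz : (I × Fin (2 * (KA - 1)) → A × C) × (I × Fin (2 * (KC - 1)) → A × C),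
      prob (groupsWeight k p) (fun ξη => T ≤ cellStat (selectCells yz) ξη) ≤
        128 / T ^ 2 * statNoise k (selectCells yz) p := fun yz => by
    have hvar := expect_cellStat_sub_sq_le k hp (selectCells_eq_zero_or_one yz)
    have hsignal : statSignal k (selectCells yz) p = 0 := by simp [statSignal, cellSignal, hind]
    simp only [hsignal, sub_zero, mul_zero, zero_mul, zero_add, add_zero] at hvar
    calc _ ≤ prob (groupsWeight k p) (fun ξη => T ^ 2 ≤ cellStat (selectCells yz) ξη ^ 2) :=
          prob_mono hg fun ξη h => pow_le_pow_left₀ hT.le h 2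
      _ ≤ _ := prob_le_expect_div hg (fun _ => sq_nonneg _) (by positivity)
      _ ≤ _ := by
        rw [div_mul_eq_mul_div]
        exact div_le_div_of_nonneg_right hvar (by positivity)
  refine (expect_mono (selectWeight_mem_stdSimplex _ _ hp) hcheb).trans ?_
  rw [expect_const_mul, mul_div_right_comm]
  exact mul_le_mul_of_nonneg_left (expect_statNoise_selectCells_le hKA hKC hp k) (by positivity)

lemma expect_one_sub_selectCells_le {KA KC : ℕ} (hKA : 1 ≤ KA) (hKC : 1 ≤ KC)
    {p : I → A × C → ℝ} (hp : ∀ b, p b ∈ stdSimplex ℝ (A × C)) (b : I) (z : A × C) :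
    expect (selectWeight (2 * (KA - 1)) (2 * (KC - 1)) p) (fun yz => 1 - selectCells yz b z) ≤
      2 * ((KA - 1) * margFst (p b) z.1) + 2 * ((KC - 1) * margSnd (p b) z.2) := by
  rw [expect_sub, expect_const (selectWeight_mem_stdSimplex _ _ hp), expect_selectCells hp]
  have hA := margFst_mem_stdSimplex (hp b)
  have hC := margSnd_mem_stdSimplex (hp b)
  have hA1 := le_one_of_mem_stdSimplex hA z.1
  have hC1 := le_one_of_mem_stdSimplex hC z.2
  have hrow := one_sub_pow_le hA1 (2 * (KA - 1))
  have hcol := one_sub_pow_le hC1 (2 * (KC - 1))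
  have hrow1 := pow_le_one₀ (n := 2 * (KA - 1)) (sub_nonneg.2 hA1) (sub_le_self _ (hA.1 z.1))
  have hcol1 := pow_le_one₀ (n := 2 * (KC - 1)) (sub_nonneg.2 hC1) (sub_le_self _ (hC.1 z.2))
  push_cast [Nat.cast_sub hKA, Nat.cast_sub hKC] at hrow hcol
  nlinarith [mul_nonneg (sub_nonneg.2 hrow1) (sub_nonneg.2 hcol1)]

lemma four_mul_sub_lost_le_statSignal {I A C : Type*} [Fintype I] [Fintype A] [Fintype C]
    (k : ℕ) {c : I → A × C → ℝ} (hc : ∀ b z, 0 ≤ c b z)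
    (p : I → A × C → ℝ) (cells : I → Finset (A × C)) :
    4 * ((k : ℝ) ^ 2 * ∑ b, ∑ z ∈ cells b, depend (p b) z ^ 2 -
      (k : ℝ) ^ 2 * ∑ b, ∑ z ∈ cells b, (1 - c b z) * depend (p b) z ^ 2) ≤
      statSignal k c p := by
  rw [← mul_sub, mul_left_comm, ← sum_sub_distrib, mul_sum, statSignal]
  refine mul_le_mul_of_nonneg_left (sum_le_sum fun b _ => ?_) (sq_nonneg _)
  rw [← sum_sub_distrib, mul_sum]
  calc _ = ∑ z ∈ cells b, c b z * (2 * depend (p b) z) ^ 2 := sum_congr rfl fun z _ => by ring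
    _ ≤ _ := sum_le_sum_of_subset_of_nonneg (subset_univ _)
        fun z _ _ => mul_nonneg (hc b z) (sq_nonneg _)

/-- The expected loss of signal by the deletions is at most a twentieth, so Markov's inequality
applies to the loss. -/
lemma prob_statSignal_selectCells_lt_le {k KA KC : ℕ} (hKA : 1 ≤ KA) (hKC : 1 ≤ KC)
    {p : I → A × C → ℝ} (hp : ∀ b, p b ∈ stdSimplex ℝ (A × C)) {cells : I → Finset (A × C)}
    (hA : ∀ b, ∀ z ∈ cells b, ((KA : ℝ) - 1) * margFst (p b) z.1 ≤ 1 / 80)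
    (hC : ∀ b, ∀ z ∈ cells b, ((KC : ℝ) - 1) * margSnd (p b) z.2 ≤ 1 / 80) {Y : ℝ}
    (hY : Y = (k : ℝ) ^ 2 * ∑ b, ∑ z ∈ cells b, depend (p b) z ^ 2) (hY0 : 0 < Y) :
    prob (selectWeight (2 * (KA - 1)) (2 * (KC - 1)) p)
      (fun yz => statSignal k (selectCells yz) p < 2 * Y) ≤ 1 / 10 := by
  have hw := selectWeight_mem_stdSimplex (2 * (KA - 1)) (2 * (KC - 1)) hp
  set lost : (I × Fin (2 * (KA - 1)) → A × C) × (I × Fin (2 * (KC - 1)) → A × C) → ℝ :=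
    fun yz => (k : ℝ) ^ 2 * ∑ b, ∑ z ∈ cells b, (1 - selectCells yz b z) * depend (p b) z ^ 2
    with hlost
  have hlost_nonneg : ∀ yz, 0 ≤ lost yz := fun yz => mul_nonneg (sq_nonneg _) <|
    sum_nonneg fun b _ => sum_nonneg fun z _ => mul_nonneg
      (by rcases selectCells_eq_zero_or_one yz b z with h | h <;> simp [h]) (sq_nonneg _)
  have hmean : expect (selectWeight (2 * (KA - 1)) (2 * (KC - 1)) p) lost ≤ Y / 20 := by
    simp only [hlost, expect_const_mul, expect_sum, expect_mul_const]
    rw [hY, mul_div_assoc, sum_div]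
    refine mul_le_mul_of_nonneg_left (sum_le_sum fun b _ => ?_) (sq_nonneg _)
    rw [sum_div]
    refine sum_le_sum fun z hz => ?_
    have hmiss := expect_one_sub_selectCells_le hKA hKC hp b z
    have hlight : expect (selectWeight (2 * (KA - 1)) (2 * (KC - 1)) p)
        (fun yz => 1 - selectCells yz b z) ≤ 1 / 20 := by linarith [hA b z hz, hC b z hz]
    linarith [mul_le_mul_of_nonneg_right hlight (sq_nonneg (depend (p b) z))]
  calc _ ≤ prob (selectWeight (2 * (KA - 1)) (2 * (KC - 1)) p) (fun yz => Y / 2 ≤ lost yz) :=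
        prob_mono hw fun yz h => by
          have hkept := four_mul_sub_lost_le_statSignal k
            (fun b => nonneg_of_eq_zero_or_one (selectCells_eq_zero_or_one yz b)) p cells
          rw [← hY] at hkept
          linarith
    _ ≤ _ := prob_le_expect_div hw hlost_nonneg (half_pos hY0)
    _ ≤ 1 / 10 := by
        rw [div_le_iff₀ (half_pos hY0)]
        linarith

lemma le_exceedProb {k KA KC : ℕ} (hKA : 1 ≤ KA) (hKC : 1 ≤ KC)
    {p : I → A × C → ℝ} (hp : ∀ b, p b ∈ stdSimplex ℝ (A × C)) {cells : I → Finset (A × C)}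
    (hA : ∀ b, ∀ z ∈ cells b, ((KA : ℝ) - 1) * margFst (p b) z.1 ≤ 1 / 80)
    (hC : ∀ b, ∀ z ∈ cells b, ((KC : ℝ) - 1) * margSnd (p b) z.2 ≤ 1 / 80) {ρ T : ℝ}
    (hρ1 : 1 ≤ ρ)
    (hρ : flatNoise (Fintype.card I) (Fintype.card A) (Fintype.card C) k KA KC ≤ ρ ^ 2)
    (hsignal : 10 ^ 6 * ρ ≤ (k : ℝ) ^ 2 * ∑ b, ∑ z ∈ cells b, depend (p b) z ^ 2)
    (hT : T ≤ (k : ℝ) ^ 2 * ∑ b, ∑ z ∈ cells b, depend (p b) z ^ 2) :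
    4 / 5 ≤ exceedProb k KA KC p T := by
  set Y := (k : ℝ) ^ 2 * ∑ b, ∑ z ∈ cells b, depend (p b) z ^ 2 with hY
  have hw := selectWeight_mem_stdSimplex (2 * (KA - 1)) (2 * (KC - 1)) hp
  have hg := groupsWeight_mem_stdSimplex k hp
  have hweak := prob_statSignal_selectCells_lt_le hKA hKC hp hA hC hY (by linarith)
  have hnoisy : prob (selectWeight (2 * (KA - 1)) (2 * (KC - 1)) p)
      (fun yz => 20 * ρ ^ 2 ≤ statNoise k (selectCells yz) p) ≤ 1 / 20 := by
    refine (prob_le_expect_div hw (fun yz => mul_nonneg (sq_nonneg _) (sum_nonneg fun b _ =>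
      cellNoise_nonneg (nonneg_of_eq_zero_or_one (selectCells_eq_zero_or_one yz b)) _))
      (by positivity)).trans ?_
    rw [div_le_iff₀ (by positivity)]
    exact ((expect_statNoise_selectCells_le hKA hKC hp k).trans hρ).trans_eq (by ring)
  have hgood := sub_prob_le_expect hw
    (fun yz : (I × Fin (2 * (KA - 1)) → A × C) × (I × Fin (2 * (KC - 1)) → A × C) =>
      statSignal k (selectCells yz) p < 2 * Y ∨ 20 * ρ ^ 2 ≤ statNoise k (selectCells yz) p)
    (f := fun yz => prob (groupsWeight k p) fun ξη => T ≤ cellStat (selectCells yz) ξη)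
    (c := 19 / 20) (by norm_num) (fun yz => prob_nonneg hg _) fun yz h => by
      obtain ⟨hstrong, hquiet⟩ := not_or.1 h
      have hfail := prob_cellStat_lt_le hp (selectCells_eq_zero_or_one yz) hρ1
        (not_le.1 hquiet).le (by linarith [not_lt.1 hstrong]) (T := T) (by linarith)
      rw [prob_not hg] at hfail
      linarith
  have hbad := prob_or_le hw
    (fun yz : (I × Fin (2 * (KA - 1)) → A × C) × (I × Fin (2 * (KC - 1)) → A × C) =>
      statSignal k (selectCells yz) p < 2 * Y)
    fun yz => 20 * ρ ^ 2 ≤ statNoise k (selectCells yz) p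
  unfold exceedProb
  linarith

end Selection

/-! ### Sampling bins in blocks -/

section Sampling

variable {A B C R X ι : Type*} [Fintype A] [Fintype B] [Fintype C] [Fintype R] [Fintype X]
  [Fintype ι] [DecidableEq R] [DecidableEq ι]

/-- The distribution on `A × B × C` with bin weights `q` on `B` and conditional distributions `p`
on `A × C`. -/
def joint {A B C : Type*} (q : B → ℝ) (p : B → A × C → ℝ) (x : A × B × C) : ℝ :=
  q x.2.1 * p x.2.1 (x.1, x.2.2)

/-- The bins that are hit in every one of the blocks `β r`. -/
def usedBins {B R : Type*} [Fintype B] {n : ℕ} (β : R → Fin n → B) : Finset B :=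
  open Classical in univ.filter fun b => ∀ r, ∃ i, β r i = b

/-- The weights of blocks, indexed by `R`, of `n` independent bins each. -/
def blockWeight {B : Type*} (R : Type*) [Fintype R] (n : ℕ) (q : B → ℝ) : (R → Fin n → B) → ℝ :=
  piWeight fun _ => piWeight fun _ => q

lemma mem_usedBins {B R : Type*} [Fintype B] {n : ℕ} {β : R → Fin n → B} {b : B} :
    b ∈ usedBins β ↔ ∀ r, ∃ i, β r i = b := by
  simp [usedBins]

lemma card_usedBins_le {B R : Type*} [Fintype B] [Nonempty R] {n : ℕ} (β : R → Fin n → B) :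
    #(usedBins β) ≤ n := by
  classical
  obtain ⟨r⟩ := ‹Nonempty R›
  have hsub : usedBins β ⊆ univ.image (β r) := fun b hb => by
    simpa using mem_usedBins.1 hb r
  simpa using (card_le_card hsub).trans card_image_le

/-- The position in the block `r` of a sample that lies in the used bin `b`. -/
def usedSample {B R : Type*} [Fintype B] {n : ℕ} (β : R → Fin n → B) (br : usedBins β × R) :
    R × Fin n :=
  (br.2, (mem_usedBins.1 br.1.2 br.2).choose)

lemma usedSample_spec {B R : Type*} [Fintype B] {n : ℕ} (β : R → Fin n → B)
    (br : usedBins β × R) : β (usedSample β br).1 (usedSample β br).2 = br.1 :=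
  (mem_usedBins.1 br.1.2 br.2).choose_spec

lemma usedSample_injective {B R : Type*} [Fintype B] {n : ℕ} (β : R → Fin n → B) :
    Function.Injective (usedSample β) := fun x y h => by
  have hbin := usedSample_spec β x
  rw [h, usedSample_spec β y] at hbin
  exact Prod.ext (Subtype.ext hbin.symm) (congrArg Prod.fst h)

lemma blockWeight_mem_stdSimplex (n : ℕ) {q : B → ℝ} (hq : q ∈ stdSimplex ℝ B) :
    blockWeight R n q ∈ stdSimplex ℝ (R → Fin n → B) :=
  piWeight_mem_stdSimplex fun _ => piWeight_mem_stdSimplex fun _ => hq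

lemma joint_mem_stdSimplex {A B C : Type*} [Fintype A] [Fintype B] [Fintype C] {q : B → ℝ}
    (hq : q ∈ stdSimplex ℝ B) {p : B → A × C → ℝ} (hp : ∀ b, p b ∈ stdSimplex ℝ (A × C)) :
    joint q p ∈ stdSimplex ℝ (A × B × C) := by
  refine ⟨fun x => mul_nonneg (hq.1 _) ((hp _).1 _), ?_⟩
  have hmass : ∀ b, ∑ a, ∑ c, p b (a, c) = 1 := fun b => by
    rw [← Fintype.sum_prod_type', (hp b).2]
  simp only [joint, Fintype.sum_prod_type]
  rw [sum_comm]
  simp only [← mul_sum, hmass, mul_one, hq.2]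

lemma expect_piWeight_joint (q : B → ℝ) (p : B → A × C → ℝ)
    (G : (ι → B) → (ι → A × C) → ℝ) :
    expect (piWeight fun _ : ι => joint q p)
        (fun s => G (fun i => (s i).2.1) fun i => ((s i).1, (s i).2.2)) =
      expect (piWeight fun _ => q) fun β => expect (piWeight fun i => p (β i)) (G β) := by
  let binFirst : A × B × C ≃ B × (A × C) :=
    ⟨fun x => (x.2.1, x.1, x.2.2), fun y => (y.2.1, y.1, y.2.2), fun _ => rfl, fun _ => rfl⟩
  exact (expect_piWeight_map binFirst (fun _ : ι => fun y => q y.1 * p y.1 y.2)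
    fun z => G (fun j => (z j).1) fun j => (z j).2).trans
      (expect_piWeight_pair (fun _ => q) (fun _ => p) G)

lemma expect_comp_usedSample [DecidableEq B] {n : ℕ} (β : R → Fin n → B) {p : B → X → ℝ}
    (hp : ∀ b, p b ∈ stdSimplex ℝ X) (G : (usedBins β × R → X) → ℝ) :
    expect (piWeight fun j : R × Fin n => p (β j.1 j.2)) (fun x => G (x ∘ usedSample β)) =
      expect (binWeight R fun b : usedBins β => p b) G := by
  have h := expect_piWeight_comp (usedSample_injective β) (fun j => hp (β j.1 j.2)) G
  simp only [usedSample_spec] at h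
  exact h

/-- Given the bins of all samples, the samples taken for the used bins are independent, so an event
`S` for them can be realized by an event for independent samples from `joint q p`. -/
lemma exists_prob_joint_eq [DecidableEq B] {N n : ℕ} (hN : Fintype.card R * n ≤ N)
    (S : (U : Finset B) → (U × R → A × C) → Prop) :
    ∃ S' : (Fin N → A × B × C) → Prop, ∀ q ∈ stdSimplex ℝ B, ∀ p : B → A × C → ℝ,
      (∀ b, p b ∈ stdSimplex ℝ (A × C)) →
      prob (piWeight fun _ : Fin N => joint q p) S' =
        expect (blockWeight R n q) fun β =>
          prob (binWeight R fun b : usedBins β => p b) (S (usedBins β)) := by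
  classical
  obtain ⟨e⟩ : Nonempty (R × Fin n ↪ Fin N) :=
    Function.Embedding.nonempty_of_card_le (by simpa using hN)
  let F (β : R × Fin n → B) (x : R × Fin n → A × C) : ℝ :=
    if S (usedBins (Function.curry β)) (x ∘ usedSample (Function.curry β)) then 1 else 0
  refine ⟨fun s => S (usedBins fun r i => (s (e (r, i))).2.1)
    ((fun j => ((s (e j)).1, (s (e j)).2.2)) ∘ usedSample fun r i => (s (e (r, i))).2.1),
    fun q hq p hp => ?_⟩
  calc _ = expect (piWeight fun _ : R × Fin n => joint q p)
          (fun s => F (fun j => (s j).2.1) fun j => ((s j).1, (s j).2.2)) :=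
        expect_piWeight_comp e.injective (fun _ => joint_mem_stdSimplex hq hp)
          fun s => F (fun j => (s j).2.1) fun j => ((s j).1, (s j).2.2)
    _ = expect (piWeight fun _ => q) fun β => expect (piWeight fun j => p (β j)) (F β) :=
        expect_piWeight_joint q p F
    _ = expect (piWeight fun _ => q) fun β =>
          prob (binWeight R fun b : usedBins (Function.curry β) => p b)
            (S (usedBins (Function.curry β))) :=
        congrArg _ <| funext fun β => expect_comp_usedSample (Function.curry β) hp
          fun y => if S (usedBins (Function.curry β)) y then 1 else 0
    _ = _ := expect_piWeight_curry (fun _ : R × Fin n => q) fun β =>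
          prob (binWeight R fun b : usedBins β => p b) (S (usedBins β))

end Sampling

section Role

variable {I A C R R' X : Type*} [Fintype I] [Fintype A] [Fintype C] [Fintype R] [Fintype R']
  [Fintype X] [DecidableEq I] [DecidableEq R] [DecidableEq R']

/-- The roles of the samples of a bin: `s` samples whose rows and `t` samples whose columns are
deleted, and two groups of `k` pairs. -/
abbrev Role (s t k : ℕ) : Type := (Fin s ⊕ Fin t) ⊕ ((Fin k ⊕ Fin k) ⊕ (Fin k ⊕ Fin k))

lemma card_role (s t k : ℕ) : Fintype.card (Role s t k) = s + t + 4 * k := by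
  simp only [Fintype.card_sum, Fintype.card_fin]
  ring

/-- The restriction of samples in each bin to the roles on the left. -/
def leftRoles {I X R R' : Type*} (y : I × (R ⊕ R') → X) (br : I × R) : X := y (br.1, Sum.inl br.2)

/-- The restriction of samples in each bin to the roles on the right. -/
def rightRoles {I X R R' : Type*} (y : I × (R ⊕ R') → X) (br : I × R') : X :=
  y (br.1, Sum.inr br.2)

/-- The samples in each bin with their roles on the left and on the right paired up. -/
def pairRoles {I X R : Type*} (y : I × (R ⊕ R) → X) (br : I × R) : X × X :=
  (leftRoles y br, rightRoles y br)

/-- The samples whose rows and the samples whose columns are deleted. -/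
def selecting {I X : Type*} {s t k : ℕ} (y : I × Role s t k → X) :
    (I × Fin s → X) × (I × Fin t → X) :=
  (leftRoles (leftRoles y), rightRoles (leftRoles y))

/-- The two groups of pairs of samples. -/
def groups {I X : Type*} {s t k : ℕ} (y : I × Role s t k → X) :
    (I × Fin k → X × X) × (I × Fin k → X × X) :=
  (pairRoles (leftRoles (rightRoles y)), pairRoles (rightRoles (rightRoles y)))

lemma expect_binWeight_roles {p : I → X → ℝ} (hp : ∀ b, p b ∈ stdSimplex ℝ X)
    (G : (I × R → X) → (I × R' → X) → ℝ) :
    expect (binWeight (R ⊕ R') p) (fun y => G (leftRoles y) (rightRoles y)) =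
      expect (binWeight R p) fun y => expect (binWeight R' p) (G y) := by
  have he : Function.Injective (Sum.elim
      (fun br : I × R => ((br.1, Sum.inl br.2) : I × (R ⊕ R')))
      (fun br : I × R' => ((br.1, Sum.inr br.2) : I × (R ⊕ R')))) := by
    rintro (⟨b, r⟩ | ⟨b, r⟩) (⟨b', r'⟩ | ⟨b', r'⟩) h <;> simp_all
  exact expect_piWeight_comp₂ he (fun br : I × (R ⊕ R') => hp br.1) G

lemma expect_binWeight_pairRoles {p : I → X → ℝ} (hp : ∀ b, p b ∈ stdSimplex ℝ X)
    (G : (I × R → X × X) → ℝ) :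
    expect (binWeight (R ⊕ R) p) (fun y => G (pairRoles y)) =
      expect (binWeight R fun b => prodWeight (p b) (p b)) G :=
  (expect_binWeight_roles hp fun y z => G fun br => (y br, z br)).trans
    (expect_piWeight_pair (fun br : I × R => p br.1) (fun br _ => p br.1)
      fun y z => G fun br => (y br, z br)).symm

lemma expect_binWeight_selecting_groups {s t k : ℕ} {p : I → A × C → ℝ}
    (hp : ∀ b, p b ∈ stdSimplex ℝ (A × C))
    (G : (I × Fin s → A × C) × (I × Fin t → A × C) →
      (I × Fin k → (A × C) × (A × C)) × (I × Fin k → (A × C) × (A × C)) → ℝ) :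
    expect (binWeight (Role s t k) p) (fun y => G (selecting y) (groups y)) =
      expect (selectWeight s t p) fun yz => expect (groupsWeight k p) (G yz) := by
  have hgroups : ∀ yz, expect (binWeight ((Fin k ⊕ Fin k) ⊕ (Fin k ⊕ Fin k)) p)
      (fun z => G yz (pairRoles (leftRoles z), pairRoles (rightRoles z))) =
      expect (groupsWeight k p) (G yz) := fun yz => by
    rw [expect_binWeight_roles hp fun y z => G yz (pairRoles y, pairRoles z), groupsWeight,
      expect_prodWeight]
    have hright : ∀ ξ, expect (binWeight (Fin k ⊕ Fin k) p) (fun z => G yz (ξ, pairRoles z)) =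
        expect (binWeight (Fin k) fun b => prodWeight (p b) (p b)) fun η => G yz (ξ, η) :=
      fun ξ => expect_binWeight_pairRoles hp fun η => G yz (ξ, η)
    simp only [hright]
    exact expect_binWeight_pairRoles hp fun ξ => expect _ fun η => G yz (ξ, η)
  simp only [selecting, groups]
  rw [expect_binWeight_roles hp fun y z => G (leftRoles y, rightRoles y)
    (pairRoles (leftRoles z), pairRoles (rightRoles z))]
  simp only [hgroups]
  rw [expect_binWeight_roles hp fun y z => expect (groupsWeight k p) (G (y, z)), selectWeight,
    expect_prodWeight]

lemma prob_binWeight_role_eq_exceedProb [DecidableEq A] [DecidableEq C] (k KA KC : ℕ)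
    {p : I → A × C → ℝ} (hp : ∀ b, p b ∈ stdSimplex ℝ (A × C)) (T : ℝ) :
    prob (binWeight (Role (2 * (KA - 1)) (2 * (KC - 1)) k) p)
        (fun y => T ≤ cellStat (selectCells (selecting y)) (groups y)) =
      exceedProb k KA KC p T :=
  expect_binWeight_selecting_groups hp fun yz ξη =>
    @ite ℝ (T ≤ cellStat (selectCells yz) ξη) (Classical.propDecidable _) 1 0

end Role

section RandomSubset

variable {Ω B : Type*} [Fintype Ω] [Fintype B] {w : Ω → ℝ}

lemma sum_eq_sum_mul_ite_mem {B : Type*} [Fintype B] [DecidableEq B] (U : Finset B) (Q : B → ℝ) :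
    ∑ b ∈ U, Q b = ∑ b, Q b * if b ∈ U then 1 else 0 := by
  simp [sum_ite_mem]

lemma expect_sum_mem (w : Ω → ℝ) (U : Ω → Finset B) (Q : B → ℝ) :
    expect w (fun ω => ∑ b ∈ U ω, Q b) = ∑ b, Q b * prob w fun ω => b ∈ U ω := by
  classical
  simp only [sum_eq_sum_mul_ite_mem (U _) Q, expect_sum, expect_const_mul, prob]
  congr!

lemma expect_sq_sum_mem_sub_le (hw : w ∈ stdSimplex ℝ Ω) {U : Ω → Finset B}
    (hU : ∀ b b', b ≠ b' → prob w (fun ω => b ∈ U ω ∧ b' ∈ U ω) ≤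
      prob w (fun ω => b ∈ U ω) * prob w (fun ω => b' ∈ U ω))
    {Q : B → ℝ} (hQ : ∀ b, 0 ≤ Q b) :
    expect w (fun ω => (∑ b ∈ U ω, Q b - expect w fun ω => ∑ b ∈ U ω, Q b) ^ 2) ≤
      ∑ b, Q b ^ 2 * prob w fun ω => b ∈ U ω := by
  classical
  set E := expect w fun ω => ∑ b ∈ U ω, Q b with hE
  have hpair : ∀ b b', Q b * Q b' * prob w (fun ω => b ∈ U ω ∧ b' ∈ U ω) ≤
      Q b * prob w (fun ω => b ∈ U ω) * (Q b' * prob w fun ω => b' ∈ U ω) +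
        if b = b' then Q b ^ 2 * prob w (fun ω => b ∈ U ω) else 0 := fun b b' => by
    obtain rfl | hb := eq_or_ne b b'
    · simp only [and_self, if_true, ← pow_two]
      exact le_add_of_nonneg_left (sq_nonneg _)
    · rw [if_neg hb, add_zero, mul_mul_mul_comm]
      exact mul_le_mul_of_nonneg_left (hU b b' hb) (mul_nonneg (hQ b) (hQ b'))
  have hsum := sum_le_sum fun b (_ : b ∈ univ) => sum_le_sum fun b' (_ : b' ∈ univ) => hpair b b'
  simp only [sum_add_distrib, sum_ite_eq, mem_univ, if_true, ← sum_mul_sum,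
    ← expect_sum_mem w U Q, ← hE] at hsum
  have hexpand : ∀ ω, (∑ b ∈ U ω, Q b - E) ^ 2 =
      ∑ b, ∑ b', Q b * Q b' * (if b ∈ U ω ∧ b' ∈ U ω then 1 else 0) -
        2 * E * ∑ b ∈ U ω, Q b + E ^ 2 := fun ω => by
    have hsq : (∑ b ∈ U ω, Q b) * ∑ b ∈ U ω, Q b =
        ∑ b, ∑ b', Q b * Q b' * (if b ∈ U ω ∧ b' ∈ U ω then 1 else 0) := by
      simp only [sum_eq_sum_mul_ite_mem (U _) Q, sum_mul_sum]
      exact sum_congr rfl fun b _ => sum_congr rfl fun b' _ => by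
        by_cases hb : b ∈ U ω <;> simp [hb]
    rw [← hsq]
    ring
  have hprob : ∀ b b', expect w (fun ω => if b ∈ U ω ∧ b' ∈ U ω then (1 : ℝ) else 0) =
      prob w fun ω => b ∈ U ω ∧ b' ∈ U ω := fun b b' => by
    rw [prob]
    congr!
  simp only [hexpand, expect_add, expect_sub, expect_const_mul, expect_const hw, expect_sum w univ,
    hprob, ← hE]
  linarith

lemma prob_sum_mem_lt_le (hw : w ∈ stdSimplex ℝ Ω) {U : Ω → Finset B}
    (hU : ∀ b b', b ≠ b' → prob w (fun ω => b ∈ U ω ∧ b' ∈ U ω) ≤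
      prob w (fun ω => b ∈ U ω) * prob w (fun ω => b' ∈ U ω))
    {Q : B → ℝ} (hQ : ∀ b, 0 ≤ Q b) {D E : ℝ} (hQD : ∀ b, Q b ≤ D)
    (hE : E = ∑ b, Q b * prob w fun ω => b ∈ U ω) (hD : 40 * D ≤ E) (hpos : 0 < E) :
    prob w (fun ω => ∑ b ∈ U ω, Q b < E / 2) ≤ 1 / 10 := by
  have hvar := expect_sq_sum_mem_sub_le hw hU hQ
  rw [expect_sum_mem, ← hE] at hvar
  have hvarD : ∑ b, Q b ^ 2 * prob w (fun ω => b ∈ U ω) ≤ D * E := by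
    rw [hE, mul_sum]
    refine sum_le_sum fun b _ => ?_
    rw [pow_two, mul_assoc]
    exact mul_le_mul_of_nonneg_right (hQD b) (mul_nonneg (hQ b) (prob_nonneg hw _))
  calc _ ≤ prob w (fun ω => (E / 2) ^ 2 ≤ (∑ b ∈ U ω, Q b - E) ^ 2) :=
        prob_mono hw fun ω h => by nlinarith
    _ ≤ _ := prob_le_expect_div hw (fun _ => sq_nonneg _) (by positivity)
    _ ≤ 1 / 10 := by
      rw [div_le_iff₀ (by positivity)]
      nlinarith

lemma prob_sum_mem_lt_half_sum_le (hw : w ∈ stdSimplex ℝ Ω) {U : Ω → Finset B} {Q : B → ℝ}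
    (hQ : ∀ b, 0 ≤ Q b) (hpos : 0 < ∑ b, Q b)
    (hU : ∀ b, Q b ≠ 0 → 19 / 20 ≤ prob w fun ω => b ∈ U ω) :
    prob w (fun ω => ∑ b ∈ U ω, Q b < (∑ b, Q b) / 2) ≤ 1 / 10 := by
  have hmean : 19 / 20 * ∑ b, Q b ≤ expect w fun ω => ∑ b ∈ U ω, Q b := by
    rw [expect_sum_mem, mul_sum]
    refine sum_le_sum fun b _ => ?_
    by_cases hb : Q b = 0
    · simp [hb]
    · rw [mul_comm]
      exact mul_le_mul_of_nonneg_left (hU b hb) (hQ b)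
  calc _ ≤ prob w (fun ω => (∑ b, Q b) / 2 ≤ ∑ b, Q b - ∑ b ∈ U ω, Q b) :=
        prob_mono hw fun ω h => by linarith
    _ ≤ _ := prob_le_expect_div hw (fun ω => sub_nonneg.2 <|
        sum_le_sum_of_subset_of_nonneg (subset_univ _) fun b _ _ => hQ b) (half_pos hpos)
    _ ≤ 1 / 10 := by
      rw [div_le_iff₀ (half_pos hpos), expect_sub, expect_const hw]
      linarith

end RandomSubset

section Hits

variable {B R : Type*} [Fintype B] [Fintype R] [DecidableEq R]

lemma prob_piWeight_forall {ι X : Type*} [Fintype ι] [Fintype X] [DecidableEq ι] (p : ι → X → ℝ)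
    (S : ι → X → Prop) :
    prob (piWeight p) (fun x => ∀ i, S i (x i)) = ∏ i, prob (p i) (S i) := by
  classical
  simp only [prob, ← expect_piWeight_prod]
  congr! with x
  by_cases h : ∀ i, S i (x i)
  · simp [h]
  · obtain ⟨i, hi⟩ := not_forall.1 h
    rw [if_neg h, prod_eq_zero (mem_univ i) (if_neg hi)]

lemma prob_and_eq {Ω : Type*} [Fintype Ω] {w : Ω → ℝ} (hw : w ∈ stdSimplex ℝ Ω)
    (S S' : Ω → Prop) :
    prob w (fun ω => S ω ∧ S' ω) = 1 - prob w (fun ω => ¬ S ω) - prob w (fun ω => ¬ S' ω) +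
      prob w fun ω => ¬ S ω ∧ ¬ S' ω := by
  rw [← expect_const hw 1]
  simp only [prob, ← expect_sub, ← expect_add]
  congr! 2 with ω
  by_cases h : S ω <;> by_cases h' : S' ω <;> simp [h, h']

lemma prob_mem_eq_sum (q : B → ℝ) (s : Finset B) : prob q (fun b => b ∈ s) = ∑ b ∈ s, q b := by
  simp only [prob, expect, mul_ite, mul_one, mul_zero, ← sum_filter]
  congr 1
  ext b
  simp

lemma prob_not_exists_eq (n : ℕ) {q : B → ℝ} (hq : q ∈ stdSimplex ℝ B) (b : B) :
    prob (piWeight fun _ : Fin n => q) (fun γ => ¬ ∃ i, γ i = b) = (1 - q b) ^ n := by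
  have hmiss : prob q (fun x => ¬ x = b) = 1 - q b := by
    rw [prob_not hq]
    simpa using prob_mem_eq_sum q {b}
  simpa [hmiss] using prob_piWeight_forall (fun _ : Fin n => q) fun _ x => ¬ x = b

lemma prob_exists_eq_and_exists_eq_le (n : ℕ) {q : B → ℝ} (hq : q ∈ stdSimplex ℝ B) {b b' : B}
    (hb : b ≠ b') :
    prob (piWeight fun _ : Fin n => q) (fun γ => (∃ i, γ i = b) ∧ ∃ i, γ i = b') ≤
      (1 - (1 - q b) ^ n) * (1 - (1 - q b') ^ n) := by
  classical
  have hone : prob q (fun x => ¬ (x = b ∨ x = b')) = 1 - (q b + q b') := by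
    rw [prob_not hq, ← sum_pair hb]
    simpa using prob_mem_eq_sum q {b, b'}
  have hmiss : prob (piWeight fun _ : Fin n => q)
      (fun γ => (¬ ∃ i, γ i = b) ∧ ¬ ∃ i, γ i = b') = (1 - (q b + q b')) ^ n := by
    rw [← hone]
    simpa [forall_and] using
      prob_piWeight_forall (fun _ : Fin n => q) fun _ x => ¬ (x = b ∨ x = b')
  have hle : q b + q b' ≤ 1 := by
    rw [← hq.2, ← sum_pair hb]
    exact sum_le_sum_of_subset_of_nonneg (subset_univ _) fun i _ _ => hq.1 i
  have hpow : (1 - (q b + q b')) ^ n ≤ ((1 - q b) * (1 - q b')) ^ n :=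
    pow_le_pow_left₀ (by linarith) (by nlinarith [mul_nonneg (hq.1 b) (hq.1 b')]) n
  rw [mul_pow] at hpow
  rw [prob_and_eq (piWeight_mem_stdSimplex fun _ => hq), prob_not_exists_eq n hq,
    prob_not_exists_eq n hq, hmiss]
  linarith

/-- The probability that a bin of weight `x` is hit in each of `r` blocks of `n` samples. -/
def hitProb (r n : ℕ) (x : ℝ) : ℝ := (1 - (1 - x) ^ n) ^ r

lemma prob_mem_usedBins (n : ℕ) {q : B → ℝ} (hq : q ∈ stdSimplex ℝ B) (b : B) :
    prob (blockWeight R n q) (fun β => b ∈ usedBins β) = hitProb (Fintype.card R) n (q b) := by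
  have hhit : prob (piWeight fun _ : Fin n => q) (fun γ => ∃ i, γ i = b) = 1 - (1 - q b) ^ n := by
    rw [← prob_not_exists_eq n hq, prob_not (piWeight_mem_stdSimplex fun _ => hq), sub_sub_cancel]
  simp only [mem_usedBins]
  refine (prob_piWeight_forall (fun _ : R => piWeight fun _ : Fin n => q)
    fun _ γ => ∃ i, γ i = b).trans ?_
  rw [hhit, prod_const, card_univ, hitProb]

/-- Different bins compete for the samples, so that hitting them is negatively correlated. -/
lemma prob_mem_usedBins_and_mem_usedBins_le (n : ℕ) {q : B → ℝ} (hq : q ∈ stdSimplex ℝ B)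
    {b b' : B} (hb : b ≠ b') :
    prob (blockWeight R n q) (fun β => b ∈ usedBins β ∧ b' ∈ usedBins β) ≤
      prob (blockWeight R n q) (fun β => b ∈ usedBins β) *
        prob (blockWeight R n q) fun β => b' ∈ usedBins β := by
  rw [prob_mem_usedBins n hq, prob_mem_usedBins n hq, hitProb, hitProb, ← mul_pow]
  simp only [mem_usedBins, ← forall_and]
  refine (prob_piWeight_forall (fun _ : R => piWeight fun _ : Fin n => q)
    fun _ γ => (∃ i, γ i = b) ∧ ∃ i, γ i = b').trans_le ?_
  rw [prod_const, card_univ]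
  exact pow_le_pow_left₀ (prob_nonneg (piWeight_mem_stdSimplex fun _ => hq) _)
    (prob_exists_eq_and_exists_eq_le n hq hb) _

end Hits

/-! ### The test at one scale -/

section ScaleTest

variable {A B C : Type*} [Fintype A] [Fintype B] [Fintype C] [DecidableEq A] [DecidableEq B]
  [DecidableEq C]

/-- The probability of rejection of the test that draws blocks of `n` samples from `joint q p`,
takes from each block one sample in every used bin, and compares the statistic of these samples with
the threshold `T`. -/
def rejectProb (k KA KC n : ℕ) (q : B → ℝ) (p : B → A × C → ℝ) (T : ℝ) : ℝ :=
  expect (blockWeight (Role (2 * (KA - 1)) (2 * (KC - 1)) k) n q) fun β =>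
    exceedProb k KA KC (fun b : usedBins β => p b) T

lemma exists_prob_eq_rejectProb {N n k KA KC : ℕ}
    (hN : (2 * (KA - 1) + 2 * (KC - 1) + 4 * k) * n ≤ N) (T : ℝ) :
    ∃ S : (Fin N → A × B × C) → Prop, ∀ q ∈ stdSimplex ℝ B, ∀ p : B → A × C → ℝ,
      (∀ b, p b ∈ stdSimplex ℝ (A × C)) →
      prob (piWeight fun _ : Fin N => joint q p) S = rejectProb k KA KC n q p T := by
  rw [← card_role] at hN
  obtain ⟨S, hS⟩ := exists_prob_joint_eq (A := A) (B := B) (C := C) hN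
    fun _ y => T ≤ cellStat (selectCells (selecting y)) (groups y)
  refine ⟨S, fun q hq p hp => (hS q hq p hp).trans (congrArg _ (funext fun β => ?_))⟩
  exact prob_binWeight_role_eq_exceedProb k KA KC (fun b : usedBins β => hp b) T

lemma card_usedBins_le_min {B : Type*} [Fintype B] {n k : ℕ} (hk : 1 ≤ k) {s t : ℕ}
    (β : Role s t k → Fin n → B) : Fintype.card (usedBins β) ≤ min (Fintype.card B) n := by
  have : Nonempty (Role s t k) := ⟨Sum.inr (Sum.inl (Sum.inl ⟨0, hk⟩))⟩
  rw [Fintype.card_coe]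
  exact le_min (card_le_univ _) (card_usedBins_le β)

lemma flatNoise_mono {n n' : ℕ} (hn : n ≤ n') (dA dC k KA KC : ℕ) :
    flatNoise n dA dC k KA KC ≤ flatNoise n' dA dC k KA KC := by
  have := flatNorm_nonneg dA KA
  have := flatNorm_nonneg dC KC
  unfold flatNoise
  gcongr

lemma rejectProb_le_of_depend_eq_zero {n k KA KC : ℕ} (hk : 1 ≤ k) (hKA : 1 ≤ KA) (hKC : 1 ≤ KC)
    {q : B → ℝ} (hq : q ∈ stdSimplex ℝ B) {p : B → A × C → ℝ}
    (hp : ∀ b, p b ∈ stdSimplex ℝ (A × C)) (hind : ∀ b z, depend (p b) z = 0) {T : ℝ}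
    (hT : 0 < T) :
    rejectProb k KA KC n q p T ≤
      128 * flatNoise (min (Fintype.card B) n) (Fintype.card A) (Fintype.card C) k KA KC /
        T ^ 2 := by
  have hw := blockWeight_mem_stdSimplex (R := Role (2 * (KA - 1)) (2 * (KC - 1)) k) n hq
  refine (expect_mono hw fun β => ?_).trans (expect_const hw _).le
  refine (exceedProb_le_of_depend_eq_zero hKA hKC (fun b : usedBins β => hp b)
    (fun b => hind b) hT).trans ?_
  gcongr
  exact flatNoise_mono (card_usedBins_le_min hk β) _ _ _ _ _

lemma le_rejectProb {n k KA KC : ℕ} (hk : 1 ≤ k) (hKA : 1 ≤ KA) (hKC : 1 ≤ KC)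
    {q : B → ℝ} (hq : q ∈ stdSimplex ℝ B) {p : B → A × C → ℝ}
    (hp : ∀ b, p b ∈ stdSimplex ℝ (A × C)) {cells : B → Finset (A × C)}
    (hA : ∀ b, ∀ z ∈ cells b, ((KA : ℝ) - 1) * margFst (p b) z.1 ≤ 1 / 80)
    (hC : ∀ b, ∀ z ∈ cells b, ((KC : ℝ) - 1) * margSnd (p b) z.2 ≤ 1 / 80) {ρ T Y : ℝ}
    (hρ1 : 1 ≤ ρ)
    (hρ : flatNoise (min (Fintype.card B) n) (Fintype.card A) (Fintype.card C) k KA KC ≤ ρ ^ 2)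
    (hYρ : 10 ^ 6 * ρ ≤ Y) (hYT : T ≤ Y)
    (hY : prob (blockWeight (Role (2 * (KA - 1)) (2 * (KC - 1)) k) n q)
      (fun β => ∑ b ∈ usedBins β, (k : ℝ) ^ 2 * ∑ z ∈ cells b, depend (p b) z ^ 2 < Y) ≤ 1 / 10) :
    2 / 3 ≤ rejectProb k KA KC n q p T := by
  have hw := blockWeight_mem_stdSimplex (R := Role (2 * (KA - 1)) (2 * (KC - 1)) k) n hq
  have hpower := sub_prob_le_expect hw _ (by norm_num : (4 / 5 : ℝ) ≤ 1)
    (fun β => expect_nonneg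
      (selectWeight_mem_stdSimplex (2 * (KA - 1)) (2 * (KC - 1)) fun b : usedBins β => hp b)
      fun yz => prob_nonneg (groupsWeight_mem_stdSimplex k fun b : usedBins β => hp b)
        fun ξη => T ≤ cellStat (selectCells yz) ξη)
    fun β hβ => by
      have hsignal : Y ≤ (k : ℝ) ^ 2 * ∑ b : usedBins β, ∑ z ∈ cells b, depend (p b) z ^ 2 := by
        rw [mul_sum, sum_coe_sort (usedBins β)
          fun b => (k : ℝ) ^ 2 * ∑ z ∈ cells b, depend (p b) z ^ 2]
        exact not_lt.1 hβ
      exact le_exceedProb hKA hKC (fun b : usedBins β => hp b) (fun b => hA b) (fun b => hC b) hρ1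
        ((flatNoise_mono (card_usedBins_le_min hk β) _ _ _ _ _).trans hρ)
        (hYρ.trans hsignal) (hYT.trans hsignal)
  exact le_trans (by linarith) hpower

end ScaleTest

/-! ### Hellinger distance of the cells -/

lemma sq_sub_eq_sq_sqrt_mul_sq_sqrt {x y : ℝ} (hx : 0 ≤ x) (hy : 0 ≤ y) :
    (x - y) ^ 2 = (√x + √y) ^ 2 * (√x - √y) ^ 2 := by
  rw [← mul_pow, ← sq_sub_sq, Real.sq_sqrt hx, Real.sq_sqrt hy]

lemma sq_sqrt_sub_sqrt_le_abs {x y : ℝ} (hx : 0 ≤ x) (hy : 0 ≤ y) :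
    (√x - √y) ^ 2 ≤ |x - y| := by
  have hfactor : x - y = (√x + √y) * (√x - √y) := by
    rw [← sq_sub_sq, Real.sq_sqrt hx, Real.sq_sqrt hy]
  have hx' := Real.sqrt_nonneg x
  have hy' := Real.sqrt_nonneg y
  rw [hfactor, abs_mul, ← sq_abs, pow_two]
  refine mul_le_mul_of_nonneg_right ?_ (abs_nonneg _)
  rw [abs_of_nonneg (add_nonneg hx' hy'), abs_le]
  constructor <;> linarith

lemma mul_sq_sqrt_sub_sqrt_le {x y : ℝ} (hx : 0 ≤ x) (hy : 0 ≤ y) :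
    y * (√x - √y) ^ 2 ≤ (x - y) ^ 2 := by
  rw [sq_sub_eq_sq_sqrt_mul_sq_sqrt hx hy]
  refine mul_le_mul_of_nonneg_right ?_ (sq_nonneg _)
  nlinarith [Real.sq_sqrt hy, Real.sqrt_nonneg x, Real.sqrt_nonneg y]

section Cells

variable {A B C : Type*} [Fintype A] [Fintype B] [Fintype C]

/-- The contribution of the cell `z` to twice the squared Hellinger distance of `p` from the product
of its marginals. -/
def cellHellinger (p : A × C → ℝ) (z : A × C) : ℝ :=
  (√(p z) - √(margFst p z.1 * margSnd p z.2)) ^ 2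

lemma cellHellinger_nonneg (p : A × C → ℝ) (z : A × C) : 0 ≤ cellHellinger p z := sq_nonneg _

lemma margFst_mul_margSnd_nonneg {p : A × C → ℝ} (hp : p ∈ stdSimplex ℝ (A × C)) (z : A × C) :
    0 ≤ margFst p z.1 * margSnd p z.2 :=
  (prodWeight_marg_mem_stdSimplex hp).1 z

lemma cellHellinger_le_abs_depend {p : A × C → ℝ} (hp : p ∈ stdSimplex ℝ (A × C)) (z : A × C) :
    cellHellinger p z ≤ |depend p z| :=
  sq_sqrt_sub_sqrt_le_abs (hp.1 z) (margFst_mul_margSnd_nonneg hp z)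

lemma mul_cellHellinger_le_depend_sq {p : A × C → ℝ} (hp : p ∈ stdSimplex ℝ (A × C))
    (z : A × C) : margFst p z.1 * margSnd p z.2 * cellHellinger p z ≤ depend p z ^ 2 :=
  mul_sq_sqrt_sub_sqrt_le (hp.1 z) (margFst_mul_margSnd_nonneg hp z)

lemma depend_eq_zero_of_cellHellinger_eq_zero {p : A × C → ℝ} (hp : p ∈ stdSimplex ℝ (A × C))
    {z : A × C} (hz : cellHellinger p z = 0) : depend p z = 0 :=
  sub_eq_zero.2 <| (Real.sqrt_inj (hp.1 z) (margFst_mul_margSnd_nonneg hp z)).1 <|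
    sub_eq_zero.1 (pow_eq_zero_iff two_ne_zero |>.1 hz)

lemma sum_abs_depend_le {p : A × C → ℝ} (hp : p ∈ stdSimplex ℝ (A × C)) :
    ∑ z, |depend p z| ≤ 2 :=
  calc ∑ z, |depend p z| ≤ ∑ z, (p z + margFst p z.1 * margSnd p z.2) :=
        sum_le_sum fun z _ => by
          have := hp.1 z
          have := margFst_mul_margSnd_nonneg hp z
          rw [depend, prodWeight, abs_le]
          constructor <;> linarith
    _ = 1 + 1 := by
      rw [sum_add_distrib, hp.2]
      exact congrArg _ (prodWeight_marg_mem_stdSimplex hp).2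
    _ = 2 := by norm_num

lemma sum_cellHellinger_le {p : A × C → ℝ} (hp : p ∈ stdSimplex ℝ (A × C)) :
    ∑ z, cellHellinger p z ≤ 2 :=
  (sum_le_sum fun z _ => cellHellinger_le_abs_depend hp z).trans (sum_abs_depend_le hp)

lemma sum_depend_sq_le {p : A × C → ℝ} (hp : p ∈ stdSimplex ℝ (A × C)) :
    ∑ z, depend p z ^ 2 ≤ 4 :=
  calc ∑ z, depend p z ^ 2 = ∑ z, |depend p z| ^ 2 := by simp only [sq_abs]
    _ ≤ (∑ z, |depend p z|) ^ 2 := sum_sq_le_sq_sum_of_nonneg fun z _ => abs_nonneg _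
    _ ≤ 2 ^ 2 := pow_le_pow_left₀ (sum_nonneg fun z _ => abs_nonneg _) (sum_abs_depend_le hp) 2
    _ = 4 := by norm_num

lemma sq_sum_cellHellinger_le {p : B → A × C → ℝ} (hp : ∀ b, p b ∈ stdSimplex ℝ (A × C))
    (cells : B → Finset (A × C)) :
    (∑ b, ∑ z ∈ cells b, cellHellinger (p b) z) ^ 2 ≤
      (∑ b, (#(cells b) : ℝ)) * ∑ b, ∑ z ∈ cells b, depend (p b) z ^ 2 := by
  have hcard : ((#(univ.sigma cells) : ℕ) : ℝ) = ∑ b, (#(cells b) : ℝ) := by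
    rw [card_sigma, Nat.cast_sum]
  rw [sum_sigma', sum_sigma', ← hcard]
  refine sq_sum_le_card_mul_sum_sq.trans ?_
  refine mul_le_mul_of_nonneg_left (sum_le_sum fun x _ => ?_) (Nat.cast_nonneg _)
  rw [← sq_abs (depend _ _)]
  exact pow_le_pow_left₀ (cellHellinger_nonneg _ _) (cellHellinger_le_abs_depend (hp _) _) 2

end Cells

section Mixture

lemma margAB_joint {A B C : Type} [Fintype C] (q : B → ℝ) (p : B → A × C → ℝ) (a : A)
    (b : B) :
    margAB (joint q p) a b = q b * margFst (p b) a := by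
  simp only [margAB, joint, margFst, mul_sum]

lemma margBC_joint {A B C : Type} [Fintype A] (q : B → ℝ) (p : B → A × C → ℝ) (b : B)
    (c : C) :
    margBC (joint q p) b c = q b * margSnd (p b) c := by
  simp only [margBC, joint, margSnd, mul_sum]

lemma margB_eq_sum {A B C : Type} [Fintype A] [Fintype C] (P : A × B × C → ℝ) (b : B) :
    margB P b = ∑ z : A × C, P (z.1, b, z.2) := by
  rw [Fintype.sum_prod_type, margB]

variable {A B C : Type} [Fintype A] [Fintype C]

lemma margB_joint (q : B → ℝ) {p : B → A × C → ℝ} (hp : ∀ b, p b ∈ stdSimplex ℝ (A × C)) :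
    margB (joint q p) = q := by
  ext b
  simp only [margB_eq_sum, joint, ← mul_sum, Prod.mk.eta, (hp b).2, mul_one]

lemma markovRef_joint (q : B → ℝ) {p : B → A × C → ℝ} (hp : ∀ b, p b ∈ stdSimplex ℝ (A × C)) :
    markovRef (joint q p) = joint q fun b => prodWeight (margFst (p b)) (margSnd (p b)) := by
  ext ⟨a, b, c⟩
  simp only [markovRef, condCB, margAB_joint, margBC_joint, margB_joint q hp, joint, prodWeight]
  by_cases hb : q b = 0
  · simp [hb]
  · field_simp

variable [Fintype B]

lemma sum_triple_eq_sum_bin (f : A × B × C → ℝ) :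
    ∑ x, f x = ∑ b, ∑ z : A × C, f (z.1, b, z.2) := by
  simp only [Fintype.sum_prod_type]
  exact sum_comm

lemma hellingerSq_joint_markovRef {q : B → ℝ} (hq : q ∈ stdSimplex ℝ B) {p : B → A × C → ℝ}
    (hp : ∀ b, p b ∈ stdSimplex ℝ (A × C)) :
    hellingerSq (joint q p) (markovRef (joint q p)) =
      (1 / 2) * ∑ b, q b * ∑ z, cellHellinger (p b) z := by
  rw [hellingerSq, markovRef_joint q hp, sum_triple_eq_sum_bin]
  simp only [mul_sum]
  refine sum_congr rfl fun b _ => sum_congr rfl fun z _ => ?_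
  rw [joint, joint, Real.sqrt_mul (hq.1 b), Real.sqrt_mul (hq.1 b), ← mul_sub, mul_pow,
    Real.sq_sqrt (hq.1 b)]
  rfl

lemma depend_eq_zero_of_hellingerSq_eq_zero {q : B → ℝ} (hq : q ∈ stdSimplex ℝ B)
    {p : B → A × C → ℝ} (hp : ∀ b, p b ∈ stdSimplex ℝ (A × C))
    (h : hellingerSq (joint q p) (markovRef (joint q p)) = 0) {b : B} (hb : q b ≠ 0)
    (z : A × C) : depend (p b) z = 0 := by
  have hs : ∀ b, 0 ≤ ∑ z, cellHellinger (p b) z := fun b =>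
    sum_nonneg fun z _ => cellHellinger_nonneg _ _
  rw [hellingerSq_joint_markovRef hq hp, mul_eq_zero_iff_left (by norm_num),
    sum_eq_zero_iff_of_nonneg fun b _ => mul_nonneg (hq.1 b) (hs b)] at h
  have hbin := (mul_eq_zero.1 (h b (mem_univ b))).resolve_left hb
  rw [sum_eq_zero_iff_of_nonneg fun z _ => cellHellinger_nonneg _ _] at hbin
  exact depend_eq_zero_of_cellHellinger_eq_zero (hp b) (hbin z (mem_univ z))

lemma depend_prodWeight {μ : A → ℝ} {ν : C → ℝ} (hμ : ∑ a, μ a = 1) (hν : ∑ c, ν c = 1)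
    (z : A × C) : depend (prodWeight μ ν) z = 0 := by
  simp only [depend, margFst, margSnd, prodWeight, ← mul_sum, ← sum_mul, hμ, hν]
  ring

lemma margB_mem_stdSimplex {P : A × B × C → ℝ} (hP : P ∈ stdSimplex ℝ (A × B × C)) :
    margB P ∈ stdSimplex ℝ B := by
  refine ⟨fun b => sum_nonneg fun a _ => sum_nonneg fun c _ => hP.1 _, ?_⟩
  simp only [margB_eq_sum, ← sum_triple_eq_sum_bin, hP.2]

lemma eq_zero_of_margB_eq_zero {P : A × B × C → ℝ} (hP : P ∈ stdSimplex ℝ (A × B × C)) {b : B}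
    (hb : margB P b = 0) (z : A × C) : P (z.1, b, z.2) = 0 := by
  rw [margB_eq_sum, sum_eq_zero_iff_of_nonneg fun z _ => hP.1 _] at hb
  exact hb z (mem_univ z)

/-- The conditional distributions on bins of weight `0` can be chosen to be independent, so that
conditional independence means independence in every bin. -/
lemma exists_eq_joint [Nonempty A] [Nonempty C] {P : A × B × C → ℝ}
    (hP : P ∈ stdSimplex ℝ (A × B × C)) :
    ∃ q ∈ stdSimplex ℝ B, ∃ p : B → A × C → ℝ, (∀ b, p b ∈ stdSimplex ℝ (A × C)) ∧
      P = joint q p ∧ ∀ b, q b = 0 → ∀ z, depend (p b) z = 0 := by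
  classical
  obtain ⟨a₀⟩ := ‹Nonempty A›
  obtain ⟨c₀⟩ := ‹Nonempty C›
  have ha := single_mem_stdSimplex ℝ a₀
  have hc := single_mem_stdSimplex ℝ c₀
  refine ⟨margB P, margB_mem_stdSimplex hP, fun b z => if margB P b = 0 then
    prodWeight (Pi.single a₀ 1) (Pi.single c₀ 1) z else P (z.1, b, z.2) / margB P b,
    fun b => ?_, funext fun ⟨a, b, c⟩ => ?_, fun b hb z => ?_⟩
  · by_cases hb : margB P b = 0
    · simpa only [hb, if_true] using prodWeight_mem_stdSimplex ha hc
    · simp only [hb, if_false]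
      refine ⟨fun z => div_nonneg (hP.1 _) ((margB_mem_stdSimplex hP).1 b), ?_⟩
      rw [← sum_div, ← margB_eq_sum, div_self hb]
  · by_cases hb : margB P b = 0
    · simpa only [joint, hb, zero_mul] using eq_zero_of_margB_eq_zero hP hb (a, c)
    · simp only [joint, hb, if_false]
      rw [mul_div_cancel₀ _ hb]
  · simpa only [hb, if_true] using depend_prodWeight ha.2 hc.2 z

end Mixture

section Union

variable {A B C κ : Type} [Fintype A] [Fintype B] [Fintype C] [Fintype κ]

lemma yesProb_ite {N : ℕ} {X : Type} [Fintype X] {P : X → ℝ} (hP : P ∈ stdSimplex ℝ X)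
    (S : (Fin N → X) → Prop) [DecidablePred S] :
    yesProb P (fun s => if S s then (0 : unitInterval) else 1) =
      1 - prob (piWeight fun _ : Fin N => P) S := by
  rw [← prob_not (piWeight_mem_stdSimplex fun _ => hP)]
  refine sum_congr rfl fun s _ => congrArg _ ?_
  by_cases hs : S s <;> simp [hs]

lemma scCIndep_le_of_rejections [Nonempty κ] {Δ : (A × B × C → ℝ) → (A × B × C → ℝ) → ℝ} {ε : ℝ}
    {N : ℕ} (S : κ → (Fin N → A × B × C) → Prop)
    (hnull : ∀ P ∈ stdSimplex ℝ (A × B × C), Δ P (markovRef P) = 0 → ∀ t,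
      prob (piWeight fun _ : Fin N => P) (S t) ≤ 1 / (3 * Fintype.card κ))
    (halt : ∀ P ∈ stdSimplex ℝ (A × B × C), ε ≤ Δ P (markovRef P) → ∃ t,
      2 / 3 ≤ prob (piWeight fun _ : Fin N => P) (S t)) :
    scCIndep Δ ε ≤ N := by
  classical
  refine sInf_le ⟨N, rfl, fun s => if ∃ t ∈ univ, S t s then 0 else 1, fun P hP => ?_⟩
  have hw := piWeight_mem_stdSimplex (ι := Fin N) fun _ => hP
  rw [yesProb_ite hP fun s => ∃ t ∈ univ, S t s]
  refine ⟨fun hP0 => ?_, fun hfar => ?_⟩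
  · have hunion : prob (piWeight fun _ : Fin N => P) (fun s => ∃ t ∈ univ, S t s) ≤ 1 / 3 :=
      calc _ ≤ ∑ t, prob (piWeight fun _ : Fin N => P) (S t) := prob_exists_le hw univ S
        _ ≤ ∑ _t : κ, 1 / (3 * (Fintype.card κ : ℝ)) := sum_le_sum fun t _ => hnull P hP hP0 t
        _ = 1 / 3 := by simp
    linarith
  · obtain ⟨t, ht⟩ := halt P hP hfar
    have hsub := prob_mono hw (S := S t) (S' := fun s => ∃ t ∈ univ, S t s)
      fun s hs => ⟨t, mem_univ _, hs⟩
    linarith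

end Union

/-! ### Dyadic scales and levels -/

/-- The dyadic scale of a bin with an expected number of `x` samples. -/
def binLevel (x : ℝ) : ℕ := Nat.log 2 ⌊x⌋₊

lemma two_pow_binLevel_le {x : ℝ} (hx : 1 ≤ x) : (2 : ℝ) ^ binLevel x ≤ x := by
  have hfloor := Nat.pow_log_le_self 2 (Nat.floor_pos.2 hx).ne'
  exact (mod_cast hfloor : (2 : ℝ) ^ binLevel x ≤ ⌊x⌋₊).trans (Nat.floor_le (by linarith))

lemma lt_two_pow_binLevel_add_one {x : ℝ} (hx : 0 ≤ x) : x < 2 ^ (binLevel x + 1) :=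
  mod_cast (Nat.floor_lt hx).1 (Nat.lt_pow_succ_log_self one_lt_two ⌊x⌋₊)

lemma binLevel_le_log {x : ℝ} {m : ℕ} (hx : x ≤ m) : binLevel x ≤ Nat.log 2 m :=
  Nat.log_mono_right (Nat.floor_le_of_le hx)

/-- The dyadic level of a marginal probability `x`, cut off at `j`: the rows or columns of level `i`
survive the deletion by `2 ^ i - 1` samples, and unless `i = j` there are few of them. -/
def marginalLevel (j : ℕ) (x : ℝ) : ℕ :=
  Nat.findGreatest (fun i => ((2 : ℝ) ^ i - 1) * x ≤ 1 / 80) j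

lemma marginalLevel_le (j : ℕ) (x : ℝ) : marginalLevel j x ≤ j := Nat.findGreatest_le j

lemma two_pow_marginalLevel_sub_one_mul_le (j : ℕ) (x : ℝ) :
    ((2 : ℝ) ^ marginalLevel j x - 1) * x ≤ 1 / 80 :=
  Nat.findGreatest_spec (P := fun i => ((2 : ℝ) ^ i - 1) * x ≤ 1 / 80) (Nat.zero_le j) (by norm_num)

lemma le_two_pow_marginalLevel_add_one_mul {j : ℕ} {x : ℝ} (hx : 0 ≤ x)
    (hj : marginalLevel j x ≠ j) : 1 / 80 ≤ (2 : ℝ) ^ (marginalLevel j x + 1) * x := by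
  have hgreatest := Nat.findGreatest_is_greatest (Nat.lt_succ_self (marginalLevel j x))
    ((marginalLevel_le j x).lt_of_ne hj)
  rw [not_le, sub_mul, Nat.succ_eq_add_one] at hgreatest
  linarith

/-- The number of triples of a scale and two levels up to `Nat.log 2 m`, a bound for the number of
tests. -/
def numScales (m : ℕ) : ℕ := (Nat.log 2 m + 1) ^ 3

/-- The scales `j` and the levels `i`, `i'` of rows and columns that occur for `m` expected
samples. -/
def scales (m : ℕ) : Finset (ℕ × ℕ × ℕ) :=
  {t ∈ range (Nat.log 2 m + 1) ×ˢ range (Nat.log 2 m + 1) ×ˢ range (Nat.log 2 m + 1) |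
    t.2.1 ≤ t.1 ∧ t.2.2 ≤ t.1}

lemma mem_scales {m j i i' : ℕ} :
    (j, i, i') ∈ scales m ↔ j ≤ Nat.log 2 m ∧ i ≤ j ∧ i' ≤ j := by
  simp only [scales, mem_filter, mem_product, mem_range]
  omega

lemma card_scales_le (m : ℕ) : #(scales m) ≤ numScales m := by
  refine (card_filter_le _ _).trans_eq ?_
  rw [card_product, card_product, card_range, numScales]
  ring

lemma scales_nonempty (m : ℕ) : (scales m).Nonempty := ⟨(0, 0, 0), mem_scales.2 (by simp)⟩

section ScaleCells

variable {A B C : Type*} [Fintype A] [Fintype C]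

/-- The scale of a bin with an expected number of `x` samples, with the levels of the row and the
column of the cell `z`. -/
def cellScale (x : ℝ) (p : A × C → ℝ) (z : A × C) : ℕ × ℕ × ℕ :=
  (binLevel x, marginalLevel (binLevel x) (margFst p z.1),
    marginalLevel (binLevel x) (margSnd p z.2))

lemma cellScale_mem_scales {x : ℝ} {m : ℕ} (hx : x ≤ m) (p : A × C → ℝ) (z : A × C) :
    cellScale x p z ∈ scales m :=
  mem_scales.2 ⟨binLevel_le_log hx, marginalLevel_le _ _, marginalLevel_le _ _⟩

/-- The cells of scale `t` in the bin `b`, if this bin contains one of `m` samples on average. -/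
def scaleCells (m : ℕ) (q : B → ℝ) (p : B → A × C → ℝ) (t : ℕ × ℕ × ℕ) (b : B) : Finset (A × C) :=
  {z | 1 ≤ m * q b ∧ cellScale (m * q b) (p b) z = t}

variable {m j i i' : ℕ} {q : B → ℝ} {p : B → A × C → ℝ} {b : B} {z : A × C}

lemma mem_scaleCells : z ∈ scaleCells m q p (j, i, i') b ↔ 1 ≤ m * q b ∧ binLevel (m * q b) = j ∧
    marginalLevel j (margFst (p b) z.1) = i ∧ marginalLevel j (margSnd (p b) z.2) = i' := by
  simp only [scaleCells, cellScale, mem_filter, mem_univ, true_and, Prod.mk.injEq]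
  refine and_congr_right fun _ => and_congr_right fun hj => ?_
  rw [hj]

lemma two_pow_le_of_mem_scaleCells (hz : z ∈ scaleCells m q p (j, i, i') b) :
    (2 : ℝ) ^ j ≤ m * q b := by
  obtain ⟨hb, rfl, -⟩ := mem_scaleCells.1 hz
  exact two_pow_binLevel_le hb

lemma margFst_mul_le_of_mem_scaleCells (hz : z ∈ scaleCells m q p (j, i, i') b) :
    ((2 : ℝ) ^ i - 1) * margFst (p b) z.1 ≤ 1 / 80 := by
  obtain ⟨-, -, rfl, -⟩ := mem_scaleCells.1 hz
  exact two_pow_marginalLevel_sub_one_mul_le _ _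

lemma margSnd_mul_le_of_mem_scaleCells (hz : z ∈ scaleCells m q p (j, i, i') b) :
    ((2 : ℝ) ^ i' - 1) * margSnd (p b) z.2 ≤ 1 / 80 := by
  obtain ⟨-, -, -, rfl⟩ := mem_scaleCells.1 hz
  exact two_pow_marginalLevel_sub_one_mul_le _ _

lemma le_mul_margFst_of_mem_scaleCells (hp : p b ∈ stdSimplex ℝ (A × C))
    (hz : z ∈ scaleCells m q p (j, i, i') b) (hij : i ≠ j) :
    1 / 80 ≤ (2 : ℝ) ^ (i + 1) * margFst (p b) z.1 := by
  obtain ⟨-, -, rfl, -⟩ := mem_scaleCells.1 hz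
  exact le_two_pow_marginalLevel_add_one_mul ((margFst_mem_stdSimplex hp).1 _) hij

lemma le_mul_margSnd_of_mem_scaleCells (hp : p b ∈ stdSimplex ℝ (A × C))
    (hz : z ∈ scaleCells m q p (j, i, i') b) (hij : i' ≠ j) :
    1 / 80 ≤ (2 : ℝ) ^ (i' + 1) * margSnd (p b) z.2 := by
  obtain ⟨-, -, -, rfl⟩ := mem_scaleCells.1 hz
  exact le_two_pow_marginalLevel_add_one_mul ((margSnd_mem_stdSimplex hp).1 _) hij

lemma card_filter_mul_le {X : Type*} [Fintype X] {μ : X → ℝ} (hμ : μ ∈ stdSimplex ℝ X) {s : ℝ}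
    (hs : 0 ≤ s) (t : ℝ) : #{x | t ≤ s * μ x} * t ≤ s :=
  calc #{x | t ≤ s * μ x} * t = ∑ x with t ≤ s * μ x, t := by rw [sum_const, nsmul_eq_mul]
    _ ≤ ∑ x with t ≤ s * μ x, s * μ x := sum_le_sum fun x hx => (mem_filter.1 hx).2
    _ ≤ ∑ x, s * μ x := sum_le_sum_of_subset_of_nonneg (subset_univ _)
      fun x _ _ => mul_nonneg hs (hμ.1 x)
    _ = s := by rw [← mul_sum, hμ.2, mul_one]

/-- The bound for the number of rows or columns of level `i` at the scale `j`, among `d` of them. -/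
def levelCard (d j i : ℕ) : ℝ := if i = j then d else min d (160 * 2 ^ i)

lemma levelCard_nonneg (d j i : ℕ) : 0 ≤ levelCard d j i := by
  unfold levelCard
  split_ifs <;> positivity

lemma levelCard_le (d j i : ℕ) : levelCard d j i ≤ d := by
  unfold levelCard
  split_ifs
  exacts [le_rfl, min_le_left _ _]

lemma levelCard_le_of_ne {j i : ℕ} (h : i ≠ j) (d : ℕ) : levelCard d j i ≤ 160 * 2 ^ i := by
  rw [levelCard, if_neg h]
  exact min_le_right _ _

lemma card_image_le_levelCard {X Y : Type*} [Fintype X] [DecidableEq X] {μ : X → ℝ}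
    (hμ : μ ∈ stdSimplex ℝ X) {j i : ℕ} (s : Finset Y) (f : Y → X)
    (hlevel : ∀ y ∈ s, i ≠ j → 1 / 80 ≤ (2 : ℝ) ^ (i + 1) * μ (f y)) :
    #(s.image f) ≤ levelCard (Fintype.card X) j i := by
  have hcard : (#(s.image f) : ℝ) ≤ Fintype.card X := mod_cast card_le_univ _
  unfold levelCard
  split_ifs with hij
  · exact hcard
  · have hsub : s.image f ⊆ ({x | 1 / 80 ≤ (2 : ℝ) ^ (i + 1) * μ x} : Finset X) :=
      image_subset_iff.2 fun y hy => mem_filter.2 ⟨mem_univ _, hlevel y hy hij⟩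
    have hsub' : (#(s.image f) : ℝ) ≤ _ := Nat.cast_le.2 (card_le_card hsub)
    have hfew := card_filter_mul_le hμ (s := 2 ^ (i + 1)) (by positivity) (1 / 80)
    rw [pow_succ] at hfew hsub'
    exact le_min hcard (by linarith)

lemma card_scaleCells_le (hp : p b ∈ stdSimplex ℝ (A × C)) (m : ℕ) (q : B → ℝ) (j i i' : ℕ) :
    (#(scaleCells m q p (j, i, i') b) : ℝ) ≤
      levelCard (Fintype.card A) j i * levelCard (Fintype.card C) j i' := by
  classical
  set cells := scaleCells m q p (j, i, i') b
  have hrows := card_image_le_levelCard (margFst_mem_stdSimplex hp) cells Prod.fst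
    fun z hz hij => le_mul_margFst_of_mem_scaleCells hp hz hij
  have hcols := card_image_le_levelCard (margSnd_mem_stdSimplex hp) cells Prod.snd
    fun z hz hij => le_mul_margSnd_of_mem_scaleCells hp hz hij
  have hsub : cells ⊆ cells.image Prod.fst ×ˢ cells.image Prod.snd := fun z hz =>
    mem_product.2 ⟨mem_image_of_mem _ hz, mem_image_of_mem _ hz⟩
  calc (#cells : ℝ) ≤ #(cells.image Prod.fst ×ˢ cells.image Prod.snd) :=
        Nat.cast_le.2 (card_le_card hsub)
    _ = #(cells.image Prod.fst) * #(cells.image Prod.snd) := by rw [card_product, Nat.cast_mul]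
    _ ≤ _ := mul_le_mul hrows hcols (Nat.cast_nonneg _) (levelCard_nonneg _ _ _)

variable [Fintype B]

lemma sum_scaleCells (hq : q ∈ stdSimplex ℝ B) (m : ℕ) (p : B → A × C → ℝ) (f : B → A × C → ℝ) :
    ∑ t ∈ scales m, ∑ b, ∑ z ∈ scaleCells m q p t b, f b z =
      ∑ b with 1 ≤ m * q b, ∑ z, f b z := by
  rw [sum_comm, sum_filter]
  refine sum_congr rfl fun b _ => ?_
  split_ifs with hb
  · have hscale : ∀ z ∈ univ, cellScale (m * q b) (p b) z ∈ scales m := fun z _ =>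
      cellScale_mem_scales (mul_le_of_le_one_right (Nat.cast_nonneg m)
        (le_one_of_mem_stdSimplex hq b)) _ _
    simp only [← sum_fiberwise_of_maps_to hscale, scaleCells, hb, true_and]
  · simp only [scaleCells, hb, false_and, filter_false, sum_empty, sum_const_zero]

lemma exists_le_sum_scaleCells (hq : q ∈ stdSimplex ℝ B) {m : ℕ} (hm : 1 ≤ m) {ε : ℝ} (hε : 0 ≤ ε)
    (hheavy : ε ≤ ∑ b with 1 ≤ m * q b, q b * ∑ z, cellHellinger (p b) z) :
    ∃ t ∈ scales m, m * ε ≤ 2 * 2 ^ t.1 * numScales m *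
      ∑ b, ∑ z ∈ scaleCells m q p t b, cellHellinger (p b) z := by
  have hm' : (0 : ℝ) < m := mod_cast hm
  have hW : (0 : ℝ) < numScales m := mod_cast Nat.pos_of_ne_zero (by simp [numScales])
  simp only [mul_sum (s := univ), ← sum_scaleCells hq m p] at hheavy
  obtain ⟨⟨j, i, i'⟩, ht, hsignal⟩ := exists_le_of_sum_le (scales_nonempty m)
    (f := fun _ => ε / numScales m) (le_trans (by
      rw [sum_const, nsmul_eq_mul, mul_div_assoc', div_le_iff₀ hW, mul_comm]
      exact mul_le_mul_of_nonneg_left (mod_cast card_scales_le m) hε) hheavy)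
  refine ⟨(j, i, i'), ht, ?_⟩
  rw [div_le_iff₀ hW] at hsignal
  calc m * ε ≤ m * ((∑ b, ∑ z ∈ scaleCells m q p (j, i, i') b, q b * cellHellinger (p b) z) *
        numScales m) := mul_le_mul_of_nonneg_left hsignal hm'.le
    _ = numScales m *
        ∑ b, ∑ z ∈ scaleCells m q p (j, i, i') b, m * q b * cellHellinger (p b) z := by
      simp only [mul_assoc, ← mul_sum]
      ring
    _ ≤ numScales m *
        ∑ b, ∑ z ∈ scaleCells m q p (j, i, i') b, 2 * 2 ^ j * cellHellinger (p b) z := by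
      refine mul_le_mul_of_nonneg_left (sum_le_sum fun b _ => sum_le_sum fun z hz => ?_) hW.le
      refine mul_le_mul_of_nonneg_right ?_ (cellHellinger_nonneg _ _)
      obtain ⟨hb, rfl, -⟩ := mem_scaleCells.1 hz
      rw [← pow_succ']
      exact (lt_two_pow_binLevel_add_one (by linarith)).le
    _ = _ := by
      simp only [← mul_sum]
      ring

lemma sum_card_scaleCells_le (hq : q ∈ stdSimplex ℝ B) (hp : ∀ b, p b ∈ stdSimplex ℝ (A × C))
    {m M j : ℕ} (hM : min (Fintype.card B : ℝ) (m / 2 ^ j) ≤ M) (i i' : ℕ) :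
    ∑ b, (#(scaleCells m q p (j, i, i') b) : ℝ) ≤
      M * (levelCard (Fintype.card A) j i * levelCard (Fintype.card C) j i') := by
  have hbins : (#{b | (2 : ℝ) ^ j ≤ m * q b} : ℝ) ≤ M := by
    refine (le_min (mod_cast card_le_univ _) ?_).trans hM
    rw [le_div_iff₀ (by positivity)]
    exact card_filter_mul_le hq (Nat.cast_nonneg m) _
  have hempty : ∀ b ∈ univ, (#(scaleCells m q p (j, i, i') b) : ℝ) ≠ 0 →
      (2 : ℝ) ^ j ≤ m * q b := fun b _ hb => by
    obtain ⟨z, hz⟩ := card_ne_zero.1 (Nat.cast_ne_zero.1 hb)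
    exact two_pow_le_of_mem_scaleCells hz
  rw [← sum_filter_of_ne hempty]
  refine (sum_le_card_nsmul _ _ _ fun b _ => card_scaleCells_le (hp b) m q j i i').trans ?_
  rw [nsmul_eq_mul]
  exact mul_le_mul_of_nonneg_right hbins (mul_nonneg (levelCard_nonneg _ _ _)
    (levelCard_nonneg _ _ _))

lemma sum_cellHellinger_le_mul_sum_depend_sq (hp : ∀ b, p b ∈ stdSimplex ℝ (A × C)) (m : ℕ)
    (q : B → ℝ) {j i i' : ℕ} (hi : i ≠ j) (hi' : i' ≠ j) :
    ∑ b, ∑ z ∈ scaleCells m q p (j, i, i') b, cellHellinger (p b) z ≤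
      25600 * (2 ^ i * 2 ^ i') * ∑ b, ∑ z ∈ scaleCells m q p (j, i, i') b, depend (p b) z ^ 2 := by
  simp only [mul_sum]
  refine sum_le_sum fun b _ => sum_le_sum fun z hz => ?_
  have hrow := le_mul_margFst_of_mem_scaleCells (hp b) hz hi
  have hcol := le_mul_margSnd_of_mem_scaleCells (hp b) hz hi'
  have hprod : 1 ≤ 25600 * (2 ^ i * 2 ^ i') * (margFst (p b) z.1 * margSnd (p b) z.2) := by
    have := mul_le_mul hrow hcol (by norm_num) (by linarith)
    rw [pow_succ, pow_succ] at this
    linarith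
  calc cellHellinger (p b) z ≤ 25600 * (2 ^ i * 2 ^ i') *
        (margFst (p b) z.1 * margSnd (p b) z.2) * cellHellinger (p b) z :=
        le_mul_of_one_le_left (cellHellinger_nonneg _ _) hprod
    _ = 25600 * (2 ^ i * 2 ^ i') *
        (margFst (p b) z.1 * margSnd (p b) z.2 * cellHellinger (p b) z) := mul_assoc _ _ _
    _ ≤ _ := mul_le_mul_of_nonneg_left (mul_cellHellinger_le_depend_sq (hp b) z) (by positivity)

end ScaleCells

/-! ### Signal and noise -/

section SignalNoise

lemma mul_sqrt_flatNorm_le {K : ℕ} (hK : 1 ≤ K) (d : ℕ) :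
    K * √(flatNorm d K) ≤ √(min (K : ℝ) d) := by
  have : (0 : ℝ) < K := mod_cast hK
  refine Real.le_sqrt_of_sq_le (le_of_eq ?_)
  rw [mul_pow, Real.sq_sqrt (flatNorm_nonneg d K), flatNorm, mul_min_of_nonneg _ _ (sq_nonneg _)]
  congr 1 <;> field_simp

lemma mul_sqrt_flatNorm_le_sqrt {K : ℕ} (hK : 1 ≤ K) (d : ℕ) : K * √(flatNorm d K) ≤ √d :=
  (mul_sqrt_flatNorm_le hK d).trans (Real.sqrt_le_sqrt (min_le_right _ _))

/-- The order of the statistic on the null hypothesis. -/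
def noiseLevel (n dA dC k KA KC : ℕ) : ℝ := max 1 √(flatNoise n dA dC k KA KC)

lemma one_le_noiseLevel (n dA dC k KA KC : ℕ) : 1 ≤ noiseLevel n dA dC k KA KC := le_max_left _ _

lemma flatNoise_le_noiseLevel_sq (n dA dC k KA KC : ℕ) :
    flatNoise n dA dC k KA KC ≤ noiseLevel n dA dC k KA KC ^ 2 :=
  (Real.sqrt_le_left (zero_le_one.trans (one_le_noiseLevel _ _ _ _ _ _))).1 (le_max_right _ _)

lemma flatNoise_comm (n dA dC k KA KC : ℕ) :
    flatNoise n dA dC k KA KC = flatNoise n dC dA k KC KA := by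
  unfold flatNoise
  ring

lemma sqrt_flatNoise (n dA dC k KA KC : ℕ) :
    √(flatNoise n dA dC k KA KC) = k * (√n * (√(flatNorm dA KA) * √(flatNorm dC KC))) := by
  rw [flatNoise, Real.sqrt_mul (sq_nonneg _), Real.sqrt_sq (Nat.cast_nonneg _),
    Real.sqrt_mul (Nat.cast_nonneg _), Real.sqrt_mul (flatNorm_nonneg _ _)]

lemma sqrt_flatNoise_self_le {k : ℕ} (hk : 1 ≤ k) (n dA dC : ℕ) :
    √(flatNoise n dA dC k k k) ≤ √n := by
  have : (0 : ℝ) < k := mod_cast hk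
  have hnorm : flatNorm dA k * flatNorm dC k ≤ 1 / k * (1 / k) :=
    mul_le_mul (min_le_left _ _) (min_le_left _ _) (flatNorm_nonneg _ _) (by positivity)
  refine Real.sqrt_le_sqrt ?_
  calc flatNoise n dA dC k k k ≤ (k : ℝ) ^ 2 * (n * (1 / k * (1 / k))) := by
        unfold flatNoise
        gcongr
    _ = n := by field_simp

lemma sq_le_of_le_of_sq_le {k W X S₁ S₂ J : ℝ} (hX : 0 ≤ X) (hS : X ≤ 2 * k * W * S₁)
    (hJ : S₁ ^ 2 ≤ J * S₂) : X ^ 2 ≤ 4 * W ^ 2 * (J * (k ^ 2 * S₂)) :=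
  calc X ^ 2 ≤ (2 * k * W * S₁) ^ 2 := pow_le_pow_left₀ hX hS 2
    _ = 4 * W ^ 2 * k ^ 2 * S₁ ^ 2 := by ring
    _ ≤ 4 * W ^ 2 * k ^ 2 * (J * S₂) := mul_le_mul_of_nonneg_left hJ (by positivity)
    _ = _ := by ring

variable {n k KA KC dA dC : ℕ} {W X V : ℝ}

lemma mul_sqrt_le_of_sq_le (hn : 1 ≤ n) (hA : 1 ≤ dA) (hC : 1 ≤ dC) (hW : 1 ≤ W)
    (hsym : 10 ^ 23 * W ^ 4 * (n * √n) * (dA * dC) ≤ X ^ 2)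
    (hV : X ^ 2 ≤ 4 * W ^ 2 * (n * (dA * dC) * V)) : 2 * 10 ^ 6 * W * √n ≤ V := by
  have : (0 : ℝ) < n := mod_cast hn
  have : (0 : ℝ) < dA := mod_cast hA
  have : (0 : ℝ) < dC := mod_cast hC
  have hW3 : 8 * 10 ^ 6 * W ^ 3 ≤ 10 ^ 23 * W ^ 4 :=
    mul_le_mul (by norm_num) (pow_le_pow_right₀ hW (by norm_num)) (by positivity) (by positivity)
  refine le_of_mul_le_mul_left ?_ (by positivity : 0 < 4 * W ^ 2 * (n * (dA * dC) : ℝ))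
  calc 4 * W ^ 2 * (n * (dA * dC)) * (2 * 10 ^ 6 * W * √n)
      = 8 * 10 ^ 6 * W ^ 3 * (n * √n) * (dA * dC) := by ring
    _ ≤ 10 ^ 23 * W ^ 4 * (n * √n) * (dA * dC) := by gcongr
    _ ≤ X ^ 2 := hsym
    _ ≤ 4 * W ^ 2 * (n * (dA * dC) * V) := hV
    _ = _ := by ring

lemma mul_sqrt_flatNoise_le_of_mul_le (hn : 1 ≤ n) (hKA : 1 ≤ KA) (hKC : 1 ≤ KC) (hW : 1 ≤ W)
    (hX : 0 ≤ X) (hsym : 10 ^ 23 * W ^ 4 * (n * √n) * (dA * dC) ≤ X ^ 2)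
    (hV : k * X ≤ 51200 * W * (KA * KC * V)) :
    2 * 10 ^ 6 * W * √(flatNoise n dA dC k KA KC) ≤ V := by
  have hn' : (1 : ℝ) ≤ √n := Real.one_le_sqrt.2 (mod_cast hn)
  have : (0 : ℝ) < KA := mod_cast hKA
  have : (0 : ℝ) < KC := mod_cast hKC
  have hXle : 1024 * 10 ^ 8 * W ^ 2 * √n * (√dA * √dC) ≤ X := by
    refine abs_le_of_sq_le_sq' (le_trans ?_ hsym) hX |>.2
    calc (1024 * 10 ^ 8 * W ^ 2 * √n * (√dA * √dC)) ^ 2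
        = (1024 * 10 ^ 8) ^ 2 * W ^ 4 * (√n) ^ 2 * ((√dA) ^ 2 * (√dC) ^ 2) := by ring
      _ = (1024 * 10 ^ 8) ^ 2 * W ^ 4 * (n * 1) * (dA * dC) := by
        simp only [Real.sq_sqrt (Nat.cast_nonneg _), mul_one]
      _ ≤ 10 ^ 23 * W ^ 4 * (n * √n) * (dA * dC) := by
        gcongr
        norm_num
  rw [sqrt_flatNoise]
  refine le_of_mul_le_mul_left ?_ (by positivity : 0 < 51200 * W * (KA * KC : ℝ))
  calc 51200 * W * (KA * KC) *
        (2 * 10 ^ 6 * W * (k * (√n * (√(flatNorm dA KA) * √(flatNorm dC KC)))))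
      = k * (1024 * 10 ^ 8 * W ^ 2 * √n *
        ((KA * √(flatNorm dA KA)) * (KC * √(flatNorm dC KC)))) := by ring
    _ ≤ k * (1024 * 10 ^ 8 * W ^ 2 * √n * (√dA * √dC)) := by
      gcongr
      exacts [mul_sqrt_flatNorm_le_sqrt hKA dA, mul_sqrt_flatNorm_le_sqrt hKC dC]
    _ ≤ k * X := by gcongr
    _ ≤ 51200 * W * (KA * KC * V) := hV
    _ = _ := by ring

lemma mul_sqrt_flatNoise_le_of_sq_le (hn : 1 ≤ n) (hk : 1 ≤ k) (hKC : 1 ≤ KC) (hA : 1 ≤ dA)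
    (hW : 1 ≤ W)
    (hasym : 1280000000 * W ^ 3 * (n * √n) * (dA * √dC) * √(min (k : ℝ) dA) ≤ X ^ 2)
    (hV : X ^ 2 ≤ 4 * W ^ 2 * (n * (dA * (160 * KC)) * V)) :
    2 * 10 ^ 6 * W * √(flatNoise n dA dC k k KC) ≤ V := by
  have : (0 : ℝ) < n := mod_cast hn
  have : (0 : ℝ) < dA := mod_cast hA
  have : (0 : ℝ) < KC := mod_cast hKC
  rw [sqrt_flatNoise]
  refine le_of_mul_le_mul_left ?_ (by positivity : 0 < 4 * W ^ 2 * (n * (dA * (160 * KC)) : ℝ))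
  calc 4 * W ^ 2 * (n * (dA * (160 * KC))) *
        (2 * 10 ^ 6 * W * (k * (√n * (√(flatNorm dA k) * √(flatNorm dC KC)))))
      = 1280000000 * W ^ 3 * (n * √n) * (dA * (KC * √(flatNorm dC KC))) *
        (k * √(flatNorm dA k)) := by ring
    _ ≤ 1280000000 * W ^ 3 * (n * √n) * (dA * √dC) * √(min (k : ℝ) dA) := by
      gcongr
      exacts [mul_sqrt_flatNorm_le_sqrt hKC dC, mul_sqrt_flatNorm_le hk dA]
    _ ≤ X ^ 2 := hasym
    _ ≤ 4 * W ^ 2 * (n * (dA * (160 * KC)) * V) := hV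
    _ = _ := by ring

lemma mul_sqrt_le_mul_sqrt {x y : ℝ} (hx : 0 ≤ x) (hxy : x ≤ y) : x * √y ≤ y * √x :=
  calc x * √y = √x * (√x * √y) := by rw [← mul_assoc, Real.mul_self_sqrt hx]
    _ ≤ √x * (√y * √y) := by gcongr
    _ = y * √x := by rw [Real.mul_self_sqrt (hx.trans hxy), mul_comm]

lemma mul_noiseLevel_le {j i i' : ℕ} {S₁ S₂ : ℝ} (hn : 1 ≤ n) (hC : 1 ≤ dC) (hCA : dC ≤ dA)
    (hW : 1 ≤ W) (hX : 0 ≤ X) (hS₂ : 0 ≤ S₂) (hS : X ≤ 2 * 2 ^ j * W * S₁)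
    (hcells : S₁ ^ 2 ≤ n * (levelCard dA j i * levelCard dC j i') * S₂)
    (hlevels : i ≠ j → i' ≠ j → S₁ ≤ 25600 * (2 ^ i * 2 ^ i') * S₂)
    (hsym : 10 ^ 23 * W ^ 4 * (n * √n) * (dA * dC) ≤ X ^ 2)
    (hasym : 1280000000 * W ^ 3 * (n * √n) * (dA * √dC) * √(min (2 ^ j) dA) ≤ X ^ 2) :
    2 * 10 ^ 6 * W * noiseLevel n dA dC (2 ^ j) (2 ^ i) (2 ^ i') ≤ (2 ^ j) ^ 2 * S₂ := by
  have hpow : ∀ l : ℕ, 1 ≤ 2 ^ l := fun l => Nat.one_le_two_pow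
  have hA := hC.trans hCA
  have hn' : (1 : ℝ) ≤ √n := Real.one_le_sqrt.2 (mod_cast hn)
  have hsq : ∀ {JA JC : ℝ}, levelCard dA j i ≤ JA → levelCard dC j i' ≤ JC →
      X ^ 2 ≤ 4 * W ^ 2 * (n * (JA * JC) * ((2 ^ j) ^ 2 * S₂)) := fun hJA hJC => by
    have := levelCard_nonneg dA j i
    have := levelCard_nonneg dC j i'
    have := (levelCard_nonneg dA j i).trans hJA
    exact sq_le_of_le_of_sq_le hX hS (hcells.trans (by gcongr))
  have hsqrt := mul_sqrt_le_of_sq_le hn hA hC hW hsym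
    (hsq (levelCard_le dA j i) (levelCard_le dC j i'))
  rw [noiseLevel, mul_max_of_nonneg _ _ (by positivity)]
  refine max_le ((mul_le_mul_of_nonneg_left hn' (by positivity)).trans hsqrt) ?_
  by_cases hi : i = j <;> by_cases hi' : i' = j
  · subst hi hi'
    exact (mul_le_mul_of_nonneg_left (sqrt_flatNoise_self_le (hpow _) n dA dC)
      (by positivity)).trans hsqrt
  · subst hi
    exact mul_sqrt_flatNoise_le_of_sq_le hn (hpow _) (hpow _) hA hW (mod_cast hasym)
      (mod_cast hsq (levelCard_le dA i i) (levelCard_le_of_ne hi' dC))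
  · subst hi'
    have hCA' : (dC : ℝ) ≤ dA := mod_cast hCA
    rw [flatNoise_comm]
    refine mul_sqrt_flatNoise_le_of_sq_le hn (hpow _) (hpow _) hC hW (le_trans ?_ hasym) ?_
    · push_cast
      have := mul_sqrt_le_mul_sqrt (Nat.cast_nonneg _) hCA'
      have := Real.sqrt_le_sqrt (min_le_min_left (2 ^ i' : ℝ) hCA')
      exact mul_le_mul (by gcongr) this (Real.sqrt_nonneg _) (by positivity)
    · push_cast
      rw [mul_comm (dC : ℝ)]
      exact hsq (levelCard_le_of_ne hi dA) (levelCard_le dC i' i')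
  · refine mul_sqrt_flatNoise_le_of_mul_le hn (hpow _) (hpow _) hW hX hsym ?_
    push_cast
    calc 2 ^ j * X ≤ 2 ^ j * (2 * 2 ^ j * W * (25600 * (2 ^ i * 2 ^ i') * S₂)) :=
          mul_le_mul_of_nonneg_left
            (hS.trans (mul_le_mul_of_nonneg_left (hlevels hi hi') (by positivity))) (by positivity)
      _ = _ := by ring

end SignalNoise

/-! ### The signal at one scale -/

lemma le_hitProb {R n : ℕ} {x ℓ : ℝ} (hx0 : 0 ≤ x) (hx1 : x ≤ 1) (hn : ℓ ≤ n * x)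
    (hR : 20 * R ≤ Real.exp ℓ) : 19 / 20 ≤ hitProb R n x := by
  have hmiss : (1 - x) ^ n ≤ Real.exp (-ℓ) :=
    calc (1 - x) ^ n ≤ Real.exp (-x) ^ n :=
          pow_le_pow_left₀ (sub_nonneg.2 hx1) (Real.one_sub_le_exp_neg x) n
      _ = Real.exp (-(n * x)) := by rw [← Real.exp_nat_mul, mul_neg]
      _ ≤ Real.exp (-ℓ) := Real.exp_le_exp.2 (neg_le_neg hn)
  have hunion : (R : ℝ) * (1 - x) ^ n ≤ 1 / 20 :=
    calc (R : ℝ) * (1 - x) ^ n ≤ R * Real.exp (-ℓ) := by gcongr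
      _ = R / Real.exp ℓ := by rw [Real.exp_neg, div_eq_mul_inv]
      _ ≤ 1 / 20 := by
        rw [div_le_iff₀ (Real.exp_pos _)]
        linarith
  have hle := pow_le_one₀ (n := n) (sub_nonneg.2 hx1) (sub_le_self 1 hx0)
  have hbernoulli := one_add_mul_le_pow (a := -(1 - x) ^ n) (by linarith) R
  rw [hitProb, sub_eq_add_neg]
  linarith

lemma one_sub_pow_le_one_sub_half {m : ℕ} {x : ℝ} (hx0 : 0 ≤ x) (hx1 : x ≤ 1) (hmx : m * x ≤ 1) :
    (1 - x) ^ m ≤ 1 - m * x / 2 := by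
  have hprod : (1 + x) ^ m * (1 - x) ^ m ≤ 1 := by
    rw [← mul_pow]
    exact pow_le_one₀ (by nlinarith) (by nlinarith)
  have hbound : (1 + m * x) * (1 - x) ^ m ≤ 1 :=
    (mul_le_mul_of_nonneg_right (one_add_mul_le_pow (by linarith) m)
      (pow_nonneg (by linarith) m)).trans hprod
  have : 0 ≤ m * x := by positivity
  by_contra! hlt
  nlinarith

lemma pow_four_le_hitProb {n m : ℕ} {x : ℝ} (hx0 : 0 ≤ x) (hx1 : x ≤ 1) (hmn : m ≤ n)
    (hmx : m * x ≤ 1) : (m * x / 2) ^ 4 ≤ hitProb 4 n x := by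
  have hle : (1 - x) ^ n ≤ (1 - x) ^ m :=
    pow_le_pow_of_le_one (sub_nonneg.2 hx1) (sub_le_self 1 hx0) hmn
  have := one_sub_pow_le_one_sub_half hx0 hx1 hmx
  exact pow_le_pow_left₀ (by positivity) (by linarith) 4

lemma hitProb_nonneg {x : ℝ} (hx0 : 0 ≤ x) (hx1 : x ≤ 1) (r n : ℕ) : 0 ≤ hitProb r n x :=
  pow_nonneg (sub_nonneg.2 (pow_le_one₀ (sub_nonneg.2 hx1) (sub_le_self 1 hx0))) r

section LightBins

variable {A C : Type*} [Fintype A] [Fintype C]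

lemma sq_sum_cellHellinger_univ_le {p : A × C → ℝ} (hp : p ∈ stdSimplex ℝ (A × C)) :
    (∑ z, cellHellinger p z) ^ 2 ≤
      (Fintype.card A * Fintype.card C) * ∑ z, depend p z ^ 2 := by
  simpa using sq_sum_cellHellinger_le (B := Unit) (fun _ => hp) fun _ => univ

lemma pow_four_mul_sum_cellHellinger_le {p : A × C → ℝ} (hp : p ∈ stdSimplex ℝ (A × C)) {m n : ℕ}
    (hmn : m ≤ n) {x : ℝ} (hx0 : 0 ≤ x) (hx1 : x ≤ 1) (hmx : m * x ≤ 1) :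
    (m * (x * ∑ z, cellHellinger p z)) ^ 4 ≤
      64 * (Fintype.card A * Fintype.card C) * ((∑ z, depend p z ^ 2) * hitProb 4 n x) := by
  set h := ∑ z, cellHellinger p z
  have hh : h ^ 2 ≤ 2 ^ 2 :=
    pow_le_pow_left₀ (sum_nonneg fun z _ => cellHellinger_nonneg p z) (sum_cellHellinger_le hp) 2
  calc (m * (x * h)) ^ 4 = 16 * (m * x / 2) ^ 4 * (h ^ 2 * h ^ 2) := by ring
    _ ≤ 16 * hitProb 4 n x * (2 ^ 2 * (Fintype.card A * Fintype.card C * ∑ z, depend p z ^ 2)) := by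
      have := hitProb_nonneg hx0 hx1 4 n
      gcongr
      exacts [pow_four_le_hitProb hx0 hx1 hmn hmx, sq_sum_cellHellinger_univ_le hp]
    _ = _ := by ring

variable {B : Type*} [Fintype B]

lemma pow_four_le_mul_sum_depend_sq_mul_hitProb {q : B → ℝ} (hq : q ∈ stdSimplex ℝ B)
    {p : B → A × C → ℝ} (hp : ∀ b, p b ∈ stdSimplex ℝ (A × C)) {m n : ℕ} (hmn : m ≤ n) {ε : ℝ}
    (hε : 0 ≤ ε)
    (hlight : ε ≤ ∑ b with ¬ 1 ≤ m * q b, q b * ∑ z, cellHellinger (p b) z) :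
    (m * ε) ^ 4 ≤ 64 * ((Fintype.card B : ℝ) ^ 3 * (Fintype.card A * Fintype.card C)) *
      ∑ b, (∑ z, depend (p b) z ^ 2) * hitProb 4 n (q b) := by
  set s : Finset B := {b | ¬ 1 ≤ m * q b}
  set g : B → ℝ := fun b => (∑ z, depend (p b) z ^ 2) * hitProb 4 n (q b)
  have hg : ∀ b, 0 ≤ g b := fun b => mul_nonneg (sum_nonneg fun z _ => sq_nonneg _)
    (hitProb_nonneg (hq.1 b) (le_one_of_mem_stdSimplex hq b) 4 n)
  have hbin : ∀ b, 0 ≤ m * (q b * ∑ z, cellHellinger (p b) z) := fun b =>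
    mul_nonneg (Nat.cast_nonneg m)
      (mul_nonneg (hq.1 b) (sum_nonneg fun z _ => cellHellinger_nonneg _ z))
  calc (m * ε) ^ 4 ≤ (∑ b ∈ s, m * (q b * ∑ z, cellHellinger (p b) z)) ^ 4 := by
        rw [← mul_sum]
        gcongr
    _ ≤ (#s : ℝ) ^ 3 * ∑ b ∈ s, (m * (q b * ∑ z, cellHellinger (p b) z)) ^ 4 :=
      pow_sum_le_card_mul_sum_pow (fun b _ => hbin b) 3
    _ ≤ (Fintype.card B : ℝ) ^ 3 *
        ∑ b ∈ s, 64 * (Fintype.card A * Fintype.card C) * g b := by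
      gcongr with b hb
      · exact card_le_univ s
      · exact pow_four_mul_sum_cellHellinger_le (hp b) hmn (hq.1 b)
          (le_one_of_mem_stdSimplex hq b) (not_le.1 (mem_filter.1 hb).2).le
    _ ≤ (Fintype.card B : ℝ) ^ 3 * (64 * (Fintype.card A * Fintype.card C) * ∑ b, g b) := by
      rw [← mul_sum]
      gcongr
      exacts [fun b _ _ => hg b, subset_univ s]
    _ = _ := by ring

end LightBins

/-! ### The tests at all scales -/

/-- The length of the blocks at the scale `k`, for a base number `m` of samples: the factor `ℓ`
makes it likely that every block contains a sample in each bin of probability `k / m`. -/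
def blockLength (m ℓ k : ℕ) : ℕ := ℓ * m / k + 1

lemma mul_lt_mul_blockLength {k : ℕ} (hk : 0 < k) (m ℓ : ℕ) : ℓ * m < k * blockLength m ℓ k :=
  Nat.lt_mul_div_succ _ hk

lemma mul_blockLength_le {m ℓ k : ℕ} (hkm : k ≤ m) (hℓ : 1 ≤ ℓ) :
    k * blockLength m ℓ k ≤ 2 * (ℓ * m) := by
  have hdiv := Nat.mul_div_le (ℓ * m) k
  have hm := Nat.le_mul_of_pos_left m hℓ
  rw [blockLength, mul_add]
  omega

lemma two_pow_le_of_mem_scales {m : ℕ} (hm : 1 ≤ m) {j i i' : ℕ} (ht : (j, i, i') ∈ scales m) :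
    2 ^ j ≤ m :=
  Nat.pow_le_of_le_log (by omega) (mem_scales.1 ht).1

lemma card_role_le_of_mem_scales {m j i i' : ℕ} (ht : (j, i, i') ∈ scales m) :
    2 * (2 ^ i - 1) + 2 * (2 ^ i' - 1) + 4 * 2 ^ j ≤ 8 * 2 ^ j := by
  obtain ⟨-, hi, hi'⟩ := mem_scales.1 ht
  have := Nat.pow_le_pow_right two_pos hi
  have := Nat.pow_le_pow_right two_pos hi'
  omega

lemma le_prob_mem_usedBins_of_mem_scales {B : Type*} [Fintype B] {q : B → ℝ}
    (hq : q ∈ stdSimplex ℝ B) {m ℓ j i i' : ℕ} (hm : 1 ≤ m) (hexp : 160 * m ≤ Real.exp ℓ)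
    (ht : (j, i, i') ∈ scales m) {b : B} (hb : (2 : ℝ) ^ j ≤ m * q b) :
    19 / 20 ≤ prob (blockWeight (Role (2 * (2 ^ i - 1)) (2 * (2 ^ i' - 1)) (2 ^ j))
      (blockLength m ℓ (2 ^ j)) q) fun β => b ∈ usedBins β := by
  rw [prob_mem_usedBins _ hq, card_role]
  refine le_hitProb (ℓ := ℓ) (hq.1 b) (le_one_of_mem_stdSimplex hq b) ?_ (le_trans ?_ hexp)
  · have hlength : (ℓ * m : ℝ) ≤ 2 ^ j * blockLength m ℓ (2 ^ j) :=
      mod_cast (mul_lt_mul_blockLength (Nat.two_pow_pos j) m ℓ).le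
    refine le_of_mul_le_mul_left ?_ (by positivity : (0 : ℝ) < 2 ^ j)
    calc (2 : ℝ) ^ j * ℓ ≤ m * q b * ℓ := by gcongr
      _ = ℓ * m * q b := by ring
      _ ≤ 2 ^ j * blockLength m ℓ (2 ^ j) * q b := mul_le_mul_of_nonneg_right hlength (hq.1 b)
      _ = _ := by ring
  · have hrole := (card_role_le_of_mem_scales ht).trans
      (Nat.mul_le_mul_left 8 (two_pow_le_of_mem_scales hm ht))
    exact_mod_cast (by omega : 20 * (2 * (2 ^ i - 1) + 2 * (2 ^ i' - 1) + 4 * 2 ^ j) ≤ 160 * m)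

lemma one_le_numScales (m : ℕ) : 1 ≤ numScales m := Nat.one_le_pow _ _ (Nat.succ_pos _)

/-- The noise level of the test at the scale `t`. -/
def scaleNoise (m ℓ dA dB dC : ℕ) (t : ℕ × ℕ × ℕ) : ℝ :=
  noiseLevel (min dB (blockLength m ℓ (2 ^ t.1))) dA dC (2 ^ t.1) (2 ^ t.2.1) (2 ^ t.2.2)

lemma one_le_scaleNoise (m ℓ dA dB dC : ℕ) (t : ℕ × ℕ × ℕ) : 1 ≤ scaleNoise m ℓ dA dB dC t :=
  one_le_noiseLevel _ _ _ _ _ _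

section ScaleTests

variable {A B C : Type*} [Fintype A] [Fintype B] [Fintype C] [DecidableEq A] [DecidableEq B]
  [DecidableEq C]

/-- The probability of rejection of the test at the scale `t`, whose threshold exceeds the noise
level by a multiple of the number of tests. -/
def scaleRejectProb (m ℓ : ℕ) (q : B → ℝ) (p : B → A × C → ℝ) (t : ℕ × ℕ × ℕ) : ℝ :=
  rejectProb (2 ^ t.1) (2 ^ t.2.1) (2 ^ t.2.2) (blockLength m ℓ (2 ^ t.1)) q p
    (20 * numScales m *
      scaleNoise m ℓ (Fintype.card A) (Fintype.card B) (Fintype.card C) t)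

lemma exists_prob_eq_scaleRejectProb {m ℓ : ℕ} (hm : 1 ≤ m) (hℓ : 1 ≤ ℓ) {t : ℕ × ℕ × ℕ}
    (ht : t ∈ scales m) :
    ∃ S : (Fin (16 * (ℓ * m)) → A × B × C) → Prop, ∀ q ∈ stdSimplex ℝ B, ∀ p : B → A × C → ℝ,
      (∀ b, p b ∈ stdSimplex ℝ (A × C)) →
      prob (piWeight fun _ => joint q p) S = scaleRejectProb m ℓ q p t := by
  refine exists_prob_eq_rejectProb ?_ _
  have hlength := mul_blockLength_le (two_pow_le_of_mem_scales hm ht) hℓ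
  calc (2 * (2 ^ t.2.1 - 1) + 2 * (2 ^ t.2.2 - 1) + 4 * 2 ^ t.1) * blockLength m ℓ (2 ^ t.1)
      ≤ 8 * 2 ^ t.1 * blockLength m ℓ (2 ^ t.1) :=
        Nat.mul_le_mul_right _ (card_role_le_of_mem_scales ht)
    _ = 8 * (2 ^ t.1 * blockLength m ℓ (2 ^ t.1)) := by ring
    _ ≤ 8 * (2 * (ℓ * m)) := Nat.mul_le_mul_left _ hlength
    _ = 16 * (ℓ * m) := by ring

variable {q : B → ℝ} {p : B → A × C → ℝ}

lemma scaleRejectProb_le (hq : q ∈ stdSimplex ℝ B) (hp : ∀ b, p b ∈ stdSimplex ℝ (A × C))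
    (hind : ∀ b z, depend (p b) z = 0) (m ℓ : ℕ) (t : ℕ × ℕ × ℕ) :
    scaleRejectProb m ℓ q p t ≤ 1 / (3 * numScales m) := by
  have hρ := one_le_scaleNoise m ℓ (Fintype.card A) (Fintype.card B) (Fintype.card C) t
  set ρ := scaleNoise m ℓ (Fintype.card A) (Fintype.card B) (Fintype.card C) t
  have hW : (1 : ℝ) ≤ numScales m := mod_cast one_le_numScales m
  refine (rejectProb_le_of_depend_eq_zero Nat.one_le_two_pow Nat.one_le_two_pow
    Nat.one_le_two_pow hq hp hind (by positivity)).trans ?_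
  calc _ ≤ 128 * ρ ^ 2 / (20 * numScales m * ρ) ^ 2 := by
        gcongr
        exact flatNoise_le_noiseLevel_sq _ _ _ _ _ _
    _ = 8 / 25 / (numScales m * numScales m) := by
        field_simp
        norm_num
    _ ≤ 1 / 3 / numScales m := div_le_div₀ (by norm_num) (by norm_num) (by positivity)
        (le_mul_of_one_le_left (by positivity) hW)
    _ = 1 / (3 * numScales m) := div_div _ _ _

lemma le_scaleRejectProb (hq : q ∈ stdSimplex ℝ B) (hp : ∀ b, p b ∈ stdSimplex ℝ (A × C))
    {m ℓ j i i' : ℕ} {cells : B → Finset (A × C)}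
    (hA : ∀ b, ∀ z ∈ cells b, ((2 : ℝ) ^ i - 1) * margFst (p b) z.1 ≤ 1 / 80)
    (hC : ∀ b, ∀ z ∈ cells b, ((2 : ℝ) ^ i' - 1) * margSnd (p b) z.2 ≤ 1 / 80) {E : ℝ}
    (hE : 2 * 10 ^ 6 * numScales m *
      scaleNoise m ℓ (Fintype.card A) (Fintype.card B) (Fintype.card C) (j, i, i') ≤ E)
    (hlow : prob (blockWeight (Role (2 * (2 ^ i - 1)) (2 * (2 ^ i' - 1)) (2 ^ j))
      (blockLength m ℓ (2 ^ j)) q)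
      (fun β => ∑ b ∈ usedBins β, (2 ^ j) ^ 2 * ∑ z ∈ cells b, depend (p b) z ^ 2 < E / 2) ≤
        1 / 10) :
    2 / 3 ≤ scaleRejectProb m ℓ q p (j, i, i') := by
  have hρ := one_le_scaleNoise m ℓ (Fintype.card A) (Fintype.card B) (Fintype.card C) (j, i, i')
  set ρ := scaleNoise m ℓ (Fintype.card A) (Fintype.card B) (Fintype.card C) (j, i, i')
  have hW : (1 : ℝ) ≤ numScales m := mod_cast one_le_numScales m
  have hWρ : ρ ≤ numScales m * ρ := le_mul_of_one_le_left (by linarith) hW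
  exact le_rejectProb Nat.one_le_two_pow Nat.one_le_two_pow Nat.one_le_two_pow hq hp
    (mod_cast hA) (mod_cast hC) hρ (flatNoise_le_noiseLevel_sq _ _ _ _ _ _)
    (by linarith : 10 ^ 6 * ρ ≤ E / 2) (by linarith) (mod_cast hlow)

end ScaleTests

/-- Conditions on the base number `m` of samples, and the factor `ℓ` in the lengths of the blocks,
under which the tests detect a squared Hellinger distance `ε`. In the bins that contain one of the
`m` samples on average, `sym` and `asym` make the signal exceed the noise at one of the scales; for
the other bins, `light` does so at the scale `1`. -/
structure IsSufficient (ε : ℝ) (dA dB dC m ℓ : ℕ) : Prop where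
  one_le : 1 ≤ m
  le_exp : 160 * m ≤ Real.exp ℓ
  sym : 10 ^ 23 * numScales m ^ 4 * (dB * √dB) * (dA * dC) ≤ (m * ε) ^ 2
  asym :
    1280000000 * numScales m ^ 3 * (dB * √dB) * (dA * √dC) * √dA ≤ (m * ε) ^ 2 ∨
      1280000000 * numScales m ^ 3 * (dB * √(2 * (ℓ * m))) * (dA * √dC) ≤ (m * ε) ^ 2
  light :
    128000000 * numScales m * ((dB : ℝ) ^ 3 * (dA * dC)) * √(min dB (2 * (ℓ * m))) ≤ (m * ε) ^ 4

namespace IsSufficient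

variable {ε : ℝ} {dA dB dC m ℓ : ℕ}

lemma one_le_factor (h : IsSufficient ε dA dB dC m ℓ) : 1 ≤ ℓ := by
  have hm : (1 : ℝ) ≤ m := mod_cast h.one_le
  refine Nat.one_le_iff_ne_zero.2 fun h0 => ?_
  have := h.le_exp
  rw [h0, Nat.cast_zero, Real.exp_zero] at this
  linarith

lemma asym_scale (h : IsSufficient ε dA dB dC m ℓ) {j n : ℕ} (hj : 2 ^ j ≤ m) (hn : n ≤ dB)
    (hlength : n ≤ blockLength m ℓ (2 ^ j)) :
    1280000000 * numScales m ^ 3 * (n * √n) * (dA * √dC) * √(min (2 ^ j) dA) ≤ (m * ε) ^ 2 := by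
  have hn' : (n : ℝ) ≤ dB := mod_cast hn
  rcases h.asym with hasym | hasym
  · refine le_trans ?_ hasym
    gcongr
    exact min_le_right _ _
  · refine le_trans ?_ hasym
    have hsamples : √n * √(min (2 ^ j) dA) ≤ √(2 * (ℓ * m)) := by
      rw [← Real.sqrt_mul (Nat.cast_nonneg n)]
      refine Real.sqrt_le_sqrt ?_
      calc n * min (2 ^ j : ℝ) dA ≤ n * 2 ^ j := by
            gcongr
            exact min_le_left _ _
        _ = (2 ^ j * n : ℕ) := by
          push_cast
          ring
        _ ≤ (2 * (ℓ * m) : ℕ) := Nat.cast_le.2 ((Nat.mul_le_mul_left _ hlength).trans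
          (mul_blockLength_le hj h.one_le_factor))
        _ = 2 * (ℓ * m) := by push_cast; rfl
    calc 1280000000 * numScales m ^ 3 * (n * √n) * (dA * √dC) * √(min (2 ^ j) dA)
        = 1280000000 * numScales m ^ 3 * (n * (√n * √(min (2 ^ j) dA))) * (dA * √dC) := by ring
      _ ≤ 1280000000 * numScales m ^ 3 * (dB * √(2 * (ℓ * m))) * (dA * √dC) := by gcongr

end IsSufficient

section Detection

variable {A B C : Type*} [Fintype A] [Fintype B] [Fintype C]

lemma exists_mul_scaleNoise_le [Nonempty B] [Nonempty C]
    (hCA : Fintype.card C ≤ Fintype.card A) {q : B → ℝ} (hq : q ∈ stdSimplex ℝ B)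
    {p : B → A × C → ℝ} (hp : ∀ b, p b ∈ stdSimplex ℝ (A × C)) {ε : ℝ} (hε : 0 ≤ ε) {m ℓ : ℕ}
    (h : IsSufficient ε (Fintype.card A) (Fintype.card B) (Fintype.card C) m ℓ)
    (hheavy : ε ≤ ∑ b with 1 ≤ m * q b, q b * ∑ z, cellHellinger (p b) z) :
    ∃ t ∈ scales m, 2 * 10 ^ 6 * numScales m *
      scaleNoise m ℓ (Fintype.card A) (Fintype.card B) (Fintype.card C) t ≤
        (2 ^ t.1) ^ 2 * ∑ b, ∑ z ∈ scaleCells m q p t b, depend (p b) z ^ 2 := by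
  obtain ⟨⟨j, i, i'⟩, ht, hsignal⟩ := exists_le_sum_scaleCells hq h.one_le hε hheavy
  refine ⟨(j, i, i'), ht, ?_⟩
  set n := min (Fintype.card B) (blockLength m ℓ (2 ^ j)) with hn
  have hj := two_pow_le_of_mem_scales h.one_le ht
  have hlength : (m / 2 ^ j : ℝ) ≤ blockLength m ℓ (2 ^ j) := by
    rw [div_le_iff₀' (by positivity)]
    exact_mod_cast (Nat.le_mul_of_pos_left m h.one_le_factor).trans
      (mul_lt_mul_blockLength (Nat.two_pow_pos j) m ℓ).le
  have hcard := sum_card_scaleCells_le hq hp (m := m) (M := n) (j := j)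
    (by rw [hn, Nat.cast_min]; exact min_le_min_left _ hlength) i i'
  have hnB : (n : ℝ) ≤ Fintype.card B := mod_cast min_le_left _ _
  refine mul_noiseLevel_le (le_min Fintype.card_pos (Nat.succ_pos _)) Fintype.card_pos hCA
    (mod_cast one_le_numScales m) (by positivity)
    (sum_nonneg fun b _ => sum_nonneg fun z _ => sq_nonneg _) hsignal
    ((sq_sum_cellHellinger_le hp _).trans (mul_le_mul_of_nonneg_right hcard
      (sum_nonneg fun b _ => sum_nonneg fun z _ => sq_nonneg _)))
    (sum_cellHellinger_le_mul_sum_depend_sq hp m q) (le_trans ?_ h.sym)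
    (h.asym_scale hj (min_le_left _ _) (min_le_right _ _))
  gcongr

lemma scaleNoise_zero_le {m ℓ dB : ℕ} (dA dC : ℕ) (hm : 1 ≤ m) (hℓ : 1 ≤ ℓ) (hB : 1 ≤ dB) :
    scaleNoise m ℓ dA dB dC (0, 0, 0) ≤ √(min dB (2 * (ℓ * m))) := by
  have hlength := mul_blockLength_le hm hℓ
  rw [one_mul] at hlength
  have hn : 1 ≤ min dB (blockLength m ℓ 1) := le_min hB (Nat.succ_pos _)
  calc scaleNoise m ℓ dA dB dC (0, 0, 0) ≤ √(min dB (blockLength m ℓ 1) : ℕ) :=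
        max_le (Real.one_le_sqrt.2 (mod_cast hn)) (sqrt_flatNoise_self_le le_rfl _ dA dC)
    _ ≤ √(min dB (2 * (ℓ * m))) := Real.sqrt_le_sqrt (mod_cast min_le_min_left _ hlength)

variable [DecidableEq A] [DecidableEq B] [DecidableEq C]

lemma exists_le_scaleRejectProb_of_heavy [Nonempty B] [Nonempty C]
    (hCA : Fintype.card C ≤ Fintype.card A) {q : B → ℝ} (hq : q ∈ stdSimplex ℝ B)
    {p : B → A × C → ℝ} (hp : ∀ b, p b ∈ stdSimplex ℝ (A × C)) {ε : ℝ} (hε : 0 ≤ ε) {m ℓ : ℕ}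
    (h : IsSufficient ε (Fintype.card A) (Fintype.card B) (Fintype.card C) m ℓ)
    (hheavy : ε ≤ ∑ b with 1 ≤ m * q b, q b * ∑ z, cellHellinger (p b) z) :
    ∃ t ∈ scales m, 2 / 3 ≤ scaleRejectProb m ℓ q p t := by
  obtain ⟨⟨j, i, i'⟩, ht, hsignal⟩ := exists_mul_scaleNoise_le hCA hq hp hε h hheavy
  rw [mul_sum] at hsignal
  refine ⟨(j, i, i'), ht, le_scaleRejectProb hq hp (cells := scaleCells m q p (j, i, i'))
    (fun b z hz => margFst_mul_le_of_mem_scaleCells hz)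
    (fun b z hz => margSnd_mul_le_of_mem_scaleCells hz) hsignal ?_⟩
  have hpos : (0 : ℝ) < 2 * 10 ^ 6 * numScales m *
      scaleNoise m ℓ (Fintype.card A) (Fintype.card B) (Fintype.card C) (j, i, i') :=
    mul_pos (mul_pos (by norm_num) (mod_cast one_le_numScales m))
      (one_pos.trans_le (one_le_scaleNoise _ _ _ _ _ _))
  refine prob_sum_mem_lt_half_sum_le (blockWeight_mem_stdSimplex _ hq)
    (fun b => mul_nonneg (sq_nonneg _) (sum_nonneg fun z _ => sq_nonneg _))
    (hpos.trans_le hsignal) fun b hb => ?_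
  obtain ⟨z, hz⟩ : (scaleCells m q p (j, i, i') b).Nonempty := by
    by_contra! hempty
    exact hb (by simp [hempty])
  exact le_prob_mem_usedBins_of_mem_scales hq h.one_le h.le_exp ht
    (two_pow_le_of_mem_scaleCells hz)

lemma le_scaleRejectProb_of_light [Nonempty A] [Nonempty B] [Nonempty C]
    {q : B → ℝ} (hq : q ∈ stdSimplex ℝ B) {p : B → A × C → ℝ}
    (hp : ∀ b, p b ∈ stdSimplex ℝ (A × C)) {ε : ℝ} (hε : 0 ≤ ε) {m ℓ : ℕ}
    (h : IsSufficient ε (Fintype.card A) (Fintype.card B) (Fintype.card C) m ℓ)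
    (hlight : ε ≤ ∑ b with ¬ 1 ≤ m * q b, q b * ∑ z, cellHellinger (p b) z) :
    2 / 3 ≤ scaleRejectProb m ℓ q p (0, 0, 0) := by
  have hmn : m ≤ blockLength m ℓ 1 := by
    have := mul_lt_mul_blockLength one_pos m ℓ
    have := Nat.le_mul_of_pos_left m h.one_le_factor
    omega
  have hsignal := pow_four_le_mul_sum_depend_sq_mul_hitProb hq hp hmn hε hlight
  set E := ∑ b, (∑ z, depend (p b) z ^ 2) * hitProb 4 (blockLength m ℓ 1) (q b)
  have : (0 : ℝ) < Fintype.card A := mod_cast Fintype.card_pos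
  have : (0 : ℝ) < Fintype.card B := mod_cast Fintype.card_pos
  have : (0 : ℝ) < Fintype.card C := mod_cast Fintype.card_pos
  have hE : 2 * 10 ^ 6 * numScales m *
      scaleNoise m ℓ (Fintype.card A) (Fintype.card B) (Fintype.card C) (0, 0, 0) ≤ E := by
    refine le_of_mul_le_mul_left (le_trans (le_trans ?_ h.light) hsignal) (by positivity)
    have hnoise := scaleNoise_zero_le (Fintype.card A) (Fintype.card C) h.one_le h.one_le_factor
      (Fintype.card_pos (α := B))
    calc _ = 128000000 * numScales m *
          ((Fintype.card B : ℝ) ^ 3 * (Fintype.card A * Fintype.card C)) *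
          scaleNoise m ℓ (Fintype.card A) (Fintype.card B) (Fintype.card C) (0, 0, 0) := by ring
      _ ≤ _ := mul_le_mul_of_nonneg_left hnoise (by positivity)
  have hE' : 160 ≤ E := by
    have hW : (1 : ℝ) ≤ numScales m := mod_cast one_le_numScales m
    have := mul_le_mul hW (one_le_scaleNoise m ℓ (Fintype.card A) (Fintype.card B)
      (Fintype.card C) (0, 0, 0)) zero_le_one (zero_le_one.trans hW)
    linarith
  refine le_scaleRejectProb hq hp (cells := fun _ => univ) (fun b z _ => by norm_num)
    (fun b z _ => by norm_num) hE ?_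
  simp only [pow_zero, one_pow, one_mul]
  refine prob_sum_mem_lt_le (blockWeight_mem_stdSimplex _ hq)
    (fun b b' hb => prob_mem_usedBins_and_mem_usedBins_le _ hq hb)
    (fun b => sum_nonneg fun z _ => sq_nonneg _) (D := 4) (fun b => sum_depend_sq_le (hp b)) ?_
    (by linarith) (by linarith)
  simp only [prob_mem_usedBins _ hq, card_role]
  rfl

end Detection

theorem scCIndep_hellingerSq_le {A B C : Type} [Fintype A] [Fintype B] [Fintype C] [Nonempty A]
    [Nonempty B] [Nonempty C] (hCA : Fintype.card C ≤ Fintype.card A) {ε : ℝ} (hε : 0 ≤ ε)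
    {m ℓ : ℕ} (h : IsSufficient ε (Fintype.card A) (Fintype.card B) (Fintype.card C) m ℓ) :
    scCIndep (A := A) (B := B) (C := C) hellingerSq ε ≤ (16 * (ℓ * m) : ℕ) := by
  classical
  have : Nonempty (scales m) := (scales_nonempty m).to_subtype
  choose S hS using fun t : scales m =>
    exists_prob_eq_scaleRejectProb (A := A) (B := B) (C := C) h.one_le h.one_le_factor t.2
  refine scCIndep_le_of_rejections S (fun P hP hP0 t => ?_) fun P hP hfar => ?_
  · obtain ⟨q, hq, p, hp, rfl, hzero⟩ := exists_eq_joint hP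
    have hind : ∀ b z, depend (p b) z = 0 := fun b => by
      by_cases hb : q b = 0
      exacts [hzero b hb, depend_eq_zero_of_hellingerSq_eq_zero hq hp hP0 hb]
    rw [hS t q hq p hp, Fintype.card_coe]
    refine (scaleRejectProb_le hq hp hind m ℓ t).trans ?_
    have : (0 : ℝ) < #(scales m) := mod_cast (scales_nonempty m).card_pos
    gcongr
    exact card_scales_le m
  · obtain ⟨q, hq, p, hp, rfl, -⟩ := exists_eq_joint hP
    rw [hellingerSq_joint_markovRef hq hp,
      ← sum_filter_add_sum_filter_not univ fun b => 1 ≤ m * q b] at hfar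
    by_cases hheavy : ε ≤ ∑ b with 1 ≤ m * q b, q b * ∑ z, cellHellinger (p b) z
    · obtain ⟨t, ht, hreject⟩ := exists_le_scaleRejectProb_of_heavy hCA hq hp hε h hheavy
      exact ⟨⟨t, ht⟩, hreject.trans_eq (hS ⟨t, ht⟩ q hq p hp).symm⟩
    · have hreject := le_scaleRejectProb_of_light hq hp hε h (by linarith)
      have ht : (0, 0, 0) ∈ scales m := mem_scales.2 (by simp)
      exact ⟨⟨_, ht⟩, hreject.trans_eq (hS ⟨_, ht⟩ q hq p hp).symm⟩

/-! ### The rate -/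

section Rates

variable {a b c x s ε D m R : ℝ} {n k : ℕ}

lemma rpow_pow_eq_pow (hx : 0 ≤ x) (h : s * n = k) : (x ^ s) ^ n = x ^ k := by
  rw [← Real.rpow_mul_natCast hx, h, Real.rpow_natCast]

lemma rpow_pow_eq_pow_mul_sqrt (hx : 0 ≤ x) (h : s * n = k + 1 / 2) :
    (x ^ s) ^ n = x ^ k * √x := by
  rw [← Real.rpow_mul_natCast hx, h, Real.rpow_add_of_nonneg hx (by positivity) (by positivity),
    Real.rpow_natCast, Real.sqrt_eq_rpow]

lemma sq_mul_le_of_mul_fSym_le (ha : 0 ≤ a) (hb : 0 ≤ b) (hc : 0 ≤ c) (hε : 0 < ε) (hD : 0 ≤ D)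
    (hm : D * fSym ε a b c ≤ m) : D ^ 2 * (b * √b * (a * c)) ≤ (m * ε) ^ 2 := by
  have hpow : (a ^ (1 / 2 : ℝ) * b ^ (3 / 4 : ℝ) * c ^ (1 / 2 : ℝ)) ^ 2 = b * √b * (a * c) := by
    rw [mul_pow, mul_pow, rpow_pow_eq_pow (k := 1) ha (by norm_num),
      rpow_pow_eq_pow_mul_sqrt (k := 1) hb (by norm_num),
      rpow_pow_eq_pow (k := 1) hc (by norm_num)]
    ring
  have hle := (mul_le_mul_of_nonneg_left (le_max_left _ _) hD).trans hm
  rw [← mul_div_assoc, div_le_iff₀ hε] at hle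
  rw [← hpow, ← mul_pow]
  gcongr

lemma mul_sqrt_le_pow_four_of_mul_rpow_le (ha : 0 ≤ a) (hb : 0 ≤ b) (hc : 0 ≤ c) (hε : 0 ≤ ε)
    (hD : 1 ≤ D) (hm₀ : 0 ≤ m)
    (hm : D * (a ^ (2 / 7 : ℝ) * b ^ (6 / 7 : ℝ) * c ^ (2 / 7 : ℝ)) ≤ m * ε ^ (8 / 7 : ℝ)) :
    D * (b ^ 3 * (a * c) * √m) ≤ (m * ε) ^ 4 := by
  have hpow : (a ^ (2 / 7 : ℝ) * b ^ (6 / 7 : ℝ) * c ^ (2 / 7 : ℝ)) ^ 7 =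
      a ^ 2 * b ^ 6 * c ^ 2 := by
    rw [mul_pow, mul_pow, rpow_pow_eq_pow (k := 2) ha (by norm_num),
      rpow_pow_eq_pow (k := 6) hb (by norm_num), rpow_pow_eq_pow (k := 2) hc (by norm_num)]
  have hroot : D * (b ^ 3 * (a * c)) ≤ m ^ 3 * √m * ε ^ 4 := by
    refine le_of_sq_le_sq ?_ (by positivity)
    calc (D * (b ^ 3 * (a * c))) ^ 2 = D ^ 2 * (a ^ 2 * b ^ 6 * c ^ 2) := by ring
      _ ≤ D ^ 7 * (a ^ 2 * b ^ 6 * c ^ 2) := by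
        gcongr
        norm_num
      _ ≤ (m * ε ^ (8 / 7 : ℝ)) ^ 7 := by
        rw [← hpow, ← mul_pow]
        gcongr
      _ = m ^ 6 * √m ^ 2 * ε ^ 8 := by
        rw [mul_pow, rpow_pow_eq_pow (k := 8) hε (by norm_num), Real.sq_sqrt hm₀]
        ring
      _ = (m ^ 3 * √m * ε ^ 4) ^ 2 := by ring
  calc D * (b ^ 3 * (a * c) * √m) = D * (b ^ 3 * (a * c)) * √m := by ring
    _ ≤ m ^ 3 * √m * ε ^ 4 * √m := by gcongr
    _ = m ^ 3 * (√m * √m) * ε ^ 4 := by ring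
    _ = (m * ε) ^ 4 := by
      rw [Real.mul_self_sqrt hm₀]
      ring

lemma mul_le_pow_four_or_of_mul_fSym_le (ha : 0 ≤ a) (hb : 0 ≤ b) (hc : 0 ≤ c) (hε : 0 < ε)
    (hD : 1 ≤ D) (hm₀ : 0 ≤ m) (hm : D * fSym ε a b c ≤ m) :
    D * (b ^ 3 * (a * c) * √b) ≤ (m * ε) ^ 4 ∨ D * (b ^ 3 * (a * c) * √m) ≤ (m * ε) ^ 4 := by
  have hD₀ : 0 ≤ D := zero_le_one.trans hD
  have hpow : (a ^ (1 / 4 : ℝ) * b ^ (7 / 8 : ℝ) * c ^ (1 / 4 : ℝ)) ^ 4 = b ^ 3 * (a * c) * √b := by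
    rw [mul_pow, mul_pow, rpow_pow_eq_pow (k := 1) ha (by norm_num),
      rpow_pow_eq_pow_mul_sqrt (k := 3) hb (by norm_num),
      rpow_pow_eq_pow (k := 1) hc (by norm_num)]
    ring
  have hmin := (mul_le_mul_of_nonneg_left (le_max_right _ _) hD₀).trans hm
  rw [mul_min_of_nonneg _ _ hD₀, min_le_iff, ← mul_div_assoc, ← mul_div_assoc, div_le_iff₀ hε,
    div_le_iff₀ (by positivity)] at hmin
  refine hmin.imp (fun hle => ?_) (mul_sqrt_le_pow_four_of_mul_rpow_le ha hb hc hε.le hD hm₀)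
  calc D * (b ^ 3 * (a * c) * √b) ≤ D ^ 4 * (b ^ 3 * (a * c) * √b) := by
        gcongr
        exact le_self_pow₀ hD (by norm_num)
    _ ≤ (m * ε) ^ 4 := by
      rw [← hpow, ← mul_pow]
      gcongr

lemma mul_sqrt_le_sq_of_mul_rpow_le (ha : 0 ≤ a) (hb : 0 ≤ b) (hc : 0 ≤ c) (hε : 0 ≤ ε)
    (hD : 1 ≤ D) (hm₀ : 0 ≤ m)
    (hm : D * (a ^ (2 / 3 : ℝ) * b ^ (2 / 3 : ℝ) * c ^ (1 / 3 : ℝ)) ≤ m * ε ^ (4 / 3 : ℝ)) :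
    D * (b * √m * (a * √c)) ≤ (m * ε) ^ 2 := by
  have hpow : (a ^ (2 / 3 : ℝ) * b ^ (2 / 3 : ℝ) * c ^ (1 / 3 : ℝ)) ^ 3 = a ^ 2 * b ^ 2 * c := by
    rw [mul_pow, mul_pow, rpow_pow_eq_pow (k := 2) ha (by norm_num),
      rpow_pow_eq_pow (k := 2) hb (by norm_num), rpow_pow_eq_pow (k := 1) hc (by norm_num),
      pow_one]
  have hroot : D * (b * (a * √c)) ≤ m * √m * ε ^ 2 := by
    refine le_of_sq_le_sq ?_ (by positivity)
    calc (D * (b * (a * √c))) ^ 2 = D ^ 2 * (a ^ 2 * b ^ 2 * √c ^ 2) := by ring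
      _ = D ^ 2 * (a ^ 2 * b ^ 2 * c) := by rw [Real.sq_sqrt hc]
      _ ≤ D ^ 3 * (a ^ 2 * b ^ 2 * c) := by
        gcongr
        norm_num
      _ ≤ (m * ε ^ (4 / 3 : ℝ)) ^ 3 := by
        rw [← hpow, ← mul_pow]
        gcongr
      _ = m ^ 2 * √m ^ 2 * ε ^ 4 := by
        rw [mul_pow, rpow_pow_eq_pow (k := 4) hε (by norm_num), Real.sq_sqrt hm₀]
        ring
      _ = (m * √m * ε ^ 2) ^ 2 := by ring
  calc D * (b * √m * (a * √c)) = D * (b * (a * √c)) * √m := by ring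
    _ ≤ m * √m * ε ^ 2 * √m := by gcongr
    _ = m * (√m * √m) * ε ^ 2 := by ring
    _ = (m * ε) ^ 2 := by
      rw [Real.mul_self_sqrt hm₀]
      ring

lemma mul_le_sq_or_of_mul_fAsym_le (ha : 0 ≤ a) (hb : 0 ≤ b) (hc : 0 ≤ c) (hε : 0 < ε)
    (hD : 1 ≤ D) (hm₀ : 0 ≤ m) (hm : D * fAsym ε a b c ≤ m) :
    D * (b * √b * (a * √c) * √a) ≤ (m * ε) ^ 2 ∨ D * (b * √m * (a * √c)) ≤ (m * ε) ^ 2 := by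
  have hD₀ : 0 ≤ D := zero_le_one.trans hD
  have hpow : (a ^ (3 / 4 : ℝ) * b ^ (3 / 4 : ℝ) * c ^ (1 / 4 : ℝ)) ^ 2 =
      b * √b * (a * √c) * √a := by
    rw [mul_pow, mul_pow, rpow_pow_eq_pow_mul_sqrt (k := 1) ha (by norm_num),
      rpow_pow_eq_pow_mul_sqrt (k := 1) hb (by norm_num),
      rpow_pow_eq_pow_mul_sqrt (k := 0) hc (by norm_num)]
    ring
  rw [fAsym, mul_min_of_nonneg _ _ hD₀, min_le_iff, ← mul_div_assoc, ← mul_div_assoc,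
    div_le_iff₀ hε, div_le_iff₀ (by positivity)] at hm
  refine hm.imp (fun hle => ?_) (mul_sqrt_le_sq_of_mul_rpow_le ha hb hc hε.le hD hm₀)
  calc D * (b * √b * (a * √c) * √a) ≤ D ^ 2 * (b * √b * (a * √c) * √a) := by
        gcongr
        exact le_self_pow₀ hD (by norm_num)
    _ ≤ (m * ε) ^ 2 := by
      rw [← hpow, ← mul_pow]
      gcongr

lemma max_fSym_fAsym_le (ha : 1 ≤ a) (hb : 1 ≤ b) (hc : 1 ≤ c) (hε : 0 ≤ ε) :
    max (fSym ε a b c) (fAsym ε a b c) ≤ a * b * c / ε := by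
  have hrpow : ∀ {x s : ℝ}, 1 ≤ x → s ≤ 1 → x ^ s ≤ x := fun {x s} hx hs => by
    simpa using Real.rpow_le_rpow_of_exponent_le hx hs
  refine max_le (max_le ?_ ((min_le_left _ _).trans ?_)) ((min_le_left _ _).trans ?_)
  all_goals gcongr <;> exact hrpow ‹_› (by norm_num)

lemma one_le_max_fSym_fAsym (ha : 1 ≤ a) (hb : 1 ≤ b) (hc : 1 ≤ c) (hε : 0 < ε) (hε₁ : ε ≤ 1) :
    1 ≤ max (fSym ε a b c) (fAsym ε a b c) := by
  refine le_max_of_le_left (le_max_of_le_left ((one_le_div hε).2 (hε₁.trans ?_)))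
  exact one_le_mul_of_one_le_of_one_le (one_le_mul_of_one_le_of_one_le
    (Real.one_le_rpow ha (by norm_num)) (Real.one_le_rpow hb (by norm_num)))
    (Real.one_le_rpow hc (by norm_num))

lemma div_div_rpow_le (hx : 0 ≤ x) (hε : 0 ≤ ε) (hR : 1 ≤ R) (hs : s ≤ n) :
    x / (ε / R) ^ s ≤ R ^ n * (x / ε ^ s) := by
  have hR₀ : 0 ≤ R := zero_le_one.trans hR
  rw [Real.div_rpow hε hR₀, div_div_eq_mul_div, mul_comm x, mul_div_assoc, ← Real.rpow_natCast R n]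
  gcongr

lemma max_fSym_fAsym_div_le (ha : 0 ≤ a) (hb : 0 ≤ b) (hc : 0 ≤ c) (hε : 0 ≤ ε) (hR : 1 ≤ R) :
    max (fSym (ε / R) a b c) (fAsym (ε / R) a b c) ≤
      R ^ 2 * max (fSym ε a b c) (fAsym ε a b c) := by
  have hlinear : ∀ y : ℝ, 0 ≤ y → y / (ε / R) ≤ R ^ 2 * (y / ε) := fun y hy => by
    simpa using div_div_rpow_le (s := 1) (n := 2) hy hε hR (by norm_num)
  unfold fSym fAsym
  simp only [mul_max_of_nonneg _ _ (sq_nonneg R), mul_min_of_nonneg _ _ (sq_nonneg R)]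
  refine max_le_max (max_le_max (hlinear _ (by positivity))
    (min_le_min (hlinear _ (by positivity)) ?_)) (min_le_min (hlinear _ (by positivity)) ?_)
  all_goals exact div_div_rpow_le (by positivity) hε hR (by norm_num)

lemma max_fSym_fAsym_nonneg (ha : 0 ≤ a) (hb : 0 ≤ b) (hc : 0 ≤ c) (hε : 0 ≤ ε) :
    0 ≤ max (fSym ε a b c) (fAsym ε a b c) :=
  le_max_of_le_left (le_max_of_le_left (by positivity))

lemma half_le_log_two_add (hx : 0 ≤ x) : 1 / 2 ≤ Real.log (2 + x) := by
  have := Real.log_le_log two_pos (le_add_of_nonneg_right hx)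
  linarith [Real.log_two_gt_d9]

lemma log_two_add_mul_le (hx : 0 ≤ x) (hR₀ : 0 ≤ R) (hR : R ≤ 168 * Real.log (2 + x)) :
    Real.log (2 + R * x) ≤ 10 * Real.log (2 + x) := by
  have hlog : Real.log (2 + x) ≤ 2 + x := Real.log_le_self (by positivity)
  rw [show (10 : ℝ) = (10 : ℕ) by norm_num, ← Real.log_pow]
  refine Real.log_le_log (by positivity) ?_
  calc 2 + R * x ≤ 2 + 168 * (2 + x) * (2 + x) := by
        gcongr <;> linarith
    _ ≤ 2 ^ 8 * (2 + x) ^ 2 := by nlinarith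
    _ ≤ (2 + x) ^ 8 * (2 + x) ^ 2 := by
      gcongr
      linarith
    _ = (2 + x) ^ 10 := by ring

lemma rate_div_le (ha : 0 ≤ a) (hb : 0 ≤ b) (hc : 0 ≤ c) (hε : 0 < ε) (hR : 1 ≤ R)
    (hRlog : R ≤ 168 * Real.log (2 + a * b * c / ε)) :
    rate (10 ^ 50) 11 (ε / R) a b c ≤ rate (10 ^ 66) 13 ε a b c := by
  have hx : 0 ≤ a * b * c / ε := by positivity
  have hlog := half_le_log_two_add hx
  have hlogR := log_two_add_mul_le hx (zero_le_one.trans hR) hRlog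
  rw [rate, div_div_eq_mul_div, mul_comm (a * b * c) R, mul_div_assoc, rate]
  have : 0 ≤ Real.log (2 + R * (a * b * c / ε)) :=
    Real.log_nonneg (by linarith [mul_nonneg (zero_le_one.trans hR) hx])
  have := max_fSym_fAsym_nonneg ha hb hc hε.le
  set F := max (fSym ε a b c) (fAsym ε a b c)
  set L := Real.log (2 + a * b * c / ε)
  calc 10 ^ 50 * Real.log (2 + R * (a * b * c / ε)) ^ 11 *
        max (fSym (ε / R) a b c) (fAsym (ε / R) a b c)
      ≤ 10 ^ 50 * (10 * L) ^ 11 * (R ^ 2 * F) := by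
        gcongr
        · exact max_fSym_fAsym_nonneg ha hb hc (by positivity)
        exact max_fSym_fAsym_div_le ha hb hc hε.le hR
    _ ≤ 10 ^ 50 * (10 * L) ^ 11 * ((168 * L) ^ 2 * F) := by gcongr
    _ = 10 ^ 50 * 10 ^ 11 * 168 ^ 2 * L ^ 13 * F := by ring
    _ ≤ 10 ^ 66 * L ^ 13 * F := by
      gcongr
      norm_num

end Rates

section Parameters

lemma natLog_two_le {m : ℕ} {y : ℝ} (hm : m ≠ 0) (h : m ≤ Real.exp y) : Nat.log 2 m ≤ 2 * y := by
  have hexp : Real.exp (1 / 2) ≤ 2 := by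
    rw [← Real.le_log_iff_exp_le two_pos]
    linarith [Real.log_two_gt_d9]
  have hlog : Real.exp (Nat.log 2 m * (1 / 2)) ≤ Real.exp y := calc
    Real.exp (Nat.log 2 m * (1 / 2)) = Real.exp (1 / 2) ^ Nat.log 2 m := Real.exp_nat_mul _ _
    _ ≤ 2 ^ Nat.log 2 m := by gcongr
    _ ≤ m := mod_cast Nat.pow_log_le_self 2 hm
    _ ≤ Real.exp y := h
  linarith [Real.exp_le_exp.1 hlog]

lemma le_exp_mul_natCast {x : ℝ} {n L : ℕ} (hx : x ≤ 2.7 ^ n) (hL : 1 ≤ L) :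
    x ≤ Real.exp (n * L) := by
  calc x ≤ 2.7 ^ n := hx
    _ ≤ Real.exp 1 ^ n := by
      gcongr
      linarith [Real.exp_one_gt_d9]
    _ = Real.exp n := by rw [← Real.exp_nat_mul, mul_one]
    _ ≤ Real.exp (n * L) :=
      Real.exp_le_exp.2 (le_mul_of_one_le_right (Nat.cast_nonneg n) (mod_cast hL))

lemma two_mul_pow_ten_le_exp {L : ℕ} (hL : 1 ≤ L) :
    2 * (10 ^ 40 * L ^ 10) ≤ Real.exp (110 * L) := by
  have hpow : (L : ℝ) ^ 10 ≤ Real.exp (10 * L) := by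
    rw [show (10 : ℝ) = (10 : ℕ) by norm_num, Real.exp_nat_mul]
    gcongr
    linarith [Real.add_one_le_exp (L : ℝ)]
  calc 2 * (10 ^ 40 * (L : ℝ) ^ 10) = 2 * 10 ^ 40 * L ^ 10 := by ring
    _ ≤ Real.exp ((100 : ℕ) * L) * Real.exp (10 * L) := by
      gcongr
      exact le_exp_mul_natCast (by norm_num) hL
    _ = Real.exp (110 * L) := by
      rw [← Real.exp_add]
      push_cast
      ring_nf

lemma numScales_le {m L : ℕ} (hm : m ≠ 0) (hL : 1 ≤ L) (h : m ≤ Real.exp (111 * L)) :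
    (numScales m : ℝ) ≤ (223 * L) ^ 3 := by
  have hL' : (1 : ℝ) ≤ L := mod_cast hL
  rw [numScales]
  push_cast
  gcongr
  linarith [natLog_two_le hm h]

lemma sqrt_mul_le_mul_sqrt {x y : ℝ} (hx : 1 ≤ x) : √(x * y) ≤ x * √y := by
  rw [Real.sqrt_mul (zero_le_one.trans hx)]
  gcongr
  exact Real.sqrt_le_iff.2 ⟨zero_le_one.trans hx, le_self_pow₀ hx two_ne_zero⟩

section Overhead

variable {a b c ε w r D m : ℝ}

lemma mul_sqrt_mul_le_sq_or_of_mul_fAsym_le (ha : 0 ≤ a) (hb : 0 ≤ b) (hc : 0 ≤ c) (hε : 0 < ε)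
    (hw : 0 ≤ w) (hr : 1 ≤ r) (hwr : w * r ≤ D) (hD : 1 ≤ D) (hm₀ : 0 ≤ m)
    (hm : D * fAsym ε a b c ≤ m) :
    w * (b * √b) * (a * √c) * √a ≤ (m * ε) ^ 2 ∨ w * (b * √(r * m)) * (a * √c) ≤ (m * ε) ^ 2 := by
  refine (mul_le_sq_or_of_mul_fAsym_le ha hb hc hε hD hm₀ hm).imp (fun hdense => ?_)
    fun hsparse => ?_
  · calc w * (b * √b) * (a * √c) * √a = w * (b * √b * (a * √c) * √a) := by ring
      _ ≤ D * (b * √b * (a * √c) * √a) := by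
        gcongr
        exact (le_mul_of_one_le_right hw hr).trans hwr
      _ ≤ (m * ε) ^ 2 := hdense
  · calc w * (b * √(r * m)) * (a * √c) ≤ w * (b * (r * √m)) * (a * √c) := by
          gcongr
          exact sqrt_mul_le_mul_sqrt hr
      _ = w * r * (b * √m * (a * √c)) := by ring
      _ ≤ D * (b * √m * (a * √c)) := by gcongr
      _ ≤ (m * ε) ^ 2 := hsparse

lemma mul_sqrt_min_le_pow_four_of_mul_fSym_le (ha : 0 ≤ a) (hb : 0 ≤ b) (hc : 0 ≤ c) (hε : 0 < ε)
    (hw : 0 ≤ w) (hr : 1 ≤ r) (hwr : w * r ≤ D) (hD : 1 ≤ D) (hm₀ : 0 ≤ m)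
    (hm : D * fSym ε a b c ≤ m) :
    w * (b ^ 3 * (a * c)) * √(min b (r * m)) ≤ (m * ε) ^ 4 := by
  rcases mul_le_pow_four_or_of_mul_fSym_le ha hb hc hε hD hm₀ hm with hdense | hsparse
  · calc w * (b ^ 3 * (a * c)) * √(min b (r * m)) ≤ w * (b ^ 3 * (a * c)) * √b := by
          gcongr
          exact min_le_left _ _
      _ = w * (b ^ 3 * (a * c) * √b) := by ring
      _ ≤ D * (b ^ 3 * (a * c) * √b) := by
        gcongr
        exact (le_mul_of_one_le_right hw hr).trans hwr
      _ ≤ (m * ε) ^ 4 := hdense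
  · calc w * (b ^ 3 * (a * c)) * √(min b (r * m)) ≤ w * (b ^ 3 * (a * c)) * (r * √m) := by
          gcongr
          exact (Real.sqrt_le_sqrt (min_le_right _ _)).trans (sqrt_mul_le_mul_sqrt hr)
      _ = w * r * (b ^ 3 * (a * c) * √m) := by ring
      _ ≤ D * (b ^ 3 * (a * c) * √m) := by gcongr
      _ ≤ (m * ε) ^ 4 := hsparse

end Overhead

lemma isSufficient_of_mul_max_le {ε D : ℝ} {dA dB dC m ℓ : ℕ} (hε : 0 < ε) (hm : 1 ≤ m)
    (hℓ : 1 ≤ ℓ) (hexp : 160 * m ≤ Real.exp ℓ) (hsq : 10 ^ 23 * numScales m ^ 4 ≤ D ^ 2)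
    (hcube : 1280000000 * numScales m ^ 3 * (2 * ℓ) ≤ D)
    (h : D * max (fSym ε dA dB dC) (fAsym ε dA dB dC) ≤ m) : IsSufficient ε dA dB dC m ℓ := by
  have hfactor : (1 : ℝ) ≤ 2 * ℓ := mod_cast (by omega : 1 ≤ 2 * ℓ)
  have hW : (1 : ℝ) ≤ numScales m := mod_cast one_le_numScales m
  have hD : 1 ≤ D := (one_le_mul_of_one_le_of_one_le
    (one_le_mul_of_one_le_of_one_le (by norm_num) (one_le_pow₀ hW)) hfactor).trans hcube
  have hlinear : 128000000 * (numScales m : ℝ) * (2 * ℓ) ≤ D := by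
    refine le_trans ?_ hcube
    gcongr
    · norm_num
    · exact le_self_pow₀ hW (by norm_num)
  have hD₀ : 0 ≤ D := zero_le_one.trans hD
  have hsym := (mul_le_mul_of_nonneg_left (le_max_left _ _) hD₀).trans h
  have hasym := (mul_le_mul_of_nonneg_left (le_max_right _ _) hD₀).trans h
  refine ⟨hm, hexp, ?_, ?_, ?_⟩
  · calc 10 ^ 23 * numScales m ^ 4 * (dB * √dB) * (dA * dC : ℝ)
        = 10 ^ 23 * numScales m ^ 4 * (dB * √dB * (dA * dC)) := by ring
      _ ≤ D ^ 2 * (dB * √dB * (dA * dC)) := by gcongr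
      _ ≤ (m * ε) ^ 2 := sq_mul_le_of_mul_fSym_le (by positivity) (by positivity)
        (by positivity) hε hD₀ hsym
  · rw [← mul_assoc 2]
    exact mul_sqrt_mul_le_sq_or_of_mul_fAsym_le (by positivity) (by positivity) (by positivity) hε
      (by positivity) hfactor hcube hD (by positivity) hasym
  · rw [← mul_assoc 2]
    exact mul_sqrt_min_le_pow_four_of_mul_fSym_le (by positivity) (by positivity) (by positivity) hε
      (by positivity) hfactor hlinear hD (by positivity) hsym

lemma numScales_overhead_le {m L : ℕ} (h : (numScales m : ℝ) ≤ (223 * L) ^ 3) (hL : 1 ≤ L) :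
    10 ^ 23 * (numScales m : ℝ) ^ 4 ≤ (10 ^ 40 * L ^ 10) ^ 2 ∧
      1280000000 * (numScales m : ℝ) ^ 3 * (2 * (117 * L : ℕ)) ≤ 10 ^ 40 * L ^ 10 := by
  have : (1 : ℝ) ≤ L := mod_cast hL
  constructor
  · calc 10 ^ 23 * (numScales m : ℝ) ^ 4 ≤ 10 ^ 23 * ((223 * L) ^ 3) ^ 4 := by gcongr
      _ = 10 ^ 23 * 223 ^ 12 * (L : ℝ) ^ 12 := by ring
      _ ≤ 10 ^ 80 * (L : ℝ) ^ 20 := by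
        gcongr
        · norm_num
        · norm_num
      _ = (10 ^ 40 * L ^ 10) ^ 2 := by ring
  · calc 1280000000 * (numScales m : ℝ) ^ 3 * (2 * (117 * L : ℕ))
        ≤ 1280000000 * ((223 * L) ^ 3) ^ 3 * (2 * (117 * L : ℕ)) := by gcongr
      _ = 1280000000 * 223 ^ 9 * 234 * (L : ℝ) ^ 10 := by
        push_cast
        ring
      _ ≤ 10 ^ 40 * L ^ 10 := by
        gcongr
        norm_num

lemma exists_isSufficient_of_le_exp {ε : ℝ} {dA dB dC L : ℕ} (hε : 0 < ε) (hL : 1 ≤ L)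
    (hone : 1 ≤ max (fSym ε dA dB dC) (fAsym ε dA dB dC))
    (hexp : max (fSym ε dA dB dC) (fAsym ε dA dB dC) ≤ Real.exp L) :
    ∃ m : ℕ, IsSufficient ε dA dB dC m (117 * L) ∧
      m ≤ 2 * (10 ^ 40 * L ^ 10) * max (fSym ε dA dB dC) (fAsym ε dA dB dC) := by
  set F := max (fSym ε dA dB dC) (fAsym ε dA dB dC) with hF
  have hDF : 1 ≤ 10 ^ 40 * (L : ℝ) ^ 10 * F := one_le_mul_of_one_le_of_one_le
    (one_le_mul_of_one_le_of_one_le (by norm_num) (one_le_pow₀ (mod_cast hL))) hone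
  set m := ⌈10 ^ 40 * (L : ℝ) ^ 10 * F⌉₊
  have hm : 1 ≤ m := Nat.one_le_ceil_iff.2 (zero_lt_one.trans_le hDF)
  have hm_le : (m : ℝ) ≤ 2 * (10 ^ 40 * L ^ 10) * F := by
    rw [mul_assoc]
    exact Nat.ceil_le_two_mul (by linarith)
  have hm_exp : (m : ℝ) ≤ Real.exp (111 * L) := by
    refine hm_le.trans ((mul_le_mul (two_mul_pow_ten_le_exp hL) hexp (zero_le_one.trans hone)
      (Real.exp_pos _).le).trans_eq ?_)
    rw [← Real.exp_add]
    ring_nf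
  have hm_exp' : 160 * m ≤ Real.exp (117 * L : ℕ) := by
    refine (mul_le_mul (le_exp_mul_natCast (n := 6) (by norm_num) hL) hm_exp (Nat.cast_nonneg m)
      (Real.exp_pos _).le).trans_eq ?_
    rw [← Real.exp_add]
    push_cast
    ring_nf
  obtain ⟨hsq, hcube⟩ := numScales_overhead_le (numScales_le (by omega) hL hm_exp) hL
  exact ⟨m, isSufficient_of_mul_max_le hε hm (by omega) hm_exp' hsq hcube (hF ▸ Nat.le_ceil _),
    hm_le⟩

lemma exists_isSufficient {ε : ℝ} {dA dB dC : ℕ} (hA : 1 ≤ dA) (hB : 1 ≤ dB) (hC : 1 ≤ dC)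
    (hε : 0 < ε) (hε₁ : ε ≤ 1) :
    ∃ m ℓ : ℕ, IsSufficient ε dA dB dC m ℓ ∧ 16 * (ℓ * m) ≤ rate (10 ^ 50) 11 ε dA dB dC := by
  have hA' : (1 : ℝ) ≤ dA := mod_cast hA
  have hB' : (1 : ℝ) ≤ dB := mod_cast hB
  have hC' : (1 : ℝ) ≤ dC := mod_cast hC
  have hF_le := max_fSym_fAsym_le hA' hB' hC' hε.le
  have hone := one_le_max_fSym_fAsym hA' hB' hC' hε hε₁
  have hlog : 1 ≤ Real.log (2 + dA * dB * dC / ε) := by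
    rw [Real.le_log_iff_exp_le (by positivity)]
    linarith [Real.exp_one_lt_d9]
  have hexp : max (fSym ε dA dB dC) (fAsym ε dA dB dC) ≤
      Real.exp ⌈Real.log (2 + dA * dB * dC / ε)⌉₊ :=
    hF_le.trans ((le_add_of_nonneg_left zero_le_two).trans
      ((Real.log_le_iff_le_exp (by positivity)).1 (Nat.le_ceil _)))
  have hceil : (⌈Real.log (2 + dA * dB * dC / ε)⌉₊ : ℝ) ≤ 2 * Real.log (2 + dA * dB * dC / ε) :=
    Nat.ceil_le_two_mul (by linarith)
  obtain ⟨m, h, hm⟩ := exists_isSufficient_of_le_exp hε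
    (Nat.one_le_ceil_iff.2 (zero_lt_one.trans_le hlog)) hone hexp
  refine ⟨m, _, h, ?_⟩
  rw [rate]
  set F := max (fSym ε dA dB dC) (fAsym ε dA dB dC)
  set y := Real.log (2 + dA * dB * dC / ε)
  calc 16 * ((117 * ⌈y⌉₊ : ℕ) * m : ℝ)
      ≤ 16 * ((117 * ⌈y⌉₊ : ℕ) * (2 * (10 ^ 40 * ⌈y⌉₊ ^ 10) * F)) := by gcongr
    _ = 3744 * 10 ^ 40 * (⌈y⌉₊ : ℝ) ^ 11 * F := by
      push_cast
      ring
    _ ≤ 3744 * 10 ^ 40 * (2 * y) ^ 11 * F := by gcongr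
    _ = 3744 * 10 ^ 40 * 2 ^ 11 * y ^ 11 * F := by ring
    _ ≤ 10 ^ 50 * y ^ 11 * F := by
      gcongr
      norm_num

end Parameters

section HellingerRate

variable {A B C : Type} [Fintype A] [Fintype B] [Fintype C] [Nonempty A] [Nonempty C] {ε : ℝ}

lemma hellingerSq_markovRef_le_one {P : A × B × C → ℝ} (hP : P ∈ stdSimplex ℝ (A × B × C)) :
    hellingerSq P (markovRef P) ≤ 1 := by
  obtain ⟨q, hq, p, hp, rfl, -⟩ := exists_eq_joint hP
  calc hellingerSq (joint q p) (markovRef (joint q p))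
      = 1 / 2 * ∑ b, q b * ∑ z, cellHellinger (p b) z := hellingerSq_joint_markovRef hq hp
    _ ≤ 1 / 2 * ∑ b, q b * 2 := by
      gcongr with b
      exacts [hq.1 b, sum_cellHellinger_le (hp b)]
    _ = 1 := by
      rw [← sum_mul, hq.2]
      norm_num

lemma scCIndep_hellingerSq_eq_zero (hε : 1 < ε) :
    scCIndep (A := A) (B := B) (C := C) hellingerSq ε = 0 := by
  refine nonpos_iff_eq_zero.1 (sInf_le ⟨0, rfl, fun _ => 1, fun P hP =>
    ⟨fun _ => ?_, fun hfar => absurd (hellingerSq_markovRef_le_one hP) (by linarith)⟩⟩)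
  norm_num [yesProb]

theorem scCIndep_hellingerSq_le_rate [Nonempty B] (hCA : Fintype.card C ≤ Fintype.card A)
    (hε : 0 < ε) :
    (scCIndep (A := A) (B := B) (C := C) hellingerSq ε : ℝ≥0∞) ≤
      ENNReal.ofReal (rate (10 ^ 50) 11 ε (Fintype.card A) (Fintype.card B) (Fintype.card C)) := by
  rcases le_or_gt ε 1 with hε₁ | hε₁
  · obtain ⟨m, ℓ, hsufficient, hrate⟩ := exists_isSufficient (dA := Fintype.card A)
      (dB := Fintype.card B) (dC := Fintype.card C) Fintype.card_pos Fintype.card_pos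
      Fintype.card_pos hε hε₁
    calc (scCIndep (A := A) (B := B) (C := C) hellingerSq ε : ℝ≥0∞)
        ≤ ((16 * (ℓ * m) : ℕ) : ℕ∞) :=
          ENat.toENNReal_mono (scCIndep_hellingerSq_le hCA hε.le hsufficient)
      _ = ENNReal.ofReal (16 * (ℓ * m) : ℕ) := by simp only [ENat.toENNReal_coe,
        ENNReal.ofReal_natCast]
      _ ≤ _ := ENNReal.ofReal_le_ofReal (mod_cast hrate)
  · rw [scCIndep_hellingerSq_eq_zero hε₁, ENat.toENNReal_zero]
    exact zero_le

end HellingerRate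

/-! ### Kullback–Leibler divergence and Hellinger distance -/

/-- The term of the Kullback–Leibler divergence at probabilities `x` and `y`, plus `y - x`. The
correction sums to zero over two distributions and makes the term nonnegative. -/
def klTerm (x y : ℝ) : ℝ := x * Real.log (x / y) - x + y

section KLTerm

variable {x y s t M : ℝ}

lemma sq_sqrt_sub_sqrt_le_klTerm (hx : 0 ≤ x) (hy : 0 ≤ y) (hxy : y = 0 → x = 0) :
    (√x - √y) ^ 2 ≤ klTerm x y := by
  rw [klTerm]
  rcases hx.eq_or_lt with rfl | hx'
  · simp [Real.sq_sqrt hy]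
  have hy' : 0 < y := hy.lt_of_ne fun h => hx'.ne' (hxy h.symm)
  have hlog : -Real.log (x / y) / 2 ≤ √y / √x - 1 := by
    rw [← Real.log_inv, inv_div, ← Real.log_sqrt (by positivity), Real.sqrt_div hy]
    exact Real.log_le_sub_one_of_pos (by positivity)
  have hsqrt : x * (√y / √x) = √x * √y := by
    rw [mul_div_assoc', mul_comm x, mul_div_assoc, Real.div_sqrt, mul_comm]
  have := mul_le_mul_of_nonneg_left hlog hx
  linarith [Real.sq_sqrt hx, Real.sq_sqrt hy, sub_sq (√x) (√y)]

lemma klTerm_le_of_le_four_mul (hx : 0 ≤ x) (hy : 0 < y) (h : x ≤ 4 * y) :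
    klTerm x y ≤ 9 * (√x - √y) ^ 2 := by
  have hlog : x * Real.log (x / y) ≤ x * (x / y - 1) := by
    rcases hx.eq_or_lt with rfl | hx'
    · simp
    · gcongr
      exact Real.log_le_sub_one_of_pos (by positivity)
  have hsqrt : √x + √y ≤ 3 * √y := by
    have : √x ≤ 2 * √y := by
      refine Real.sqrt_le_iff.2 ⟨by positivity, ?_⟩
      rw [mul_pow, Real.sq_sqrt hy.le]
      linarith
    linarith
  calc klTerm x y ≤ x * (x / y - 1) - x + y := by
        rw [klTerm]
        gcongr
    _ = (x - y) ^ 2 / y := by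
      field_simp
      ring
    _ = (√x - √y) ^ 2 * (√x + √y) ^ 2 / y := by
      rw [← mul_pow, mul_comm (√x - √y), ← sq_sub_sq, Real.sq_sqrt hx, Real.sq_sqrt hy.le]
    _ ≤ (√x - √y) ^ 2 * (3 * √y) ^ 2 / y := by gcongr
    _ = 9 * (√x - √y) ^ 2 := by
      rw [mul_pow, Real.sq_sqrt hy.le]
      field_simp
      norm_num

lemma klTerm_le_of_four_mul_le (hy : 0 < y) (h : 4 * y ≤ x) (hxM : x ≤ M ^ 2 * y) :
    klTerm x y ≤ 8 * Real.log M * (√x - √y) ^ 2 := by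
  have hx : 0 < x := by linarith
  have hlog : Real.log (x / y) ≤ 2 * Real.log M := by
    rw [show (2 : ℝ) = (2 : ℕ) by norm_num, ← Real.log_pow]
    exact Real.log_le_log (by positivity) ((div_le_iff₀ hy).2 hxM)
  have hsqrt : √y ≤ √x / 2 := by
    rw [le_div_iff₀ two_pos]
    refine Real.le_sqrt_of_sq_le ?_
    rw [mul_pow, Real.sq_sqrt hy.le]
    linarith
  have hx_le : x ≤ 4 * (√x - √y) ^ 2 := calc
    x = 4 * (√x - √x / 2) ^ 2 := by
      nth_rw 1 [← Real.sq_sqrt hx.le]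
      ring
    _ ≤ 4 * (√x - √y) ^ 2 := by
      gcongr
      linarith [Real.sqrt_nonneg x]
  calc klTerm x y ≤ x * Real.log (x / y) := by
        rw [klTerm]
        linarith
    _ ≤ 4 * (√x - √y) ^ 2 * (2 * Real.log M) := by
      refine mul_le_mul hx_le hlog (Real.log_nonneg ?_) (by positivity)
      exact (one_le_div hy).2 (by linarith)
    _ = 8 * Real.log M * (√x - √y) ^ 2 := by ring

lemma klTerm_le_mul_sq_sqrt_sub_sqrt (hx : 0 ≤ x) (hy : 0 < y) (hM : 1 ≤ M) (h : x ≤ M ^ 2 * y) :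
    klTerm x y ≤ (9 + 8 * Real.log M) * (√x - √y) ^ 2 := by
  have := mul_nonneg (Real.log_nonneg hM) (sq_nonneg (√x - √y))
  rcases le_total x (4 * y) with hxy | hxy
  · linarith [klTerm_le_of_le_four_mul hx hy hxy]
  · linarith [klTerm_le_of_four_mul_le hy hxy h, sq_nonneg (√x - √y)]

lemma negMulLog_le_two_mul_sqrt (hx : 0 ≤ x) : Real.negMulLog x ≤ 2 * √x := by
  rcases hx.eq_or_lt with rfl | hx'
  · simp
  have hlog : -(Real.log x / 2) ≤ (√x)⁻¹ := by
    rw [← Real.log_sqrt hx, ← Real.log_inv]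
    exact Real.log_le_self (by positivity)
  calc Real.negMulLog x = 2 * (x * -(Real.log x / 2)) := by
        rw [Real.negMulLog]
        ring
    _ ≤ 2 * (x * (√x)⁻¹) := by gcongr
    _ = 2 * √x := by rw [← div_eq_mul_inv, Real.div_sqrt]

lemma klTerm_mul_le_of_lt (hs : 0 < s) (ht : 0 < t) (hxs : x ≤ s) (hxt : x ≤ t) (hM : 1 ≤ M)
    (h : M ^ 2 * (s * t) < x) : klTerm x (s * t) ≤ 2 / M := by
  have : 0 < M := zero_lt_one.trans_le hM
  have hx : 0 < x := lt_of_le_of_lt (by positivity) h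
  have ht_le : t ≤ M⁻¹ ^ 2 := by
    rw [inv_pow, ← one_div, le_div_iff₀' (by positivity)]
    refine le_of_mul_le_mul_left ?_ hs
    linarith
  have hst_le : s * t ≤ x := (le_mul_of_one_le_left (by positivity) (one_le_pow₀ hM)).trans h.le
  have hlog : Real.log (x / (s * t)) ≤ -Real.log t := by
    rw [← Real.log_inv]
    refine Real.log_le_log (by positivity) ?_
    rw [div_le_iff₀ (by positivity), mul_comm s, inv_mul_cancel_left₀ ht.ne']
    exact hxs
  calc klTerm x (s * t) ≤ x * Real.log (x / (s * t)) := by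
        rw [klTerm]
        linarith
    _ ≤ t * -Real.log t := by
      refine mul_le_mul hxt hlog (Real.log_nonneg ?_) ht.le
      exact (one_le_div (by positivity)).2 hst_le
    _ = Real.negMulLog t := by rw [Real.negMulLog, neg_mul, mul_neg]
    _ ≤ 2 * √t := negMulLog_le_two_mul_sqrt ht.le
    _ ≤ 2 * M⁻¹ := by
      gcongr
      exact Real.sqrt_le_iff.2 ⟨by positivity, ht_le⟩
    _ = 2 / M := rfl

end KLTerm

/-- Mutual information of a pair of random variables with joint distribution `p`. -/
def mutualInfo {A C : Type} [Fintype A] [Fintype C] (p : A × C → ℝ) : ℝ :=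
  klDivergence p (prodWeight (margFst p) (margSnd p))

section MutualInfo

variable {A C : Type} [Fintype A] [Fintype C] {p : A × C → ℝ} {M : ℝ}

lemma le_margFst (hp : p ∈ stdSimplex ℝ (A × C)) (z : A × C) : p z ≤ margFst p z.1 :=
  single_le_sum (f := fun c => p (z.1, c)) (fun _ _ => hp.1 _) (mem_univ z.2)

lemma le_margSnd (hp : p ∈ stdSimplex ℝ (A × C)) (z : A × C) : p z ≤ margSnd p z.2 :=
  single_le_sum (f := fun a => p (a, z.2)) (fun _ _ => hp.1 _) (mem_univ z.1)

lemma eq_zero_of_margFst_mul_margSnd_eq_zero (hp : p ∈ stdSimplex ℝ (A × C)) {z : A × C}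
    (h : margFst p z.1 * margSnd p z.2 = 0) : p z = 0 := by
  refine le_antisymm ?_ (hp.1 z)
  rcases mul_eq_zero.1 h with h | h
  · exact (le_margFst hp z).trans h.le
  · exact (le_margSnd hp z).trans h.le

lemma mutualInfo_eq_sum_klTerm (hp : p ∈ stdSimplex ℝ (A × C)) :
    mutualInfo p = ∑ z, klTerm (p z) (margFst p z.1 * margSnd p z.2) := by
  have hprod : ∑ z : A × C, margFst p z.1 * margSnd p z.2 = 1 :=
    (prodWeight_marg_mem_stdSimplex hp).2
  simp only [klTerm, sum_add_distrib, sum_sub_distrib, hprod, hp.2, sub_add_cancel]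
  rfl

lemma sum_cellHellinger_le_mutualInfo (hp : p ∈ stdSimplex ℝ (A × C)) :
    ∑ z, cellHellinger p z ≤ mutualInfo p := by
  rw [mutualInfo_eq_sum_klTerm hp]
  exact sum_le_sum fun z _ => sq_sqrt_sub_sqrt_le_klTerm (hp.1 z) (margFst_mul_margSnd_nonneg hp z)
    (eq_zero_of_margFst_mul_margSnd_eq_zero hp)

lemma klTerm_le_cellHellinger (hp : p ∈ stdSimplex ℝ (A × C)) (z : A × C) (hM : 1 ≤ M) :
    klTerm (p z) (margFst p z.1 * margSnd p z.2) ≤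
      (9 + 8 * Real.log M) * cellHellinger p z + 2 / M := by
  have hlogM := Real.log_nonneg hM
  have hcell := cellHellinger_nonneg p z
  have hA := (margFst_mem_stdSimplex hp).1 z.1
  have hC := (margSnd_mem_stdSimplex hp).1 z.2
  rcases (mul_nonneg hA hC).eq_or_lt with hprod | hprod
  · rw [← hprod, eq_zero_of_margFst_mul_margSnd_eq_zero hp hprod.symm, klTerm, zero_mul, sub_zero,
      add_zero]
    positivity
  rcases le_or_gt (p z) (M ^ 2 * (margFst p z.1 * margSnd p z.2)) with hle | hlt
  · exact le_add_of_le_of_nonneg (klTerm_le_mul_sq_sqrt_sub_sqrt (hp.1 z) hprod hM hle)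
      (by positivity)
  · exact le_add_of_nonneg_of_le (by positivity) (klTerm_mul_le_of_lt
      (pos_of_mul_pos_left hprod hC) (pos_of_mul_pos_right hprod hA) (le_margFst hp z)
      (le_margSnd hp z) hM hlt)

lemma mutualInfo_le (hp : p ∈ stdSimplex ℝ (A × C)) (hM : 1 ≤ M) :
    mutualInfo p ≤ (9 + 8 * Real.log M) * ∑ z, cellHellinger p z +
      Fintype.card A * Fintype.card C * (2 / M) := by
  rw [mutualInfo_eq_sum_klTerm hp]
  refine (sum_le_sum fun z _ => klTerm_le_cellHellinger hp z hM).trans_eq ?_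
  simp [sum_add_distrib, mul_sum]

end MutualInfo

section Divergence

variable {A B C : Type} [Fintype A] [Fintype B] [Fintype C]

lemma hellingerSq_nonneg {X : Type} [Fintype X] (P Q : X → ℝ) : 0 ≤ hellingerSq P Q :=
  mul_nonneg (by norm_num) (sum_nonneg fun _ _ => sq_nonneg _)

lemma klDivergence_joint_markovRef (q : B → ℝ) {p : B → A × C → ℝ}
    (hp : ∀ b, p b ∈ stdSimplex ℝ (A × C)) :
    klDivergence (joint q p) (markovRef (joint q p)) = ∑ b, q b * mutualInfo (p b) := by
  rw [markovRef_joint q hp, klDivergence, sum_triple_eq_sum_bin]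
  simp only [mutualInfo, klDivergence, mul_sum, joint]
  refine sum_congr rfl fun b _ => sum_congr rfl fun z _ => ?_
  by_cases hb : q b = 0
  · simp [hb]
  · rw [mul_div_mul_left _ _ hb, mul_assoc]

variable [Nonempty A] [Nonempty C] {P : A × B × C → ℝ}

lemma two_mul_hellingerSq_markovRef_le_klDivergence (hP : P ∈ stdSimplex ℝ (A × B × C)) :
    2 * hellingerSq P (markovRef P) ≤ klDivergence P (markovRef P) := by
  obtain ⟨q, hq, p, hp, rfl, -⟩ := exists_eq_joint hP
  rw [hellingerSq_joint_markovRef hq hp, klDivergence_joint_markovRef q hp, ← mul_assoc,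
    mul_one_div_cancel two_ne_zero, one_mul]
  gcongr with b
  exacts [hq.1 b, sum_cellHellinger_le_mutualInfo (hp b)]

lemma klDivergence_markovRef_le (hP : P ∈ stdSimplex ℝ (A × B × C)) {M : ℝ} (hM : 1 ≤ M) :
    klDivergence P (markovRef P) ≤ (9 + 8 * Real.log M) * (2 * hellingerSq P (markovRef P)) +
      Fintype.card A * Fintype.card C * (2 / M) := by
  obtain ⟨q, hq, p, hp, rfl, -⟩ := exists_eq_joint hP
  rw [hellingerSq_joint_markovRef hq hp, klDivergence_joint_markovRef q hp]
  calc ∑ b, q b * mutualInfo (p b)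
      ≤ ∑ b, q b * ((9 + 8 * Real.log M) * ∑ z, cellHellinger (p b) z +
          Fintype.card A * Fintype.card C * (2 / M)) := by
        gcongr with b
        exacts [hq.1 b, mutualInfo_le (hp b) hM]
    _ = (9 + 8 * Real.log M) * (2 * (1 / 2 * ∑ b, q b * ∑ z, cellHellinger (p b) z)) +
          Fintype.card A * Fintype.card C * (2 / M) := by
        simp only [mul_add, sum_add_distrib, ← sum_mul, hq.2, mul_left_comm (q _), ← mul_sum]
        ring

lemma le_hellingerSq_markovRef_of_le_klDivergence (hP : P ∈ stdSimplex ℝ (A × B × C)) {ε : ℝ}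
    (hε : 0 < ε) (hfar : ε ≤ klDivergence P (markovRef P)) :
    ε / (168 * Real.log (2 + Fintype.card A * Fintype.card C / ε)) ≤
      hellingerSq P (markovRef P) := by
  have hH := hellingerSq_nonneg P (markovRef P)
  obtain ⟨u, hu, hcard⟩ : ∃ u : ℝ, 0 ≤ u ∧ (Fintype.card A * Fintype.card C : ℝ) = u * ε :=
    ⟨_, by positivity, (div_mul_cancel₀ _ hε.ne').symm⟩
  have hKL := klDivergence_markovRef_le hP (M := 2 + 4 * u) (by linarith)
  rw [hcard] at hKL ⊢
  rw [mul_div_cancel_right₀ _ hε.ne']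
  have hlog_half := half_le_log_two_add hu
  have herror : u * ε * (2 / (2 + 4 * u)) ≤ ε / 2 := by
    rw [mul_div_assoc', div_le_div_iff₀ (by positivity) two_pos]
    linarith
  have hlog : Real.log (2 + 4 * u) ≤ 3 * Real.log (2 + u) := by
    rw [show (3 : ℝ) = (3 : ℕ) by norm_num, ← Real.log_pow]
    refine Real.log_le_log (by positivity) ?_
    nlinarith [pow_nonneg hu 3, pow_nonneg hu 2]
  have hmain : (9 + 8 * Real.log (2 + 4 * u)) * (2 * hellingerSq P (markovRef P)) ≤
      42 * Real.log (2 + u) * (2 * hellingerSq P (markovRef P)) := by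
    gcongr
    linarith
  rw [div_le_iff₀ (by positivity)]
  linarith

variable {ε : ℝ}

theorem scCIndep_klDivergence_le (hε : 0 < ε) :
    scCIndep (A := A) (B := B) (C := C) klDivergence ε ≤
      scCIndep (A := A) (B := B) (C := C) hellingerSq
        (ε / (168 * Real.log (2 + Fintype.card A * Fintype.card C / ε))) := by
  refine sInf_le_sInf ?_
  rintro n ⟨N, rfl, T, hT⟩
  refine ⟨N, rfl, T, fun P hP => ⟨fun h => (hT P hP).1 ?_, fun hfar => (hT P hP).2 ?_⟩⟩
  · linarith [two_mul_hellingerSq_markovRef_le_klDivergence hP, hellingerSq_nonneg P (markovRef P)]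
  · exact le_hellingerSq_markovRef_of_le_klDivergence hP hε hfar

theorem scCIndep_klDivergence_le_rate [Nonempty B] (hCA : Fintype.card C ≤ Fintype.card A)
    (hε : 0 < ε) :
    (scCIndep (A := A) (B := B) (C := C) klDivergence ε : ℝ≥0∞) ≤
      ENNReal.ofReal (rate (10 ^ 66) 13 ε (Fintype.card A) (Fintype.card B) (Fintype.card C)) := by
  have hhalf := half_le_log_two_add
    (show (0 : ℝ) ≤ Fintype.card A * Fintype.card C / ε by positivity)
  have hlog : Real.log (2 + Fintype.card A * Fintype.card C / ε) ≤
      Real.log (2 + Fintype.card A * Fintype.card B * Fintype.card C / ε) := by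
    gcongr
    exact le_mul_of_one_le_right (by positivity) (mod_cast Fintype.card_pos)
  calc (scCIndep (A := A) (B := B) (C := C) klDivergence ε : ℝ≥0∞)
      ≤ scCIndep (A := A) (B := B) (C := C) hellingerSq
          (ε / (168 * Real.log (2 + Fintype.card A * Fintype.card C / ε))) :=
        ENat.toENNReal_mono (scCIndep_klDivergence_le hε)
    _ ≤ ENNReal.ofReal (rate (10 ^ 50) 11
          (ε / (168 * Real.log (2 + Fintype.card A * Fintype.card C / ε)))
          (Fintype.card A) (Fintype.card B) (Fintype.card C)) :=
        scCIndep_hellingerSq_le_rate hCA (by positivity)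
    _ ≤ _ := ENNReal.ofReal_le_ofReal (rate_div_le (by positivity) (by positivity) (by positivity)
        hε (by linarith) (by linarith))

end Divergence

end CMITest

end

theorem mainTheorem2 :
    -- conditional independence testing in squared Hellinger distance
    (∃ (K : ℝ) (k : ℕ), 0 < K ∧
      ∀ (dA dB dC : ℕ) (ε : ℝ), 1 ≤ dB → 1 ≤ dC → dC ≤ dA → 0 < ε →
        (CMITest.scHellinger ε dA dB dC : ℝ≥0∞) ≤
          ENNReal.ofReal (CMITest.rate K k ε dA dB dC)) ∧
    -- CMI testing
    (∃ (K : ℝ) (k : ℕ), 0 < K ∧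
      ∀ (dA dB dC : ℕ) (ε : ℝ), 1 ≤ dB → 1 ≤ dC → dC ≤ dA → 0 < ε →
        (CMITest.scCMI ε dA dB dC : ℝ≥0∞) ≤
          ENNReal.ofReal (CMITest.rate K k ε dA dB dC)) ∧
    -- CMI testing costs no more than testing in squared Hellinger distance, up to a logarithmic
    -- factor in the threshold
    (∃ K : ℝ, 0 < K ∧
      ∀ (dA dB dC : ℕ) (ε : ℝ), 1 ≤ dB → 1 ≤ dC → dC ≤ dA → 0 < ε →
        CMITest.scCMI ε dA dB dC ≤
          CMITest.scHellinger (ε / (K * Real.log (2 + dA * dC / ε))) dA dB dC) := by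
  refine ⟨⟨10 ^ 50, 11, by positivity, fun dA dB dC ε hB hC hCA hε => ?_⟩,
    ⟨10 ^ 66, 13, by positivity, fun dA dB dC ε hB hC hCA hε => ?_⟩,
    ⟨168, by norm_num, fun dA dB dC ε hB hC hCA hε => ?_⟩⟩
  all_goals
    have : Nonempty (Fin dA) := ⟨⟨0, hC.trans hCA⟩⟩
    have : Nonempty (Fin dB) := ⟨⟨0, hB⟩⟩
    have : Nonempty (Fin dC) := ⟨⟨0, hC⟩⟩
  · simpa [CMITest.scHellinger] using CMITest.scCIndep_hellingerSq_le_rate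
      (A := Fin dA) (B := Fin dB) (C := Fin dC) (by simpa using hCA) hε
  · simpa [CMITest.scCMI] using CMITest.scCIndep_klDivergence_le_rate
      (A := Fin dA) (B := Fin dB) (C := Fin dC) (by simpa using hCA) hε
  · simpa [CMITest.scHellinger, CMITest.scCMI] using CMITest.scCIndep_klDivergence_le
      (A := Fin dA) (B := Fin dB) (C := Fin dC) hε
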